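/- **The highway problem.** An instance consists of a path with $n$ edges (the items), a capacity $c_e\in\mathbb N$ for each edge $e$, and $m$ single-minded agents. Agent $i$ requests a nonempty interval $S_i$ of consecutive edges and has a rational valuation $v_i\ge 0$; for a set $S$ of edges, $v_i(S)=v_i$ if $S_i\subseteq S$ and $v_i(S)=0$ otherwise. An allocation/pricing $(a,p)$ consists of a set $a_i$ of edges for each agent $i$ and a payment function $p$ that assigns a real number to each set of edges. It is feasible if each edge $e$ belongs to at most $c_e$ of the sets $a_i$. Its revenue is $\sum_{i:\,a_i\neq\emptyset}p(a_i)$. With $z_i=\max_S\,(v_i(S)-p(S))$, the allocation/pricing $(a,p)$ is *envy free* if for every agent $i$: if $z_i>0$, then $v_i(a_i)-p(a_i)=z_i$; if $z_i=0$, then $v_i(a_i)-p(a_i)=z_i$ or $a_i=\emptyset$; if $z_i<0$, then $a_i=\emptyset$. It is *multi envy free* if it is envy free and $p$ is monotone: $p(S)\le\sum_{T\in\mathcal C}p(T)$ for every set $S$ of edges and every collection $\mathcal C$ of sets of edges with $S\subseteq\bigcup_{T\in\mathcal C}T$. **Theorem.** For every constant $C$ there is a fully polynomial time approximation scheme for revenue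 maximization under multi envy freeness in the highway problem with all edge capacities at most $C$. That is, for every $C\in\mathbb N$ there are a random access machine program and a polynomial $P$ such that, for every instance with $c_e\le C$ for all $e$ and every rational $\epsilon>0$, the program on input the instance and $\epsilon$ (all numbers in binary) halts within time $P(L+\lceil 1/\epsilon\rceil)$, where $L$ is the length of the input and time is counted by the logarithmic cost criterion. It outputs for each agent whether it wins (and then receives exactly $S_i$) or loses (and then receives nothing), together with the payments of the winning agents. The output allocation is feasible, and there is a payment function $p$ that charges each winning agent its stated payment such that the output allocation with $p$ is multi envy free and has revenue at least $(1-\epsilon)$ times the revenue of every feasible multi envy free allocation/pricing of the instance. -/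

import Mathlib

/-! ### Allocations, pricings and envy

`E` is the set of items and `ι` the set of agents.  Agent `i` values a set `S` of items at `v i S`,
the set allocated to agent `i` is `a i`, and `p S` is the payment required for the set `S`. -/

namespace Auction

variable {ι E : Type*} [Fintype E] [DecidableEq E]

/-- The number `max_S (v(S) - p(S))` for an agent with valuation function `v`. -/
noncomputable def maxUtility (v p : Finset E → ℝ) : ℝ :=
  (Finset.univ : Finset (Finset E)).sup' Finset.univ_nonempty (fun S => v S - p S)

/-- The collection of the sets that attain `max_S (v(S) - p(S))`. -/
def demand (v p : Finset E → ℝ) : Set (Finset E) :=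
  {S | v S - p S = maxUtility v p}

/-- The allocation/pricing `(a, p)` is envy free. -/
structure IsEnvyFree (v : ι → Finset E → ℝ) (a : ι → Finset E) (p : Finset E → ℝ) : Prop where
  of_pos : ∀ i, 0 < maxUtility (v i) p → a i ∈ demand (v i) p
  of_zero : ∀ i, maxUtility (v i) p = 0 → a i ∈ demand (v i) p ∨ a i = ∅
  of_neg : ∀ i, maxUtility (v i) p < 0 → a i = ∅

/-- The pricing `p` is monotone: a set costs at most as much as any collection of sets covering
it. -/
def IsMonotonePricing (p : Finset E → ℝ) : Prop :=
  ∀ (S : Finset E) (C : Finset (Finset E)), S ⊆ C.biUnion id → p S ≤ ∑ T ∈ C, p T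

/-- The allocation/pricing `(a, p)` is multi envy free. -/
def IsMultiEnvyFree (v : ι → Finset E → ℝ) (a : ι → Finset E) (p : Finset E → ℝ) : Prop :=
  IsEnvyFree v a p ∧ IsMonotonePricing p

/-- The revenue: the total payment of the winning agents (those with a nonempty set). -/
def revenue {ι E : Type*} [Fintype ι] [DecidableEq E] (a : ι → Finset E) (p : Finset E → ℝ) : ℝ :=
  ∑ i ∈ Finset.univ.filter (fun i => a i ≠ ∅), p (a i)

end Auction

/-! ### The highway problem with edge capacities -/

/-- An instance of the highway problem: a path with `n` edges (the items), `cap e` copies of the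
edge `e`, and `m` single-minded agents; agent `i` wants the interval of edges from `lo i` to `hi i`
(both included) and values it at `val i`. -/
structure Highway where
  n : ℕ
  m : ℕ
  cap : Fin n → ℕ
  lo : Fin m → Fin n
  hi : Fin m → Fin n
  lo_le_hi : ∀ i, lo i ≤ hi i
  val : Fin m → ℚ≥0

namespace Highway

/-- The interval requested by agent `i`. -/
def bundle (I : Highway) (i : Fin I.m) : Finset (Fin I.n) := Finset.Icc (I.lo i) (I.hi i)

/-- The single-minded valuation function of agent `i`. -/
def valuation (I : Highway) (i : Fin I.m) (S : Finset (Fin I.n)) : ℝ :=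
  if I.bundle i ⊆ S then ((I.val i : ℚ) : ℝ) else 0

/-- The allocation respects the supply: the edge `e` is allocated at most `cap e` times. -/
def Feasible (I : Highway) (a : Fin I.m → Finset (Fin I.n)) : Prop :=
  ∀ e, (Finset.univ.filter (fun i => e ∈ a i)).card ≤ I.cap e

/-- The input word of an algorithm for the highway problem with accuracy parameter `ε`:
`ε`, `n`, `m`, the capacities, and the interval and valuation of each agent.  A rational number is
given by its numerator and its denominator. -/
def encode (I : Highway) (ε : ℚ≥0) : List ℕ :=
  [ε.num, ε.den, I.n, I.m] ++ List.ofFn I.cap ++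
    (List.ofFn fun i : Fin I.m =>
      [(I.lo i : ℕ), (I.hi i : ℕ), (I.val i).num, (I.val i).den]).flatten

/-- The length of the input in bits (plus one for each number). -/
def inputSize (I : Highway) (ε : ℚ≥0) : ℕ := ((I.encode ε).map fun x => x.size + 1).sum

end Highway

/-! ### Random access machine programs with logarithmic cost -/

namespace RAM

/-- The memory: a natural number in each of the cells `0, 1, 2, …`. -/
abbrev Memory : Type := ℕ → ℕ

/-- Expressions; `read a` is the content of the cell whose address is the value of `a`. -/
inductive Expr : Type
  | lit (c : ℕ)
  | read (a : Expr)
  | add (a b : Expr)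
  | sub (a b : Expr)
  | mul (a b : Expr)
  | div (a b : Expr)

/-- The value of an expression (truncated subtraction, integer division). -/
def Expr.eval (μ : Memory) : Expr → ℕ
  | .lit c => c
  | .read a => μ (a.eval μ)
  | .add a b => a.eval μ + b.eval μ
  | .sub a b => a.eval μ - b.eval μ
  | .mul a b => a.eval μ * b.eval μ
  | .div a b => a.eval μ / b.eval μ

/-- The time to evaluate an expression: each operation is charged one unit plus the number of bits
of its operands (for a memory access: of the address and of the content). -/
def Expr.cost (μ : Memory) : Expr → ℕ
  | .lit c => 1 + c.size
  | .read a => a.cost μ + (1 + (a.eval μ).size + (μ (a.eval μ)).size)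
  | .add a b => a.cost μ + b.cost μ + (1 + (a.eval μ).size + (b.eval μ).size)
  | .sub a b => a.cost μ + b.cost μ + (1 + (a.eval μ).size + (b.eval μ).size)
  | .mul a b => a.cost μ + b.cost μ + (1 + (a.eval μ).size + (b.eval μ).size)
  | .div a b => a.cost μ + b.cost μ + (1 + (a.eval μ).size + (b.eval μ).size)

/-- Programs.  `write a e` stores the value of `e` in the cell whose address is the value of `a`;
`loop b P` repeats `P` while `b` is true; a condition is true when its value is not zero. -/
inductive Program : Type
  | skip
  | write (a e : Expr)
  | seq (P Q : Program)
  | ite (b : Expr) (P Q : Program)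
  | loop (b : Expr) (P : Program)

/-- `Exec P μ ν t`: started with memory `μ`, the program `P` halts with memory `ν` after time `t`,
under the logarithmic cost criterion. -/
inductive Exec : Program → Memory → Memory → ℕ → Prop
  | skip (μ : Memory) : Exec .skip μ μ 1
  | write (a e : Expr) (μ : Memory) :
      Exec (.write a e) μ (Function.update μ (a.eval μ) (e.eval μ))
        (a.cost μ + e.cost μ + (1 + (a.eval μ).size + (e.eval μ).size))
  | seq {P Q : Program} {μ ν ρ : Memory} {s t : ℕ} :
      Exec P μ ν s → Exec Q ν ρ t → Exec (.seq P Q) μ ρ (s + t)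
  | ite_true {b : Expr} {P Q : Program} {μ ν : Memory} {t : ℕ} :
      b.eval μ ≠ 0 → Exec P μ ν t → Exec (.ite b P Q) μ ν (b.cost μ + 1 + t)
  | ite_false {b : Expr} {P Q : Program} {μ ν : Memory} {t : ℕ} :
      b.eval μ = 0 → Exec Q μ ν t → Exec (.ite b P Q) μ ν (b.cost μ + 1 + t)
  | loop_true {b : Expr} {P : Program} {μ ν ρ : Memory} {s t : ℕ} :
      b.eval μ ≠ 0 → Exec P μ ν s → Exec (.loop b P) ν ρ t →
        Exec (.loop b P) μ ρ (b.cost μ + 1 + s + t)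
  | loop_false {b : Expr} {P : Program} {μ : Memory} :
      b.eval μ = 0 → Exec (.loop b P) μ μ (b.cost μ + 1)

/-- The memory that holds the word `x` in its first cells and zeros elsewhere. -/
def initial (x : List ℕ) : Memory := fun k => x.getD k 0

end RAM

/-! ### Reading off an allocation with payments from the final memory

The cells `2 i` and `2 i + 1` hold the numerator and the denominator of the payment of agent `i`;
denominator zero means that agent `i` loses. -/

namespace Highway

/-- The winning agents receive exactly the interval that they request, the losing ones nothing. -/
def outputAllocation (I : Highway) (μ : RAM.Memory) (i : Fin I.m) : Finset (Fin I.n) :=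
  if μ (2 * (i : ℕ) + 1) = 0 then ∅ else I.bundle i

/-- The payment of agent `i`; meaningful for the winning agents. -/
def outputPayment (I : Highway) (μ : RAM.Memory) (i : Fin I.m) : ℚ :=
  (μ (2 * (i : ℕ)) : ℚ) / (μ (2 * (i : ℕ) + 1) : ℚ)

/-- The payment function `p` charges each winning agent the payment stated in the output. -/
def AgreesWithOutput (I : Highway) (μ : RAM.Memory) (p : Finset (Fin I.n) → ℝ) : Prop :=
  ∀ i, I.outputAllocation μ i ≠ ∅ → p (I.outputAllocation μ i) = ((I.outputPayment μ i : ℚ) : ℝ)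

end Highway

/-!
An instance is solved exactly after rounding, and the solution is then repaired without loss.

Valuations are scaled to integers `u i`.  For a set `W` of winners, the price of a set `S` of edges
is the least total valuation of a set of winners whose intervals cover `S` (`Cover.price`).  This
pricing is monotone and charges a winner at most its valuation, so it is multi envy free as soon as
no loser values its interval higher than some cover of it by winners
(`Highway.isMultiEnvyFree_coverPricing`).  If a loser `j` does, exchange the cover for `j`: loads
do not grow, prices do not fall, the revenue does not fall, and a potential of size at most `m ^ 2`
falls.  Hence after `m ^ 2 + 1` exchanges no loser is envious (`Sweep.iterate_next_spec`), and it is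
enough to find a set `W` within the capacities for which the prices of the winners have a large sum.

By duality of covering and packing, the price of the interval of `i ∈ W` is at least the total of any
weights on its edges that put at most `u k` on its common edges with each `k ∈ W`
(`Sweep.Feas.le_price`).  Conversely, a multi envy free pricing `p` gives such weights: the
increments of `p` on the initial stretches of the interval of `i` (`Highway.candidate_served`).  The
weights are rounded to multiples of `ε U / (2 m ^ 2)`, where `U` is the largest valuation of an agent
that can be served.  Selling to that agent alone shows that the optimum is at least `U`, so the
rounding loses a fraction of at most `ε` (`Algo.one_sub_mul_le`).

The rounded problem is solved by a sweep along the path.  As no edge has capacity above `C`, the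
intervals of the winners can be coloured with `C` colours (`Sweep.exists_coloring`).  A state
consists of the agent in each colour and, for each pair of colours, of the weight that the first
agent has put on its common edges with the second one; these are `C + C ^ 2` digits in a base that is
polynomial in `m` and `1 / ε` (`Sweep.Data.table`, `Sweep.Data.exists_best`).  The low `m` binary
digits of a table entry hold the set of winners, so no traceback is needed; the same device makes the
least cover of an interval available from its weight alone (`Sweep.slack`).

For the running time, the algorithm is written as a list of array definitions, each giving the entry
`i` of an array by a term in the earlier entries.  Such lists are compiled to random access machine
programs (`Tab.exists_program`), and the time is polynomial in a bound on the lengths of the arrays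
and in the number of binary digits of their entries (`Algo.arr_bounded`).
-/


/-! ### Sizes of numbers and cost of single instructions -/

namespace Highway

theorem size_add_le (a b : ℕ) : (a + b).size ≤ a.size + b.size + 1 := by
  rw [Nat.size_le]
  have ha := Nat.lt_size_self a
  have hb := Nat.lt_size_self b
  have h1 : 2 ^ a.size ≤ 2 ^ (a.size + b.size) := Nat.pow_le_pow_right (by norm_num) (by omega)
  have h2 : 2 ^ b.size ≤ 2 ^ (a.size + b.size) := Nat.pow_le_pow_right (by norm_num) (by omega)
  rw [pow_succ]
  omega

theorem size_mul_le (a b : ℕ) : (a * b).size ≤ a.size + b.size := by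
  rw [Nat.size_le, pow_add]
  exact Nat.mul_lt_mul'' (Nat.lt_size_self a) (Nat.lt_size_self b)

theorem size_sub_le (a b : ℕ) : (a - b).size ≤ a.size := Nat.size_le_size (Nat.sub_le a b)

theorem size_div_le (a b : ℕ) : (a / b).size ≤ a.size := Nat.size_le_size (Nat.div_le_self a b)

end Highway

namespace RAM

open Highway

/-- Every cell of the memory holds a number of at most `s` bits. -/
def Bdd (s : ℕ) (μ : Memory) : Prop := ∀ k, (μ k).size ≤ s

theorem Bdd.update {s : ℕ} {μ : Memory} (h : Bdd s μ) {k v : ℕ} (hv : v.size ≤ s) :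
    Bdd s (Function.update μ k v) := by
  intro j
  by_cases hj : j = k
  · subst hj; simpa using hv
  · simpa [Function.update_of_ne hj] using h j

/-- In a memory with cells of at most `s` bits, the value and the cost of a fixed expression are
linear in `s`. -/
theorem Expr.exists_cost_le (e : Expr) : ∃ c, ∀ (μ : Memory) (s : ℕ), Bdd s μ →
    (e.eval μ).size ≤ c * (s + 1) ∧ e.cost μ ≤ c * (s + 1) := by
  induction e with
  | lit c =>
    refine ⟨1 + c.size, fun μ s _ => ?_⟩
    simp only [Expr.eval, Expr.cost]
    constructor <;> nlinarith [Nat.zero_le (c.size * s), Nat.zero_le s]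
  | read a ih =>
    obtain ⟨c, hc⟩ := ih
    refine ⟨2 * c + 2, fun μ s h => ?_⟩
    obtain ⟨h1, h2⟩ := hc μ s h
    have h3 := h (a.eval μ)
    simp only [Expr.eval, Expr.cost]
    constructor <;> nlinarith [Nat.zero_le (c * (s + 1))]
  | add a b iha ihb =>
    obtain ⟨c, hc⟩ := iha
    obtain ⟨d, hd⟩ := ihb
    refine ⟨2 * c + 2 * d + 1, fun μ s h => ?_⟩
    obtain ⟨h1, h2⟩ := hc μ s h
    obtain ⟨h3, h4⟩ := hd μ s h
    have := size_add_le (a.eval μ) (b.eval μ)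
    simp only [Expr.eval, Expr.cost]
    constructor <;> nlinarith [Nat.zero_le (c * (s + 1)), Nat.zero_le (d * (s + 1))]
  | sub a b iha ihb =>
    obtain ⟨c, hc⟩ := iha
    obtain ⟨d, hd⟩ := ihb
    refine ⟨2 * c + 2 * d + 1, fun μ s h => ?_⟩
    obtain ⟨h1, h2⟩ := hc μ s h
    obtain ⟨h3, h4⟩ := hd μ s h
    have := size_sub_le (a.eval μ) (b.eval μ)
    simp only [Expr.eval, Expr.cost]
    constructor <;> nlinarith [Nat.zero_le (c * (s + 1)), Nat.zero_le (d * (s + 1))]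
  | mul a b iha ihb =>
    obtain ⟨c, hc⟩ := iha
    obtain ⟨d, hd⟩ := ihb
    refine ⟨2 * c + 2 * d + 1, fun μ s h => ?_⟩
    obtain ⟨h1, h2⟩ := hc μ s h
    obtain ⟨h3, h4⟩ := hd μ s h
    have := size_mul_le (a.eval μ) (b.eval μ)
    simp only [Expr.eval, Expr.cost]
    constructor <;> nlinarith [Nat.zero_le (c * (s + 1)), Nat.zero_le (d * (s + 1))]
  | div a b iha ihb =>
    obtain ⟨c, hc⟩ := iha
    obtain ⟨d, hd⟩ := ihb
    refine ⟨2 * c + 2 * d + 1, fun μ s h => ?_⟩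
    obtain ⟨h1, h2⟩ := hc μ s h
    obtain ⟨h3, h4⟩ := hd μ s h
    have := size_div_le (a.eval μ) (b.eval μ)
    simp only [Expr.eval, Expr.cost]
    constructor <;> nlinarith [Nat.zero_le (c * (s + 1)), Nat.zero_le (d * (s + 1))]

theorem exec_write (a e : Expr) : ∃ c, ∀ (μ : Memory) (s : ℕ), Bdd s μ →
    ∃ t, Exec (.write a e) μ (Function.update μ (a.eval μ) (e.eval μ)) t ∧ t ≤ c * (s + 1) := by
  obtain ⟨c, hc⟩ := a.exists_cost_le
  obtain ⟨d, hd⟩ := e.exists_cost_le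
  refine ⟨2 * c + 2 * d + 1, fun μ s h => ⟨_, Exec.write a e μ, ?_⟩⟩
  obtain ⟨h1, h2⟩ := hc μ s h
  obtain ⟨h3, h4⟩ := hd μ s h
  nlinarith

/-- The invariant rule for a loop that runs exactly `N` times. -/
theorem exec_loop {b : Expr} {P : Program} (N tb : ℕ) (Inv : ℕ → Memory → Prop)
    (hstep : ∀ i < N, ∀ μ, Inv i μ → b.eval μ ≠ 0 ∧
      ∃ ν t, Exec P μ ν t ∧ b.cost μ + 1 + t ≤ tb ∧ Inv (i + 1) ν)
    (hend : ∀ μ, Inv N μ → b.eval μ = 0 ∧ b.cost μ + 1 ≤ tb) {μ : Memory} (h0 : Inv 0 μ) :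
    ∃ ν t, Exec (.loop b P) μ ν t ∧ t ≤ (N + 1) * tb ∧ Inv N ν := by
  suffices H : ∀ j ≤ N, ∀ μ, Inv (N - j) μ →
      ∃ ν t, Exec (.loop b P) μ ν t ∧ t ≤ (j + 1) * tb ∧ Inv N ν from
    H N le_rfl μ (by simpa using h0)
  intro j
  induction j with
  | zero =>
    intro _ μ hμ
    obtain ⟨h1, h2⟩ := hend μ hμ
    exact ⟨μ, _, Exec.loop_false h1, by simpa using h2, hμ⟩
  | succ j ih =>
    intro hj μ hμ
    obtain ⟨h1, ν, t, h2, h3, h4⟩ := hstep (N - (j + 1)) (by omega) μ hμ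
    rw [show N - (j + 1) + 1 = N - j by omega] at h4
    obtain ⟨ρ, t', h5, h6, h7⟩ := ih (by omega) ν h4
    refine ⟨ρ, _, Exec.loop_true h1 h2 h5, ?_, h7⟩
    nlinarith

end RAM

/-! ### Array definitions -/

namespace Tab

open RAM Highway

/-- The arithmetic operations. -/
inductive Op : Type
  | add
  | sub
  | mul
  | div

/-- The value of an arithmetic operation. -/
def Op.ap : Op → ℕ → ℕ → ℕ
  | .add => (· + ·)
  | .sub => (· - ·)
  | .mul => (· * ·)
  | .div => (· / ·)

/-- The instruction of the machine for an arithmetic operation. -/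
def Op.expr : Op → Expr → Expr → Expr
  | .add => .add
  | .sub => .sub
  | .mul => .mul
  | .div => .div

/-- Terms over the arrays `0, …, 29` and variables.  `fold mx p x f` is the maximum (if `mx`) or the
sum of the values of `f` as the variable `x` runs over `0, …, N - 1`, where `N` is the entry `0` of
the array `p + 1`.  The ten arrays that can serve as such ranges are the parameters. -/
inductive Term : Type
  | lit (c : ℕ)
  | var (x : ℕ)
  | get (a : Fin 30) (e : Term)
  | bin (o : Op) (a b : Term)
  | fold (mx : Bool) (p : Fin 10) (x : ℕ) (f : Term)

/-- The contents of the arrays. -/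
abbrev Store : Type := Fin 30 → ℕ → ℕ

/-- The array that holds the parameter `p`. -/
def parArr (p : Fin 10) : Fin 30 := ⟨p.val + 1, by omega⟩

/-- The maximum or the sum of the first `N` values of `f`. -/
def agg (mx : Bool) (N : ℕ) (f : ℕ → ℕ) : ℕ :=
  if mx then (Finset.range N).sup f else ∑ i ∈ Finset.range N, f i

/-- The operation behind `agg`. -/
def comb (mx : Bool) (a b : ℕ) : ℕ := if mx then a + (b - a) else a + b

theorem agg_zero (mx : Bool) (f : ℕ → ℕ) : agg mx 0 f = 0 := by
  cases mx <;> simp [agg]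

theorem agg_succ (mx : Bool) (N : ℕ) (f : ℕ → ℕ) :
    agg mx (N + 1) f = comb mx (agg mx N f) (f N) := by
  cases mx
  · simp [agg, comb, Finset.sum_range_succ]
  · simp only [agg, comb, if_true, Finset.range_add_one, Finset.sup_insert]
    rcases le_total (f N) ((Finset.range N).sup f) with h | h
    · rw [sup_eq_right.2 h]; omega
    · rw [sup_eq_left.2 h]; omega

theorem agg_mono (mx : Bool) {N N' : ℕ} (h : N ≤ N') (f : ℕ → ℕ) : agg mx N f ≤ agg mx N' f := by
  induction h with
  | refl => exact le_rfl
  | step _ ih =>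
    refine ih.trans ?_
    rw [Nat.succ_eq_add_one, agg_succ]
    unfold comb
    split_ifs <;> omega

/-- The value of a term. -/
def Term.eval (σ : Store) : (ℕ → ℕ) → Term → ℕ
  | _, .lit c => c
  | η, .var x => η x
  | η, .get a e => σ a (e.eval σ η)
  | η, .bin o a b => o.ap (a.eval σ η) (b.eval σ η)
  | η, .fold mx p x f => agg mx (σ (parArr p) 0) fun i => f.eval σ (Function.update η x i)

/-- All entries have at most `b` bits and the parameters are at most `R`. -/
structure Store.Bounded (b R : ℕ) (σ : Store) : Prop where
  size_le : ∀ a k, (σ a k).size ≤ b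
  par_le : ∀ p, σ (parArr p) 0 ≤ R

theorem Op.size_le (o : Op) (a b : ℕ) : (o.ap a b).size ≤ a.size + b.size + 1 := by
  cases o
  · exact size_add_le a b
  · exact (size_sub_le a b).trans (by omega)
  · exact (size_mul_le a b).trans (by omega)
  · exact (size_div_le a b).trans (by omega)

theorem agg_size_le (mx : Bool) (N : ℕ) (f : ℕ → ℕ) (s : ℕ) (h : ∀ i < N, (f i).size ≤ s) :
    (agg mx N f).size ≤ N.size + s := by
  have h1 : agg mx N f ≤ N * (2 ^ s - 1) := by
    have h2 : ∀ i < N, f i ≤ 2 ^ s - 1 := fun i hi => by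
      have := Nat.size_le.1 (h i hi); omega
    clear h
    induction N with
    | zero => simp [agg_zero]
    | succ N ih =>
      rw [agg_succ, Nat.succ_mul]
      have := ih fun i hi => h2 i (by omega)
      have := h2 N (by omega)
      unfold comb
      split_ifs <;> omega
  refine (Nat.size_le_size h1).trans ((size_mul_le _ _).trans ?_)
  have : (2 ^ s - 1).size ≤ s := by
    rw [Nat.size_le]
    exact Nat.sub_lt (Nat.two_pow_pos s) one_pos
  omega

theorem Term.exists_size_le (e : Term) : ∃ c, ∀ (σ : Store) (η : ℕ → ℕ) (b R : ℕ),
    σ.Bounded b R → (∀ x, (η x).size ≤ b) → R.size ≤ b → (e.eval σ η).size ≤ c * (b + 1) := by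
  induction e with
  | lit c =>
    refine ⟨c.size, fun σ η b R _ _ _ => ?_⟩
    simp only [Term.eval]
    nlinarith [Nat.zero_le (c.size * b)]
  | var x => exact ⟨1, fun σ η b R _ h _ => (h x).trans (by omega)⟩
  | get a e _ => exact ⟨1, fun σ η b R h _ _ => (h.size_le _ _).trans (by omega)⟩
  | bin o e f ihe ihf =>
    obtain ⟨c, hc⟩ := ihe
    obtain ⟨d, hd⟩ := ihf
    refine ⟨c + d + 1, fun σ η b R h1 h2 h3 => ?_⟩
    have := hc σ η b R h1 h2 h3
    have := hd σ η b R h1 h2 h3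
    have := o.size_le (e.eval σ η) (f.eval σ η)
    simp only [Term.eval]
    nlinarith
  | fold mx p x f ih =>
    obtain ⟨c, hc⟩ := ih
    refine ⟨c + 1, fun σ η b R h1 h2 h3 => ?_⟩
    simp only [Term.eval]
    have hN := Nat.size_le_size (h1.par_le p)
    refine (agg_size_le mx _ _ (c * (b + 1)) fun i hi => ?_).trans (by nlinarith)
    refine hc σ _ b R h1 (fun y => ?_) h3
    by_cases hy : y = x
    · subst hy
      simpa using (Nat.size_le_size (hi.le.trans (h1.par_le p))).trans h3
    · simpa [Function.update_of_ne hy] using h2 y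

end Tab

/-! ### Evaluation of terms by machine programs -/

namespace Tab

open RAM Highway

/-- The bound `c (R + 1)^c (s + 1)` on running times. -/
def timeBound (c R s : ℕ) : ℕ := c * (R + 1) ^ c * (s + 1)

theorem timeBound_mono {c c' R s s' : ℕ} (h : c ≤ c') (hs : s ≤ s') :
    timeBound c R s ≤ timeBound c' R s' := by
  unfold timeBound
  exact Nat.mul_le_mul (Nat.mul_le_mul h (Nat.pow_le_pow_right (by omega) h)) (by omega)

theorem timeBound_add_le (c d R s : ℕ) :
    timeBound c R s + timeBound d R s ≤ timeBound (c + d) R s := by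
  have h1 : c * (R + 1) ^ c ≤ c * (R + 1) ^ (c + d) :=
    Nat.mul_le_mul le_rfl (Nat.pow_le_pow_right (by omega) (by omega))
  have h2 : d * (R + 1) ^ d ≤ d * (R + 1) ^ (c + d) :=
    Nat.mul_le_mul le_rfl (Nat.pow_le_pow_right (by omega) (by omega))
  unfold timeBound
  rw [add_mul c d, ← add_mul]
  exact Nat.mul_le_mul (by omega) le_rfl

theorem linear_le_timeBound (c R s : ℕ) : c * (s + 1) ≤ timeBound c R s := by
  unfold timeBound
  have := Nat.one_le_pow c (R + 1) (by omega)
  exact Nat.mul_le_mul (by nlinarith) le_rfl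

theorem mul_timeBound_le (c R s : ℕ) : (R + 1) * timeBound c R s ≤ timeBound (c + 1) R s := by
  unfold timeBound
  rw [pow_succ, ← mul_assoc, ← mul_assoc]
  refine Nat.mul_le_mul ?_ le_rfl
  calc (R + 1) * c * (R + 1) ^ c = c * ((R + 1) ^ c * (R + 1)) := by ring
    _ ≤ (c + 1) * ((R + 1) ^ c * (R + 1)) := Nat.mul_le_mul (by omega) le_rfl
    _ = _ := by ring

/-- The address with offset `o` from the base address, which is kept in cell `3`. -/
def at' (o : ℕ) : Expr := .add (.read (.lit 3)) (.lit o)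

/-- The memory represents the arrays `σ` and the variables `η`: cell `3` holds the base address `B`,
and the entry `k` of the array `a` is at the offset `32 k + a`.  The residues `30` and `31` are for
temporary values and for variables. -/
structure Rep (B : ℕ) (σ : Store) (η : ℕ → ℕ) (μ : Memory) : Prop where
  base : μ 3 = B
  arr : ∀ (a : Fin 30) k, μ (B + (32 * k + a)) = σ a k
  var : ∀ x, μ (B + (32 * x + 31)) = η x

theorem Rep.eval_at' {B : ℕ} {σ : Store} {η : ℕ → ℕ} {μ : Memory} (h : Rep B σ η μ) (o : ℕ) :
    (at' o).eval μ = B + o := by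
  simp [at', Expr.eval, h.base]

theorem Rep.eval_read_at' {B : ℕ} {σ : Store} {η : ℕ → ℕ} {μ : Memory} (h : Rep B σ η μ) (o : ℕ) :
    (Expr.read (at' o)).eval μ = μ (B + o) := by
  simp [Expr.eval, h.eval_at']

/-- The temporary cells are disjoint from the cells of the arrays and of the variables. -/
theorem Rep.of_frame {B : ℕ} {σ : Store} {η : ℕ → ℕ} {μ ν : Memory} (hB : 4 ≤ B)
    (h : Rep B σ η μ) (hν : ∀ k, (∀ d, k ≠ B + (32 * d + 30)) → ν k = μ k) : Rep B σ η ν where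
  base := by rw [hν 3 fun d => by omega, h.base]
  arr a k := by rw [hν _ fun d => by have := a.2; omega, h.arr]
  var x := by rw [hν _ fun d => by omega, h.var]

theorem Rep.update_tmp {B : ℕ} {σ : Store} {η : ℕ → ℕ} {μ : Memory} (hB : 4 ≤ B)
    (h : Rep B σ η μ) (d v : ℕ) : Rep B σ η (Function.update μ (B + (32 * d + 30)) v) :=
  h.of_frame hB fun _ hk => Function.update_of_ne (hk d) _ _

theorem Rep.update_var {B : ℕ} {σ : Store} {η : ℕ → ℕ} {μ : Memory} (hB : 4 ≤ B)
    (h : Rep B σ η μ) (x v : ℕ) :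
    Rep B σ (Function.update η x v) (Function.update μ (B + (32 * x + 31)) v) where
  base := by rw [Function.update_of_ne (by omega), h.base]
  arr a k := by rw [Function.update_of_ne (by have := a.2; omega), h.arr]
  var y := by
    by_cases hy : y = x
    · subst hy; simp
    · rw [Function.update_of_ne (by omega), Function.update_of_ne hy, h.var]

theorem Rep.update_arr {B : ℕ} {σ : Store} {η : ℕ → ℕ} {μ : Memory} (hB : 4 ≤ B)
    (h : Rep B σ η μ) (a : Fin 30) (k v : ℕ) :
    Rep B (Function.update σ a (Function.update (σ a) k v)) η
      (Function.update μ (B + (32 * k + a)) v) where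
  base := by rw [Function.update_of_ne (by omega), h.base]
  arr a' k' := by
    by_cases ha : a' = a
    · subst ha
      by_cases hk : k' = k
      · subst hk; simp
      · rw [Function.update_of_ne (by omega), h.arr]; simp [Function.update_of_ne hk]
    · have : (a' : ℕ) ≠ a := fun h => ha (Fin.ext h)
      have := a.2
      have := a'.2
      rw [Function.update_of_ne (by omega), Function.update_of_ne ha, h.arr]
  var y := by rw [Function.update_of_ne (by have := a.2; omega), h.var]

/-- The loop of an aggregation over the variable `x`: bound in the temporary cell `d`, accumulator
in the cell `d + 1`, saved value of the variable in the cell `d + 2`. -/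
def foldProg (mx : Bool) (p : Fin 10) (x d : ℕ) (body : Program) : Program :=
  .seq (.write (at' (32 * d + 30)) (.read (at' (parArr p))))
  (.seq (.write (at' (32 * (d + 1) + 30)) (.lit 0))
  (.seq (.write (at' (32 * (d + 2) + 30)) (.read (at' (32 * x + 31))))
  (.seq (.write (at' (32 * x + 31)) (.lit 0))
  (.seq (.loop (.sub (.read (at' (32 * d + 30))) (.read (at' (32 * x + 31))))
      (.seq body
      (.seq (.write (at' (32 * (d + 1) + 30))
          (.add (.read (at' (32 * (d + 1) + 30)))
            (if mx then .sub (.read (at' (32 * (d + 3) + 30))) (.read (at' (32 * (d + 1) + 30)))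
              else .read (at' (32 * (d + 3) + 30)))))
        (.write (at' (32 * x + 31)) (.add (.read (at' (32 * x + 31))) (.lit 1))))))
  (.seq (.write (at' (32 * x + 31)) (.read (at' (32 * (d + 2) + 30))))
    (.write (at' (32 * d + 30)) (.read (at' (32 * (d + 1) + 30)))))))))

/-- The program that evaluates a term into the temporary cell `d`, with the temporary cells beyond
`d` as work space. -/
def Term.compile : Term → ℕ → Program
  | .lit c, d => .write (at' (32 * d + 30)) (.lit c)
  | .var x, d => .write (at' (32 * d + 30)) (.read (at' (32 * x + 31)))
  | .get a e, d => .seq (e.compile d) (.write (at' (32 * d + 30))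
      (.read (.add (.mul (.lit 32) (.read (at' (32 * d + 30)))) (at' a))))
  | .bin o e f, d => .seq (e.compile d) (.seq (f.compile (d + 1)) (.write (at' (32 * d + 30))
      (o.expr (.read (at' (32 * d + 30))) (.read (at' (32 * (d + 1) + 30))))))
  | .fold mx p x f, d => foldProg mx p x d (f.compile (d + 3))

/-- The program `P` evaluates the term `e` into the temporary cell `d`, changes no other cells than
the temporary ones from `d` on, and takes time at most `timeBound c R s`. -/
def Evaluates (P : Program) (e : Term) (d c : ℕ) : Prop :=
  ∀ (B b R s : ℕ) (σ : Store) (η : ℕ → ℕ) (μ : Memory), 4 ≤ B → σ.Bounded b R →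
    (∀ x, (η x).size ≤ b) → R.size ≤ b → c * (b + 1) ≤ s → b ≤ s → Bdd s μ → Rep B σ η μ →
    ∃ ν t, Exec P μ ν t ∧ t ≤ timeBound c R s ∧ ν (B + (32 * d + 30)) = e.eval σ η ∧
      (∀ k, (∀ d' ≥ d, k ≠ B + (32 * d' + 30)) → ν k = μ k) ∧ Bdd s ν

set_option maxHeartbeats 800000 in
/-- The loop evaluates the aggregation.  Its number of rounds is the value of a parameter, hence at
most `R`, which costs one more factor `R + 1` in the time bound. -/
theorem evaluates_fold {mx : Bool} {p : Fin 10} {x d c0 : ℕ} {f : Term} {body : Program}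
    (hf : Evaluates body f (d + 3) c0) :
    ∃ c, Evaluates (foldProg mx p x d body) (.fold mx p x f) d c := by
  obtain ⟨cz, hz⟩ := (Term.fold mx p x f).exists_size_le
  obtain ⟨c1, h1⟩ := exec_write (at' (32 * d + 30)) (.read (at' (parArr p)))
  obtain ⟨c2, h2⟩ := exec_write (at' (32 * (d + 1) + 30)) (.lit 0)
  obtain ⟨c3, h3⟩ := exec_write (at' (32 * (d + 2) + 30)) (.read (at' (32 * x + 31)))
  obtain ⟨c4, h4⟩ := exec_write (at' (32 * x + 31)) (.lit 0)
  obtain ⟨c5, h5⟩ := exec_write (at' (32 * (d + 1) + 30))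
    (.add (.read (at' (32 * (d + 1) + 30)))
      (if mx then .sub (.read (at' (32 * (d + 3) + 30))) (.read (at' (32 * (d + 1) + 30)))
        else .read (at' (32 * (d + 3) + 30))))
  obtain ⟨c6, h6⟩ := exec_write (at' (32 * x + 31)) (.add (.read (at' (32 * x + 31))) (.lit 1))
  obtain ⟨c7, h7⟩ := exec_write (at' (32 * x + 31)) (.read (at' (32 * (d + 2) + 30)))
  obtain ⟨c8, h8⟩ := exec_write (at' (32 * d + 30)) (.read (at' (32 * (d + 1) + 30)))
  obtain ⟨c9, h9⟩ := (Expr.sub (.read (at' (32 * d + 30)))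
    (.read (at' (32 * x + 31)))).exists_cost_le
  refine ⟨cz + (c1 + c2 + c3 + c4 + c7 + c8) + (c0 + c5 + c6 + c9 + 1 + 1),
    fun B b R s σ η μ hB hσ hη hR hs hbs hμ hrep => ?_⟩
  have hs0 : c0 * (b + 1) ≤ s := by nlinarith
  have hsz : cz * (b + 1) ≤ s := by nlinarith
  set N := σ (parArr p) 0 with hN
  have hNR : N ≤ R := hσ.par_le p
  have hNs : N.size ≤ s := (Nat.size_le_size hNR).trans (hR.trans hbs)
  obtain ⟨t1, e1, ht1⟩ := h1 μ s hμ
  have hp : μ (B + parArr p) = N := by rw [hN, ← hrep.arr]; simp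
  rw [hrep.eval_at', hrep.eval_read_at', hp] at e1
  have hμ1 := hμ.update (k := B + (32 * d + 30)) hNs
  have hrep1 := hrep.update_tmp hB d N
  set μ1 := Function.update μ (B + (32 * d + 30)) N with hμ1d
  obtain ⟨t2, e2, ht2⟩ := h2 μ1 s hμ1
  rw [hrep1.eval_at', Expr.eval] at e2
  have hμ2 := hμ1.update (k := B + (32 * (d + 1) + 30)) (v := 0) (by simp)
  have hrep2 := hrep1.update_tmp hB (d + 1) 0
  set μ2 := Function.update μ1 (B + (32 * (d + 1) + 30)) 0 with hμ2d
  obtain ⟨t3, e3, ht3⟩ := h3 μ2 s hμ2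
  rw [hrep2.eval_at', hrep2.eval_read_at', hrep2.var] at e3
  have hμ3 := hμ2.update (k := B + (32 * (d + 2) + 30)) ((hη x).trans hbs)
  have hrep3 := hrep2.update_tmp hB (d + 2) (η x)
  set μ3 := Function.update μ2 (B + (32 * (d + 2) + 30)) (η x) with hμ3d
  obtain ⟨t4, e4, ht4⟩ := h4 μ3 s hμ3
  rw [hrep3.eval_at', Expr.eval] at e4
  have hμ4 := hμ3.update (k := B + (32 * x + 31)) (v := 0) (by simp)
  have hrep4 := hrep3.update_var hB x 0
  set μ4 := Function.update μ3 (B + (32 * x + 31)) 0 with hμ4d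
  set F : ℕ → ℕ := fun i => f.eval σ (Function.update η x i) with hF
  have hsize : ∀ i ≤ N, (agg mx i F).size ≤ s := fun i hi =>
    (Nat.size_le_size (agg_mono mx hi F)).trans ((hz σ η b R hσ hη hR).trans hsz)
  let Inv : ℕ → Memory → Prop := fun i ν => Bdd s ν ∧ Rep B σ (Function.update η x i) ν ∧
    ν (B + (32 * d + 30)) = N ∧ ν (B + (32 * (d + 1) + 30)) = agg mx i F ∧
    ν (B + (32 * (d + 2) + 30)) = η x ∧
    ∀ k, (∀ d' ≥ d, k ≠ B + (32 * d' + 30)) → k ≠ B + (32 * x + 31) → ν k = μ k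
  have hInv0 : Inv 0 μ4 := by
    refine ⟨hμ4, hrep4, ?_, ?_, ?_, fun k hk hx => ?_⟩
    · rw [hμ4d, Function.update_of_ne (by omega), hμ3d, Function.update_of_ne (by omega), hμ2d,
        Function.update_of_ne (by omega), hμ1d, Function.update_self]
    · rw [hμ4d, Function.update_of_ne (by omega), hμ3d, Function.update_of_ne (by omega), hμ2d,
        Function.update_self, agg_zero]
    · rw [hμ4d, Function.update_of_ne (by omega), hμ3d, Function.update_self]
    · rw [hμ4d, Function.update_of_ne hx, hμ3d, Function.update_of_ne (hk _ (by omega)), hμ2d,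
        Function.update_of_ne (hk _ (by omega)), hμ1d, Function.update_of_ne (hk _ le_rfl)]
  have hcond : ∀ i ν, Inv i ν → (Expr.sub (.read (at' (32 * d + 30)))
      (.read (at' (32 * x + 31)))).eval ν = N - i := by
    intro i ν ⟨_, hr, hn, _⟩
    rw [Expr.eval, hr.eval_read_at', hr.eval_read_at', hn, hr.var, Function.update_self]
  obtain ⟨ν, tl, el, htl, hb5, hrep5, hn5, ha5, hv5, hk5⟩ := exec_loop N
    (timeBound (c0 + c5 + c6 + c9 + 1) R s) Inv (b := .sub (.read (at' (32 * d + 30)))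
      (.read (at' (32 * x + 31)))) (P := .seq body
      (.seq (.write (at' (32 * (d + 1) + 30))
          (.add (.read (at' (32 * (d + 1) + 30)))
            (if mx then .sub (.read (at' (32 * (d + 3) + 30))) (.read (at' (32 * (d + 1) + 30)))
              else .read (at' (32 * (d + 3) + 30)))))
        (.write (at' (32 * x + 31)) (.add (.read (at' (32 * x + 31))) (.lit 1)))))
    (by
      intro i hi ν hν
      refine ⟨by rw [hcond i ν hν]; omega, ?_⟩
      obtain ⟨hνb, hνr, hνn, hνa, hνv, hνk⟩ := hν
      have hηi : ∀ y, (Function.update η x i y).size ≤ b := by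
        intro y
        by_cases hy : y = x
        · subst hy
          simpa using (Nat.size_le_size (hi.le.trans hNR)).trans hR
        · simpa [Function.update_of_ne hy] using hη y
      obtain ⟨ν1, u1, x1, hu1, hv1, hk1, hb1⟩ := hf B b R s σ _ ν hB hσ hηi hR hs0 hbs hνb hνr
      have hr1 : Rep B σ (Function.update η x i) ν1 :=
        hνr.of_frame hB fun k hk => hk1 k fun d' _ => hk d'
      have hacc : ν1 (B + (32 * (d + 1) + 30)) = agg mx i F := by
        rw [hk1 _ fun d' hd' => by omega, hνa]
      obtain ⟨u2, x2, hu2⟩ := h5 ν1 s hb1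
      have hval : (Expr.add (.read (at' (32 * (d + 1) + 30)))
          (if mx then .sub (.read (at' (32 * (d + 3) + 30))) (.read (at' (32 * (d + 1) + 30)))
            else .read (at' (32 * (d + 3) + 30)))).eval ν1 = agg mx (i + 1) F := by
        rw [agg_succ]
        cases mx
        · simp only [Bool.false_eq_true, if_false, Expr.eval.eq_3, hr1.eval_read_at', hacc, hv1,
            comb, hF]
        · simp only [if_true, Expr.eval.eq_3, Expr.eval.eq_4, hr1.eval_read_at', hacc, hv1,
            comb, hF]
      rw [hr1.eval_at', hval] at x2
      have hb2 := hb1.update (k := B + (32 * (d + 1) + 30)) (hsize (i + 1) hi)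
      have hr2 := hr1.update_tmp hB (d + 1) (agg mx (i + 1) F)
      set ν2 := Function.update ν1 (B + (32 * (d + 1) + 30)) (agg mx (i + 1) F) with hν2
      obtain ⟨u3, x3, hu3⟩ := h6 ν2 s hb2
      rw [hr2.eval_at', Expr.eval, hr2.eval_read_at', hr2.var, Function.update_self,
        Expr.eval] at x3
      have hr3 := hr2.update_var hB x (i + 1)
      rw [Function.update_idem] at hr3
      refine ⟨_, _, Exec.seq x1 (Exec.seq x2 x3), ?_, ?_, hr3, ?_, ?_, ?_, ?_⟩
      · have := (h9 ν s hνb).2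
        have e1 := timeBound_add_le c0 (c5 + c6 + c9 + 1) R s
        have e2 := linear_le_timeBound (c5 + c6 + c9 + 1) R s
        have e3 : (c5 + c6 + c9 + 1) * (s + 1) =
          c5 * (s + 1) + c6 * (s + 1) + c9 * (s + 1) + (s + 1) := by ring
        rw [show c0 + c5 + c6 + c9 + 1 = c0 + (c5 + c6 + c9 + 1) by ring]
        omega
      · exact hb2.update ((Nat.size_le_size hi).trans hNs)
      · rw [Function.update_of_ne (by omega), hν2, Function.update_of_ne (by omega),
          hk1 _ fun d' hd' => by omega, hνn]
      · rw [Function.update_of_ne (by omega), hν2, Function.update_self]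
      · rw [Function.update_of_ne (by omega), hν2, Function.update_of_ne (by omega),
          hk1 _ fun d' hd' => by omega, hνv]
      · intro k hk hx
        rw [Function.update_of_ne hx, hν2, Function.update_of_ne (hk _ (by omega)),
          hk1 _ fun d' hd' => hk d' (by omega), hνk k hk hx])
    (by
      intro ν hν
      refine ⟨by rw [hcond N ν hν]; omega, ?_⟩
      have := (h9 ν s hν.1).2
      refine le_trans ?_ (timeBound_mono (show c9 + 1 ≤ c0 + c5 + c6 + c9 + 1 by omega) le_rfl)
      refine le_trans ?_ (linear_le_timeBound _ _ _)
      have e3 : (c9 + 1) * (s + 1) = c9 * (s + 1) + (s + 1) := by ring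
      omega) hInv0
  obtain ⟨t7, e7, ht7⟩ := h7 ν s hb5
  rw [hrep5.eval_at', hrep5.eval_read_at', hv5] at e7
  have hb7 := hb5.update (k := B + (32 * x + 31)) ((hη x).trans hbs)
  have hrep7 := hrep5.update_var hB x (η x)
  set ν7 := Function.update ν (B + (32 * x + 31)) (η x) with hν7
  obtain ⟨t8, e8, ht8⟩ := h8 ν7 s hb7
  have ha7 : ν7 (B + (32 * (d + 1) + 30)) = agg mx N F := by
    rw [hν7, Function.update_of_ne (by omega), ha5]
  rw [hrep7.eval_at', hrep7.eval_read_at', ha7] at e8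
  refine ⟨_, _, Exec.seq e1 (Exec.seq e2 (Exec.seq e3 (Exec.seq e4 (Exec.seq el
    (Exec.seq e7 e8))))), ?_, ?_, ?_, hb7.update (hsize N le_rfl)⟩
  · have g1 := mul_timeBound_le (c0 + c5 + c6 + c9 + 1) R s
    have g2 := linear_le_timeBound (c1 + c2 + c3 + c4 + c7 + c8) R s
    have g3 := timeBound_add_le (c1 + c2 + c3 + c4 + c7 + c8) (c0 + c5 + c6 + c9 + 1 + 1) R s
    have g4 : timeBound (c1 + c2 + c3 + c4 + c7 + c8 + (c0 + c5 + c6 + c9 + 1 + 1)) R s ≤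
      timeBound (cz + (c1 + c2 + c3 + c4 + c7 + c8) + (c0 + c5 + c6 + c9 + 1 + 1)) R s :=
      timeBound_mono (by omega) le_rfl
    have g5 : (N + 1) * timeBound (c0 + c5 + c6 + c9 + 1) R s ≤
      (R + 1) * timeBound (c0 + c5 + c6 + c9 + 1) R s := Nat.mul_le_mul (by omega) le_rfl
    have g6 : (c1 + c2 + c3 + c4 + c7 + c8) * (s + 1) = c1 * (s + 1) + c2 * (s + 1) +
      c3 * (s + 1) + c4 * (s + 1) + c7 * (s + 1) + c8 * (s + 1) := by ring
    omega
  · rw [Function.update_self]; rfl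
  · intro k hk
    rw [Function.update_of_ne (hk d le_rfl)]
    by_cases hx : k = B + (32 * x + 31)
    · subst hx
      rw [hν7, Function.update_self, hrep.var]
    · rw [hν7, Function.update_of_ne hx, hk5 k hk hx]

/-- Every term is evaluated by its program; each level of nested aggregation raises the exponent of
`R + 1` in the time bound. -/
theorem Term.exists_evaluates (e : Term) : ∀ d, ∃ c, Evaluates (e.compile d) e d c := by
  induction e with
  | lit v =>
    intro d
    obtain ⟨c1, h1⟩ := exec_write (at' (32 * d + 30)) (.lit v)
    refine ⟨c1 + v.size, fun B b R s σ η μ hB hσ hη hR hs hbs hμ hrep => ?_⟩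
    obtain ⟨t, e, ht⟩ := h1 μ s hμ
    rw [hrep.eval_at', Expr.eval] at e
    refine ⟨_, t, e, (ht.trans (linear_le_timeBound _ _ _)).trans
      (timeBound_mono (by omega) le_rfl), by rw [Function.update_self]; rfl,
      fun k hk => Function.update_of_ne (hk d le_rfl) _ _, hμ.update ?_⟩
    nlinarith [Nat.zero_le (v.size * b), Nat.zero_le (c1 * (b + 1))]
  | var x =>
    intro d
    obtain ⟨c1, h1⟩ := exec_write (at' (32 * d + 30)) (.read (at' (32 * x + 31)))
    refine ⟨c1, fun B b R s σ η μ hB hσ hη hR hs hbs hμ hrep => ?_⟩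
    obtain ⟨t, e, ht⟩ := h1 μ s hμ
    rw [hrep.eval_at', hrep.eval_read_at', hrep.var] at e
    exact ⟨_, t, e, ht.trans (linear_le_timeBound _ _ _), by rw [Function.update_self]; rfl,
      fun k hk => Function.update_of_ne (hk d le_rfl) _ _, hμ.update ((hη x).trans hbs)⟩
  | get a e ih =>
    intro d
    obtain ⟨c0, h0⟩ := ih d
    obtain ⟨c1, h1⟩ := exec_write (at' (32 * d + 30))
      (.read (.add (.mul (.lit 32) (.read (at' (32 * d + 30)))) (at' a)))
    refine ⟨c0 + c1, fun B b R s σ η μ hB hσ hη hR hs hbs hμ hrep => ?_⟩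
    obtain ⟨ν, t, x, ht, hv, hk, hb⟩ := h0 B b R s σ η μ hB hσ hη hR (by nlinarith) hbs hμ hrep
    have hr : Rep B σ η ν := hrep.of_frame hB fun k h => hk k fun d' _ => h d'
    obtain ⟨u, y, hu⟩ := h1 ν s hb
    have hval : (Expr.read (.add (.mul (.lit 32) (.read (at' (32 * d + 30)))) (at' a))).eval ν =
        σ a (e.eval σ η) := by
      rw [Expr.eval, Expr.eval, hr.eval_at', Expr.eval, hr.eval_read_at', hv, Expr.eval,
        ← hr.arr]
      congr 1
      omega
    rw [hr.eval_at', hval] at y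
    refine ⟨_, _, Exec.seq x y, ?_, by rw [Function.update_self]; rfl, fun k h => ?_,
      hb.update ((hσ.size_le _ _).trans hbs)⟩
    · have := timeBound_add_le c0 c1 R s
      have := linear_le_timeBound c1 R s
      omega
    · rw [Function.update_of_ne (h d le_rfl), hk k h]
  | bin o e f ihe ihf =>
    intro d
    obtain ⟨c0, h0⟩ := ihe d
    obtain ⟨c1, h1⟩ := ihf (d + 1)
    obtain ⟨c2, h2⟩ := exec_write (at' (32 * d + 30))
      (o.expr (.read (at' (32 * d + 30))) (.read (at' (32 * (d + 1) + 30))))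
    obtain ⟨cz, hz⟩ := (Term.bin o e f).exists_size_le
    refine ⟨c0 + (c1 + c2) + cz, fun B b R s σ η μ hB hσ hη hR hs hbs hμ hrep => ?_⟩
    obtain ⟨ν, t, x, ht, hv, hk, hb⟩ := h0 B b R s σ η μ hB hσ hη hR (by nlinarith) hbs hμ hrep
    have hr : Rep B σ η ν := hrep.of_frame hB fun k h => hk k fun d' _ => h d'
    obtain ⟨ν', t', x', ht', hv', hk', hb'⟩ := h1 B b R s σ η ν hB hσ hη hR (by nlinarith) hbs hb hr
    have hr' : Rep B σ η ν' := hr.of_frame hB fun k h => hk' k fun d' _ => h d'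
    obtain ⟨u, y, hu⟩ := h2 ν' s hb'
    have hv'' : ν' (B + (32 * d + 30)) = e.eval σ η := by
      rw [hk' _ fun d' hd' => by omega, hv]
    have hval : (o.expr (.read (at' (32 * d + 30))) (.read (at' (32 * (d + 1) + 30)))).eval ν' =
        (Term.bin o e f).eval σ η := by
      rw [Term.eval, ← hv'', ← hv', ← hr'.eval_read_at', ← hr'.eval_read_at']
      cases o <;> rfl
    rw [hr'.eval_at', hval] at y
    refine ⟨_, _, Exec.seq x (Exec.seq x' y), ?_, by rw [Function.update_self], fun k h => ?_,
      hb'.update ((hz σ η b R hσ hη hR).trans (by nlinarith))⟩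
    · have := timeBound_add_le c0 (c1 + c2) R s
      have := timeBound_add_le c1 c2 R s
      have := linear_le_timeBound c2 R s
      have := timeBound_mono (R := R) (s := s) (show c0 + (c1 + c2) ≤ c0 + (c1 + c2) + cz by omega)
        le_rfl
      omega
    · rw [Function.update_of_ne (h d le_rfl), hk' k fun d' hd' => h d' (by omega), hk k h]
  | fold mx p x f ih =>
    intro d
    obtain ⟨c0, h0⟩ := ih (d + 3)
    exact evaluates_fold h0

end Tab

/-! ### Programs for sequences of array definitions -/

namespace Tab

open RAM Highway

theorem timeBound_linear_le (c d R b : ℕ) :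
    timeBound c R (d * (b + 1)) ≤ timeBound (c * (d + 1)) R b := by
  unfold timeBound
  rcases Nat.eq_zero_or_pos c with hc | hc
  · subst hc; simp
  have h : (R + 1) ^ c ≤ (R + 1) ^ (c * (d + 1)) := Nat.pow_le_pow_right (by omega) (by nlinarith)
  calc c * (R + 1) ^ c * (d * (b + 1) + 1) ≤ c * (R + 1) ^ c * ((d + 1) * (b + 1)) :=
        Nat.mul_le_mul le_rfl (by nlinarith)
    _ = c * (d + 1) * (R + 1) ^ c * (b + 1) := by ring
    _ ≤ _ := Nat.mul_le_mul (Nat.mul_le_mul le_rfl h) le_rfl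

/-- The definition of the array `tgt`: for `i = 0, …, N - 1` its entry `i` is the value of `body`
with `i` for the variable `0`; `N` is a parameter, or `1` for `none`. -/
structure Step : Type where
  tgt : Fin 30
  rng : Option (Fin 10)
  body : Term

/-- The part of `G` that has been computed just before the entry `i` of the array `j`. -/
def Store.trunc (G : Store) (j i : ℕ) : Store := fun a k =>
  if a.val < j ∨ (a.val = j ∧ k < i) then G a k else 0

theorem Store.Bounded.trunc {b R : ℕ} {G : Store} (h : G.Bounded b R) (j i : ℕ) :
    (G.trunc j i).Bounded b R where
  size_le a k := by
    unfold Store.trunc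
    split_ifs
    · exact h.size_le a k
    · simp
  par_le p := by
    unfold Store.trunc
    split_ifs
    · exact h.par_le p
    · simp

/-- The number of entries that a step defines. -/
def Step.count (st : Step) (G : Store) : ℕ :=
  st.rng.elim 1 fun p => G.trunc st.tgt 0 (parArr p) 0

/-- The arrays `G` satisfy the definition `st`. -/
structure Step.Holds (st : Step) (G : Store) : Prop where
  eval_eq : ∀ i < st.count G,
    st.body.eval (G.trunc st.tgt i) (Function.update (fun _ => 0) 0 i) = G st.tgt i
  eq_zero : ∀ k, st.count G ≤ k → G st.tgt k = 0

/-- The expression for the number of entries. -/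
def Step.countExpr (st : Step) : Expr := st.rng.elim (.lit 1) fun p => .read (at' (parArr p))

/-- The program that carries out a step. -/
def Step.prog (st : Step) : Program :=
  .seq (.write (at' 30) st.countExpr)
  (.seq (.loop (.sub (.read (at' 30)) (.read (at' 31)))
      (.seq (st.body.compile 1)
      (.seq (.write (.add (.mul (.lit 32) (.read (at' 31))) (at' st.tgt)) (.read (at' 62)))
        (.write (at' 31) (.add (.read (at' 31)) (.lit 1))))))
    (.write (at' 31) (.lit 0)))

/-- The program of a step fills the array `st.tgt`, entry by entry: after `i` rounds the memory
represents `G.trunc st.tgt i`. -/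
theorem Step.exec (st : Step) : ∃ c, ∀ (B b R s : ℕ) (G : Store) (μ : Memory), 4 ≤ B →
    G.Bounded b R → 1 ≤ R → R.size ≤ b → c * (b + 1) ≤ s → b ≤ s → Bdd s μ → st.Holds G →
    Rep B (G.trunc st.tgt 0) (fun _ => 0) μ →
    ∃ ν t, Exec st.prog μ ν t ∧ t ≤ timeBound c R s ∧
      Rep B (G.trunc (st.tgt + 1) 0) (fun _ => 0) ν ∧ Bdd s ν := by
  obtain ⟨c0, h0⟩ := st.body.exists_evaluates 1
  obtain ⟨c1, h1⟩ := exec_write (at' 30) st.countExpr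
  obtain ⟨c2, h2⟩ := exec_write (.add (.mul (.lit 32) (.read (at' 31))) (at' st.tgt))
    (.read (at' 62))
  obtain ⟨c3, h3⟩ := exec_write (at' 31) (.add (.read (at' 31)) (.lit 1))
  obtain ⟨c4, h4⟩ := exec_write (at' 31) (.lit 0)
  obtain ⟨c5, h5⟩ := (Expr.sub (.read (at' 30)) (.read (at' 31))).exists_cost_le
  refine ⟨(c1 + c4) + (c0 + (c2 + c3 + c5 + 1) + 1),
    fun B b R s G μ hB hG hR1 hR hs hbs hμ hst hrep => ?_⟩
  have hs0 : c0 * (b + 1) ≤ s := by nlinarith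
  set N := st.count G with hN
  have hNR : N ≤ R := by
    rw [hN, Step.count]
    cases st.rng with
    | none => exact hR1
    | some p => exact (hG.trunc st.tgt 0).par_le p
  have hNs : N.size ≤ s := (Nat.size_le_size hNR).trans (hR.trans hbs)
  have hcount : st.countExpr.eval μ = N := by
    rw [hN, Step.count, Step.countExpr]
    cases st.rng with
    | none => rfl
    | some p =>
      simp only [Option.elim]
      rw [hrep.eval_read_at', ← hrep.arr]
      simp
  obtain ⟨t1, e1, ht1⟩ := h1 μ s hμ
  rw [hrep.eval_at', hcount] at e1
  have hb1 := hμ.update (k := B + 30) hNs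
  have hrep1 := hrep.update_tmp hB 0 N
  rw [mul_zero, zero_add] at hrep1
  set μ1 := Function.update μ (B + 30) N with hμ1
  let Inv : ℕ → Memory → Prop := fun i ν => Bdd s ν ∧
    Rep B (G.trunc st.tgt i) (Function.update (fun _ => 0) 0 i) ν ∧ ν (B + 30) = N
  have hInv0 : Inv 0 μ1 := by
    refine ⟨hb1, ?_, by rw [hμ1, Function.update_self]⟩
    have : Function.update (fun _ : ℕ => 0) 0 0 = fun _ => 0 := Function.update_eq_self 0 _
    rw [this]
    exact hrep1
  have hcond : ∀ i ν, Inv i ν →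
      (Expr.sub (.read (at' 30)) (.read (at' 31))).eval ν = N - i := by
    intro i ν ⟨_, hr, hn⟩
    have := hr.var 0
    rw [mul_zero, zero_add, Function.update_self] at this
    rw [Expr.eval, hr.eval_read_at', hr.eval_read_at', hn, this]
  obtain ⟨ν, tl, el, htl, hb5, hrep5, hn5⟩ := exec_loop N
    (timeBound (c0 + (c2 + c3 + c5 + 1)) R s) Inv (b := .sub (.read (at' 30)) (.read (at' 31)))
    (P := .seq (st.body.compile 1)
      (.seq (.write (.add (.mul (.lit 32) (.read (at' 31))) (at' st.tgt)) (.read (at' 62)))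
        (.write (at' 31) (.add (.read (at' 31)) (.lit 1)))))
    (by
      intro i hi ν hν
      refine ⟨by rw [hcond i ν hν]; omega, ?_⟩
      obtain ⟨hνb, hνr, hνn⟩ := hν
      have hηi : ∀ y, (Function.update (fun _ : ℕ => 0) 0 i y).size ≤ b := by
        intro y
        by_cases hy : y = 0
        · subst hy
          simpa using (Nat.size_le_size (hi.le.trans hNR)).trans hR
        · simp [Function.update_of_ne hy]
      obtain ⟨ν1, u1, x1, hu1, hv1, hk1, hb1⟩ :=
        h0 B b R s _ _ ν hB (hG.trunc _ _) hηi hR hs0 hbs hνb hνr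
      have hr1 : Rep B (G.trunc st.tgt i) (Function.update (fun _ => 0) 0 i) ν1 :=
        hνr.of_frame hB fun k hk => hk1 k fun d' _ => hk d'
      rw [hst.eval_eq i hi] at hv1
      have hi1 : ν1 (B + 31) = i := by
        have := hr1.var 0
        rwa [mul_zero, zero_add, Function.update_self] at this
      obtain ⟨u2, x2, hu2⟩ := h2 ν1 s hb1
      have ha : (Expr.add (.mul (.lit 32) (.read (at' 31))) (at' st.tgt)).eval ν1 =
          B + (32 * i + st.tgt) := by
        rw [Expr.eval, Expr.eval, hr1.eval_read_at', hr1.eval_at', hi1, Expr.eval]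
        ring
      rw [ha, hr1.eval_read_at', show B + 62 = B + (32 * 1 + 30) from rfl, hv1] at x2
      have hb2 := hb1.update (k := B + (32 * i + st.tgt)) ((hG.size_le st.tgt i).trans hbs)
      have hr2 := hr1.update_arr hB st.tgt i (G st.tgt i)
      have htr : Function.update (G.trunc st.tgt i) st.tgt
          (Function.update (G.trunc st.tgt i st.tgt) i (G st.tgt i)) =
          G.trunc st.tgt (i + 1) := by
        funext a k
        by_cases haj : a = st.tgt
        · subst haj
          rw [Function.update_self]
          by_cases hk : k = i
          · subst hk; rw [Function.update_self]; simp [Store.trunc]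
          · rw [Function.update_of_ne hk]
            simp only [Store.trunc]
            have : k < i ↔ k < i + 1 := by omega
            simp [this]
        · rw [Function.update_of_ne haj]
          have : (a : ℕ) ≠ st.tgt := fun h => haj (Fin.ext h)
          simp [Store.trunc, this]
      rw [htr] at hr2
      set ν2 := Function.update ν1 (B + (32 * i + st.tgt)) (G st.tgt i) with hν2
      obtain ⟨u3, x3, hu3⟩ := h3 ν2 s hb2
      have hi2 : ν2 (B + 31) = i := by
        have := hr2.var 0
        rwa [mul_zero, zero_add, Function.update_self] at this
      rw [hr2.eval_at', Expr.eval, hr2.eval_read_at', hi2, Expr.eval] at x3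
      have hr3 := hr2.update_var hB 0 (i + 1)
      rw [Function.update_idem, mul_zero, zero_add] at hr3
      refine ⟨_, _, Exec.seq x1 (Exec.seq x2 x3), ?_, ?_, hr3, ?_⟩
      · have := (h5 ν s hνb).2
        have e1 := timeBound_add_le c0 (c2 + c3 + c5 + 1) R s
        have e2 := linear_le_timeBound (c2 + c3 + c5 + 1) R s
        have e3 : (c2 + c3 + c5 + 1) * (s + 1) =
          c2 * (s + 1) + c3 * (s + 1) + c5 * (s + 1) + (s + 1) := by ring
        omega
      · exact hb2.update ((Nat.size_le_size hi).trans hNs)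
      · have := st.tgt.2
        rw [Function.update_of_ne (by omega), hν2, Function.update_of_ne (by omega),
          hk1 _ fun d' hd' => by omega, hνn])
    (by
      intro ν hν
      refine ⟨by rw [hcond N ν hν]; omega, ?_⟩
      have := (h5 ν s hν.1).2
      refine le_trans ?_ (timeBound_mono (show c5 + 1 ≤ c0 + (c2 + c3 + c5 + 1) by omega) le_rfl)
      refine le_trans ?_ (linear_le_timeBound _ _ _)
      have e3 : (c5 + 1) * (s + 1) = c5 * (s + 1) + (s + 1) := by ring
      omega) hInv0
  obtain ⟨t4, e4, ht4⟩ := h4 ν s hb5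
  rw [hrep5.eval_at', Expr.eval] at e4
  have hrep7 := hrep5.update_var hB 0 0
  rw [Function.update_idem, mul_zero, zero_add,
    show Function.update (fun _ : ℕ => 0) 0 0 = fun _ => 0 from Function.update_eq_self 0 _,
    show G.trunc st.tgt N = G.trunc (st.tgt + 1) 0 by
      funext a k
      simp only [Store.trunc, Nat.not_lt_zero, and_false, or_false]
      rcases lt_trichotomy (a : ℕ) st.tgt with h | h | h
      · simp [h, Nat.lt_succ_of_lt h]
      · obtain rfl : a = st.tgt := Fin.ext h
        by_cases hk : k < N
        · simp [hk]
        · simp [hk, hst.eq_zero k (not_lt.1 hk)]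
      · rw [if_neg (by omega), if_neg (by omega)]] at hrep7
  refine ⟨_, _, Exec.seq e1 (Exec.seq el e4), ?_, hrep7, hb5.update (by simp)⟩
  have g1 := mul_timeBound_le (c0 + (c2 + c3 + c5 + 1)) R s
  have g2 := linear_le_timeBound (c1 + c4) R s
  have g3 := timeBound_add_le (c1 + c4) (c0 + (c2 + c3 + c5 + 1) + 1) R s
  have g5 : (N + 1) * timeBound (c0 + (c2 + c3 + c5 + 1)) R s ≤
    (R + 1) * timeBound (c0 + (c2 + c3 + c5 + 1)) R s := Nat.mul_le_mul (by omega) le_rfl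
  have g6 : (c1 + c4) * (s + 1) = c1 * (s + 1) + c4 * (s + 1) := by ring
  omega

/-- The program for a list of steps. -/
def stepsProg : List Step → Program
  | [] => .skip
  | st :: l => .seq st.prog (stepsProg l)

/-- Steps with consecutive targets fill the arrays one after the other. -/
theorem stepsProg_exec (l : List Step) : ∀ j : ℕ,
    (∀ k (h : k < l.length), (l[k].tgt : ℕ) = j + k) →
    ∃ c, ∀ (B b R s : ℕ) (G : Store) (μ : Memory), 4 ≤ B →
    G.Bounded b R → 1 ≤ R → R.size ≤ b → c * (b + 1) ≤ s → b ≤ s → Bdd s μ →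
    (∀ st ∈ l, st.Holds G) → Rep B (G.trunc j 0) (fun _ => 0) μ →
    ∃ ν t, Exec (stepsProg l) μ ν t ∧ t ≤ timeBound c R s ∧
      Rep B (G.trunc (j + l.length) 0) (fun _ => 0) ν ∧ Bdd s ν := by
  induction l with
  | nil =>
    intro j _
    refine ⟨1, fun B b R s G μ _ _ _ _ _ _ hμ _ hrep => ⟨μ, 1, Exec.skip μ, ?_, hrep, hμ⟩⟩
    exact le_trans (by omega) (linear_le_timeBound 1 R s)
  | cons st l ih =>
    intro j hj
    obtain ⟨c0, h0⟩ := st.exec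
    obtain ⟨c1, h1⟩ := ih (j + 1) fun k hk => by
      have := hj (k + 1) (by simpa using hk)
      simp only [List.getElem_cons_succ] at this
      omega
    have hst : (st.tgt : ℕ) = j := hj 0 (by simp)
    refine ⟨c0 + c1, fun B b R s G μ hB hG hR1 hR hs hbs hμ hl hrep => ?_⟩
    obtain ⟨ν, t, e, ht, hr, hb⟩ := h0 B b R s G μ hB hG hR1 hR (by nlinarith) hbs hμ
      (hl st (by simp)) (by rwa [hst])
    rw [hst] at hr
    obtain ⟨ν', t', e', ht', hr', hb'⟩ := h1 B b R s G ν hB hG hR1 hR (by nlinarith) hbs hb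
      (fun st' h => hl st' (by simp [h])) hr
    refine ⟨ν', _, Exec.seq e e', ?_, ?_, hb'⟩
    · have := timeBound_add_le c0 c1 R s
      omega
    · rwa [List.length_cons, show j + (l.length + 1) = j + 1 + l.length by ring]

end Tab

/-! ### Loading the input and storing the output -/

namespace Tab

open RAM Highway

theorem eval_lit (μ : Memory) (c : ℕ) : (Expr.lit c).eval μ = c := rfl

theorem eval_read (μ : Memory) (a : Expr) : (Expr.read a).eval μ = μ (a.eval μ) := rfl

theorem eval_add (μ : Memory) (a b : Expr) : (Expr.add a b).eval μ = a.eval μ + b.eval μ := rfl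

theorem eval_sub (μ : Memory) (a b : Expr) : (Expr.sub a b).eval μ = a.eval μ - b.eval μ := rfl

theorem eval_mul (μ : Memory) (a b : Expr) : (Expr.mul a b).eval μ = a.eval μ * b.eval μ := rfl

/-- The length of the input word, which is used as the base address. -/
def lenExpr : Expr := .add (.lit 4) (.add (.read (.lit 2)) (.mul (.lit 4) (.read (.lit 3))))

/-- The program that copies the input word into the array `0` and the base address into
cell `3`. -/
def loadProg : Program :=
  .seq (.loop (.sub lenExpr (.read (.add lenExpr (.lit 31))))
      (.seq (.write (.add lenExpr (.mul (.lit 32) (.read (.add lenExpr (.lit 31)))))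
          (.read (.read (.add lenExpr (.lit 31)))))
        (.write (.add lenExpr (.lit 31)) (.add (.read (.add lenExpr (.lit 31))) (.lit 1)))))
  (.seq (.write (.add lenExpr (.lit 31)) (.lit 0))
    (.write (.lit 3) lenExpr))

/-- Copying takes the input word of length `B` to the cells `B + 32 * k` and does not overwrite it on
the way; the counter is the cell `B + 31`. -/
theorem loadProg_exec : ∃ c, ∀ (w : List ℕ) (n m b R s : ℕ) (G : Store),
    w.length = 4 + n + 4 * m → w.getD 2 0 = n → w.getD 3 0 = m → (∀ k, G 0 k = w.getD k 0) →
    G.Bounded b R → w.length ≤ R → R.size ≤ b → b ≤ s →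
    ∃ ν t, Exec loadProg (initial w) ν t ∧ t ≤ timeBound c R s ∧
      Rep w.length (G.trunc 1 0) (fun _ => 0) ν ∧ Bdd s ν := by
  obtain ⟨c1, h1⟩ := exec_write
    (.add lenExpr (.mul (.lit 32) (.read (.add lenExpr (.lit 31)))))
    (.read (.read (.add lenExpr (.lit 31))))
  obtain ⟨c2, h2⟩ := exec_write (.add lenExpr (.lit 31))
    (.add (.read (.add lenExpr (.lit 31))) (.lit 1))
  obtain ⟨c3, h3⟩ := exec_write (.add lenExpr (.lit 31)) (.lit 0)
  obtain ⟨c4, h4⟩ := exec_write (.lit 3) lenExpr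
  obtain ⟨c5, h5⟩ := (Expr.sub lenExpr (.read (.add lenExpr (.lit 31)))).exists_cost_le
  refine ⟨(c3 + c4) + (c1 + c2 + c5 + 1 + 1),
    fun w n m b R s G hw hn hm hG0 hG hwR hR hbs => ?_⟩
  set B := w.length with hB
  have hws : ∀ k, (w.getD k 0).size ≤ s := fun k => by
    rw [← hG0]; exact (hG.size_le _ _).trans hbs
  have hBs : B.size ≤ s := (Nat.size_le_size hwR).trans (hR.trans hbs)
  have hw0 : ∀ k, B ≤ k → w.getD k 0 = 0 := fun k hk => List.getD_eq_default _ _ hk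
  let Inv : ℕ → Memory → Prop := fun i ν => Bdd s ν ∧ (∀ k < B, ν k = w.getD k 0) ∧
    ν (B + 31) = i ∧ (∀ k < i, ν (B + 32 * k) = w.getD k 0) ∧
    ∀ k ≥ B, k ≠ B + 31 → (∀ k' < i, k ≠ B + 32 * k') → ν k = 0
  have hlen : ∀ i ν, Inv i ν → lenExpr.eval ν = B := by
    intro i ν ⟨_, h, _⟩
    simp only [lenExpr, Expr.eval]
    rw [h 2 (by omega), h 3 (by omega), hn, hm]
    omega
  have hInv0 : Inv 0 (initial w) := by
    refine ⟨hws, fun k _ => rfl, ?_, by simp, fun k hk _ _ => hw0 k hk⟩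
    exact hw0 _ (by omega)
  obtain ⟨ν, tl, el, htl, hν⟩ := exec_loop B (timeBound (c1 + c2 + c5 + 1) R s) Inv
    (b := .sub lenExpr (.read (.add lenExpr (.lit 31))))
    (P := .seq (.write (.add lenExpr (.mul (.lit 32) (.read (.add lenExpr (.lit 31)))))
          (.read (.read (.add lenExpr (.lit 31)))))
        (.write (.add lenExpr (.lit 31)) (.add (.read (.add lenExpr (.lit 31))) (.lit 1))))
    (by
      intro i hi ν hν
      have hl := hlen i ν hν
      obtain ⟨hb, hlow, hctr, hcopy, hz⟩ := hν
      have hc : (Expr.read (.add lenExpr (.lit 31))).eval ν = i := by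
        rw [Expr.eval, Expr.eval, hl, Expr.eval, hctr]
      refine ⟨by rw [Expr.eval, hl, hc]; omega, ?_⟩
      obtain ⟨t1, e1, ht1⟩ := h1 ν s hb
      rw [eval_add, eval_mul, eval_lit, hl, eval_read _ (.read _), hc, hlow i hi] at e1
      have hb1 := hb.update (k := B + 32 * i) (hws i)
      set ν1 := Function.update ν (B + 32 * i) (w.getD i 0) with hν1
      have hl1 : lenExpr.eval ν1 = B := by
        simp only [lenExpr, Expr.eval]
        rw [hν1, Function.update_of_ne (by omega), Function.update_of_ne (by omega),
          hlow 2 (by omega), hlow 3 (by omega), hn, hm]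
        omega
      have hc1 : (Expr.read (.add lenExpr (.lit 31))).eval ν1 = i := by
        rw [Expr.eval, Expr.eval, hl1, Expr.eval, hν1, Function.update_of_ne (by omega), hctr]
      obtain ⟨t2, e2, ht2⟩ := h2 ν1 s hb1
      rw [eval_add _ lenExpr, eval_add, hc1, hl1, eval_lit, eval_lit] at e2
      refine ⟨_, _, Exec.seq e1 e2, ?_, hb1.update ((Nat.size_le_size hi).trans hBs), ?_, ?_, ?_, ?_⟩
      · have := (h5 ν s hb).2
        have e2 := linear_le_timeBound (c1 + c2 + c5 + 1) R s
        have e3 : (c1 + c2 + c5 + 1) * (s + 1) =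
          c1 * (s + 1) + c2 * (s + 1) + c5 * (s + 1) + (s + 1) := by ring
        omega
      · intro k hk
        rw [Function.update_of_ne (by omega), hν1, Function.update_of_ne (by omega), hlow k hk]
      · rw [Function.update_self]
      · intro k hk
        rw [Function.update_of_ne (by omega), hν1]
        by_cases hki : k = i
        · subst hki; rw [Function.update_self]
        · rw [Function.update_of_ne (by omega), hcopy k (by omega)]
      · intro k hk hk31 hk'
        rw [Function.update_of_ne hk31, hν1, Function.update_of_ne (hk' i (by omega)),
          hz k hk hk31 fun k' h => hk' k' (by omega)])
    (by
      intro ν hν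
      have hl := hlen B ν hν
      refine ⟨?_, ?_⟩
      · rw [Expr.eval, hl, Expr.eval, Expr.eval, hl, Expr.eval, hν.2.2.1]
        omega
      have := (h5 ν s hν.1).2
      refine le_trans ?_ (timeBound_mono (show c5 + 1 ≤ c1 + c2 + c5 + 1 by omega) le_rfl)
      refine le_trans ?_ (linear_le_timeBound _ _ _)
      have e3 : (c5 + 1) * (s + 1) = c5 * (s + 1) + (s + 1) := by ring
      omega) hInv0
  have hl := hlen B ν hν
  obtain ⟨hb, hlow, hctr, hcopy, hz⟩ := hν
  obtain ⟨t3, e3, ht3⟩ := h3 ν s hb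
  rw [eval_add, hl, eval_lit, eval_lit] at e3
  have hb3 := hb.update (k := B + 31) (v := 0) (by simp)
  set ν3 := Function.update ν (B + 31) 0 with hν3
  have hl3 : lenExpr.eval ν3 = B := by
    simp only [lenExpr, Expr.eval]
    rw [hν3, Function.update_of_ne (by omega), Function.update_of_ne (by omega),
      hlow 2 (by omega), hlow 3 (by omega), hn, hm]
    omega
  obtain ⟨t4, e4, ht4⟩ := h4 ν3 s hb3
  rw [hl3, Expr.eval] at e4
  have harr : ∀ k ≥ B, k ≠ B + 31 → (∀ k', k ≠ B + 32 * k') →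
      Function.update ν3 3 B k = 0 := fun k hk hk1 hk2 => by
    rw [Function.update_of_ne (by omega), hν3, Function.update_of_ne hk1,
      hz k hk hk1 fun k' _ => hk2 k']
  refine ⟨_, _, Exec.seq el (Exec.seq e3 e4), ?_, ⟨?_, ?_, ?_⟩, hb3.update hBs⟩
  · have g1 := mul_timeBound_le (c1 + c2 + c5 + 1) R s
    have g2 := linear_le_timeBound (c3 + c4) R s
    have g3 := timeBound_add_le (c3 + c4) (c1 + c2 + c5 + 1 + 1) R s
    have g5 : (B + 1) * timeBound (c1 + c2 + c5 + 1) R s ≤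
      (R + 1) * timeBound (c1 + c2 + c5 + 1) R s := Nat.mul_le_mul (by omega) le_rfl
    have g6 : (c3 + c4) * (s + 1) = c3 * (s + 1) + c4 * (s + 1) := by ring
    omega
  · rw [Function.update_self]
  · intro a k
    by_cases ha : (a : ℕ) = 0
    · obtain rfl : a = 0 := Fin.ext ha
      have : G.trunc 1 0 0 k = w.getD k 0 := by simp [Store.trunc, hG0]
      rw [this]
      by_cases hk : k < B
      · rw [Function.update_of_ne (by omega), hν3, Function.update_of_ne (by simp; omega)]
        simpa using hcopy k hk
      · rw [hw0 k (by omega), Function.update_of_ne (by omega), hν3,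
          Function.update_of_ne (by simp; omega), hz _ (by omega) (by simp; omega)]
        intro k' hk'
        simp
        omega
    · have h30 := a.2
      have : G.trunc 1 0 a k = 0 := by simp [Store.trunc, ha]
      rw [this]
      exact harr _ (by omega) (by omega) fun k' => by omega
  · intro x
    by_cases hx : x = 0
    · subst hx
      rw [Function.update_of_ne (by omega), hν3]
      simp
    · exact harr _ (by omega) (by omega) fun k' => by omega

/-- The program that copies the array `o` to the cells `0, 1, …`; the number of cells is the
parameter `p`.  Cell `3`, which holds the base address, comes last. -/
def storeProg (p : Fin 10) (o : Fin 30) : Program :=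
  .seq (.loop (.sub (.read (at' (parArr p))) (.read (at' 31)))
      (.seq (.ite (.add (.sub (.read (at' 31)) (.lit 3)) (.sub (.lit 3) (.read (at' 31))))
          (.write (.read (at' 31)) (.read (.add (.mul (.lit 32) (.read (at' 31))) (at' o))))
          .skip)
        (.write (at' 31) (.add (.read (at' 31)) (.lit 1)))))
    (.write (.lit 3) (.read (at' (32 * 3 + o))))

/-- The output lies below the base address, as its length is at most `B`, so that writing it does not
destroy the array that is being copied. -/
theorem storeProg_exec (p : Fin 10) (o : Fin 30) : ∃ c, ∀ (B b R s : ℕ) (σ : Store) (μ : Memory),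
    4 ≤ B → σ.Bounded b R → R.size ≤ b → b ≤ s → Bdd s μ → σ (parArr p) 0 ≤ B →
    Rep B σ (fun _ => 0) μ →
    ∃ ν t, Exec (storeProg p o) μ ν t ∧ t ≤ timeBound c R s ∧
      ∀ k < σ (parArr p) 0, ν k = σ o k := by
  obtain ⟨c1, h1⟩ := exec_write (.read (at' 31))
    (.read (.add (.mul (.lit 32) (.read (at' 31))) (at' o)))
  obtain ⟨c2, h2⟩ := exec_write (at' 31) (.add (.read (at' 31)) (.lit 1))
  obtain ⟨c3, h3⟩ := exec_write (.lit 3) (.read (at' (32 * 3 + o)))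
  obtain ⟨c4, h4⟩ := (Expr.add (.sub (.read (at' 31)) (.lit 3))
    (.sub (.lit 3) (.read (at' 31)))).exists_cost_le
  obtain ⟨c5, h5⟩ := (Expr.sub (.read (at' (parArr p))) (.read (at' 31))).exists_cost_le
  refine ⟨c3 + (c1 + c2 + c4 + c5 + 3 + 1), fun B b R s σ μ hB hσ hR hbs hμ hpB hrep => ?_⟩
  set N := σ (parArr p) 0 with hN
  have hNR : N ≤ R := hσ.par_le p
  have hNs : N.size ≤ s := (Nat.size_le_size hNR).trans (hR.trans hbs)
  let Inv : ℕ → Memory → Prop := fun i ν => Bdd s ν ∧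
    Rep B σ (Function.update (fun _ => 0) 0 i) ν ∧ ∀ k < i, k ≠ 3 → ν k = σ o k
  have hInv0 : Inv 0 μ := by
    refine ⟨hμ, ?_, by simp⟩
    rwa [show Function.update (fun _ : ℕ => 0) 0 0 = fun _ => 0 from Function.update_eq_self 0 _]
  have hctr : ∀ i ν, Rep B σ (Function.update (fun _ => 0) 0 i) ν →
      (Expr.read (at' 31)).eval ν = i := by
    intro i ν hr
    have := hr.var 0
    rw [mul_zero, zero_add, Function.update_self] at this
    rw [hr.eval_read_at', this]
  have hpar : ∀ η ν, Rep B σ η ν → (Expr.read (at' (parArr p))).eval ν = N := by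
    intro η ν hr
    rw [hr.eval_read_at', hN, ← hr.arr]
    simp
  obtain ⟨ν, tl, el, htl, hb, hr, hout⟩ := exec_loop N
    (timeBound (c1 + c2 + c4 + c5 + 3) R s) Inv
    (b := .sub (.read (at' (parArr p))) (.read (at' 31)))
    (P := .seq (.ite (.add (.sub (.read (at' 31)) (.lit 3)) (.sub (.lit 3) (.read (at' 31))))
          (.write (.read (at' 31)) (.read (.add (.mul (.lit 32) (.read (at' 31))) (at' o))))
          .skip)
        (.write (at' 31) (.add (.read (at' 31)) (.lit 1))))
    (by
      intro i hi ν ⟨hb, hr, hout⟩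
      have hi1 := hctr i ν hr
      refine ⟨by rw [Expr.eval, hpar _ ν hr, hi1]; omega, ?_⟩
      have hcond : (Expr.add (.sub (.read (at' 31)) (.lit 3))
          (.sub (.lit 3) (.read (at' 31)))).eval ν = (i - 3) + (3 - i) := by
        rw [eval_add, eval_sub, eval_sub, eval_lit, hi1]
      have hcost := (h5 ν s hb).2
      have hcost4 := (h4 ν s hb).2
      have e2 := linear_le_timeBound (c1 + c2 + c4 + c5 + 3) R s
      have e3 : (c1 + c2 + c4 + c5 + 3) * (s + 1) =
        c1 * (s + 1) + c2 * (s + 1) + c4 * (s + 1) + c5 * (s + 1) + 3 * (s + 1) := by ring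
      obtain ⟨ν1, t1, e1, ht1, hb1, hr1, hout1⟩ : ∃ ν1 t1,
          Exec (.ite (.add (.sub (.read (at' 31)) (.lit 3)) (.sub (.lit 3) (.read (at' 31))))
            (.write (.read (at' 31)) (.read (.add (.mul (.lit 32) (.read (at' 31))) (at' o))))
            .skip) ν ν1 t1 ∧ t1 ≤ c4 * (s + 1) + 2 + c1 * (s + 1) ∧ Bdd s ν1 ∧
          Rep B σ (Function.update (fun _ => 0) 0 i) ν1 ∧ ∀ k < i + 1, k ≠ 3 → ν1 k = σ o k := by
        by_cases h : i = 3
        · refine ⟨ν, _, Exec.ite_false (by rw [hcond]; omega) (Exec.skip ν), by omega, hb, hr, ?_⟩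
          intro k hk hk3
          exact hout k (by omega) hk3
        · obtain ⟨t1, e1, ht1⟩ := h1 ν s hb
          have hval : (Expr.read (.add (.mul (.lit 32) (.read (at' 31))) (at' o))).eval ν =
              σ o i := by
            rw [eval_read, eval_add, eval_mul, eval_lit, hi1, hr.eval_at', ← hr.arr]
            congr 1
            ring
          rw [hi1, hval] at e1
          refine ⟨_, _, Exec.ite_true (by rw [hcond]; omega) e1, by omega,
            hb.update ((hσ.size_le _ _).trans hbs), ⟨?_, ?_, ?_⟩, ?_⟩
          · rw [Function.update_of_ne (by omega), hr.base]
          · intro a k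
            rw [Function.update_of_ne (by omega), hr.arr]
          · intro x
            rw [Function.update_of_ne (by omega), hr.var]
          · intro k hk hk3
            by_cases hki : k = i
            · subst hki; rw [Function.update_self]
            · rw [Function.update_of_ne hki, hout k (by omega) hk3]
      obtain ⟨t2, e4, ht2⟩ := h2 ν1 s hb1
      rw [hr1.eval_at', Expr.eval, hctr i ν1 hr1, Expr.eval] at e4
      have hr2 := hr1.update_var hB 0 (i + 1)
      rw [Function.update_idem, mul_zero, zero_add] at hr2
      refine ⟨_, _, Exec.seq e1 e4, by omega, hb1.update ((Nat.size_le_size hi).trans hNs), hr2, ?_⟩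
      intro k hk hk3
      rw [Function.update_of_ne (by omega), hout1 k hk hk3])
    (by
      intro ν ⟨hb, hr, hout⟩
      refine ⟨by rw [Expr.eval, hpar _ ν hr, hctr N ν hr]; omega, ?_⟩
      have := (h5 ν s hb).2
      refine le_trans ?_
        (timeBound_mono (show c5 + 1 ≤ c1 + c2 + c4 + c5 + 3 by omega) le_rfl)
      refine le_trans ?_ (linear_le_timeBound _ _ _)
      have e3 : (c5 + 1) * (s + 1) = c5 * (s + 1) + (s + 1) := by ring
      omega) hInv0
  obtain ⟨t3, e3, ht3⟩ := h3 ν s hb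
  rw [hr.eval_read_at', hr.arr, Expr.eval] at e3
  refine ⟨_, _, Exec.seq el e3, ?_, ?_⟩
  · have g1 := mul_timeBound_le (c1 + c2 + c4 + c5 + 3) R s
    have g2 := linear_le_timeBound c3 R s
    have g3 := timeBound_add_le c3 (c1 + c2 + c4 + c5 + 3 + 1) R s
    have g5 : (N + 1) * timeBound (c1 + c2 + c4 + c5 + 3) R s ≤
      (R + 1) * timeBound (c1 + c2 + c4 + c5 + 3) R s := Nat.mul_le_mul (by omega) le_rfl
    omega
  · intro k hk
    by_cases h : k = 3
    · subst h; rw [Function.update_self]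
    · rw [Function.update_of_ne h, hout k hk h]

/-- A sequence of array definitions is carried out by a machine program whose running time is
polynomial in the parameters and linear in the number of bits of the entries. -/
theorem exists_program (l : List Step) (p : Fin 10) (o : Fin 30)
    (hl : ∀ k (h : k < l.length), (l[k].tgt : ℕ) = 1 + k)
    (hp : (parArr p : ℕ) < 1 + l.length) (ho : (o : ℕ) < 1 + l.length) :
    ∃ prog c, ∀ (w : List ℕ) (n m b R : ℕ) (G : Store),
    w.length = 4 + n + 4 * m → w.getD 2 0 = n → w.getD 3 0 = m → (∀ k, G 0 k = w.getD k 0) →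
    G.Bounded b R → w.length ≤ R → R.size ≤ b → (∀ st ∈ l, st.Holds G) →
    G (parArr p) 0 ≤ w.length →
    ∃ ν t, Exec prog (initial w) ν t ∧ t ≤ timeBound c R b ∧
      ∀ k < G (parArr p) 0, ν k = G o k := by
  obtain ⟨c1, h1⟩ := loadProg_exec
  obtain ⟨c2, h2⟩ := stepsProg_exec l 1 hl
  obtain ⟨c3, h3⟩ := storeProg_exec p o
  refine ⟨.seq loadProg (.seq (stepsProg l) (storeProg p o)), (c1 + (c2 + c3)) * ((c2 + 1) + 1),
    fun w n m b R G hw hn hm hG0 hG hwR hR hst hpw => ?_⟩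
  set s := (c2 + 1) * (b + 1) with hs
  have hbs : b ≤ s := by rw [hs]; nlinarith
  have hcs : c2 * (b + 1) ≤ s := by rw [hs]; nlinarith
  obtain ⟨ν1, t1, e1, ht1, hr1, hb1⟩ := h1 w n m b R s G hw hn hm hG0 hG hwR hR hbs
  obtain ⟨ν2, t2, e2, ht2, hr2, hb2⟩ := h2 w.length b R s G ν1 (by omega) hG (by omega) hR hcs hbs
    hb1 hst hr1
  have hp' : G.trunc (1 + l.length) 0 (parArr p) 0 = G (parArr p) 0 := by simp [Store.trunc, hp]
  have ho' : ∀ k, G.trunc (1 + l.length) 0 o k = G o k := by simp [Store.trunc, ho]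
  obtain ⟨ν3, t3, e3, ht3, hv⟩ := h3 w.length b R s _ ν2 (by omega) (hG.trunc _ _) hR hbs hb2
    (by rwa [hp']) hr2
  refine ⟨ν3, _, Exec.seq e1 (Exec.seq e2 e3), ?_, fun k hk => by rw [hv k (by rwa [hp']), ho']⟩
  have g1 := timeBound_add_le c1 (c2 + c3) R s
  have g2 := timeBound_add_le c2 c3 R s
  have g3 := timeBound_linear_le (c1 + (c2 + c3)) (c2 + 1) R b
  rw [← hs] at g3
  omega

end Tab

/-! ### Prices from covers by winning sets -/

namespace Cover

variable {ι E : Type*} [DecidableEq E]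

/-- The agents in `K`, all of them in `W`, have bundles that cover `S`. -/
def IsCover (b : ι → Finset E) (W : Finset ι) (S : Finset E) (K : Finset ι) : Prop :=
  K ⊆ W ∧ S ⊆ K.biUnion b

/-- The least total weight of a set of agents in `W` with bundles that cover `S`; if there is none,
a number larger than the total weight of the set `A` of all agents. -/
noncomputable def price (b : ι → Finset E) (u : ι → ℕ) (A W : Finset ι) (S : Finset E) : ℕ :=
  sInf {x | x = ∑ i ∈ A, u i + 1 ∨ ∃ K, IsCover b W S K ∧ x = ∑ i ∈ K, u i}

variable {b : ι → Finset E} {u : ι → ℕ} {A W : Finset ι} {S : Finset E}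

theorem price_le_top : price b u A W S ≤ ∑ i ∈ A, u i + 1 := Nat.sInf_le (Or.inl rfl)

theorem price_le {K : Finset ι} (h : IsCover b W S K) : price b u A W S ≤ ∑ i ∈ K, u i :=
  Nat.sInf_le (Or.inr ⟨K, h, rfl⟩)

theorem price_eq (b : ι → Finset E) (u : ι → ℕ) (A W : Finset ι) (S : Finset E) :
    price b u A W S = ∑ i ∈ A, u i + 1 ∨
      ∃ K, IsCover b W S K ∧ price b u A W S = ∑ i ∈ K, u i :=
  Nat.sInf_mem (s := {x | x = ∑ i ∈ A, u i + 1 ∨ ∃ K, IsCover b W S K ∧ x = ∑ i ∈ K, u i})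
    ⟨_, Or.inl rfl⟩

theorem exists_cover_of_lt (h : price b u A W S < ∑ i ∈ A, u i + 1) :
    ∃ K, IsCover b W S K ∧ price b u A W S = ∑ i ∈ K, u i :=
  (price_eq b u A W S).resolve_left h.ne

theorem isCover_singleton {i : ι} (hi : i ∈ W) : IsCover b W (b i) {i} :=
  ⟨by simpa using hi, by simp⟩

theorem price_lt_top (hW : W ⊆ A) {K : Finset ι} (h : IsCover b W S K) :
    price b u A W S < ∑ i ∈ A, u i + 1 :=
  (price_le h).trans_lt (Nat.lt_succ_of_le (Finset.sum_le_sum_of_subset (h.1.trans hW)))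

theorem price_bundle_le {i : ι} (hi : i ∈ W) : price b u A W (b i) ≤ u i := by
  simpa using price_le (u := u) (A := A) (isCover_singleton (b := b) hi)

theorem price_mono {S T : Finset E} (h : S ⊆ T) : price b u A W S ≤ price b u A W T := by
  rcases price_eq b u A W T with hT | ⟨K, hK, hT⟩
  · rw [hT]; exact price_le_top
  · rw [hT]; exact price_le ⟨hK.1, h.trans hK.2⟩

theorem price_empty : price b u A W ∅ = 0 := by
  simpa using price_le (b := b) (u := u) (A := A) (W := W) (S := ∅) (K := ∅) ⟨by simp, by simp⟩

/-- The measure that decreases with each exchange: every winner counts the agents with at least its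
weight. -/
def potential (u : ι → ℕ) (A W : Finset ι) : ℕ :=
  ∑ i ∈ W, (A.filter fun k => u i ≤ u k).card

theorem potential_le (hW : W ⊆ A) : potential u A W ≤ A.card * A.card := by
  refine (Finset.sum_le_card_nsmul W _ A.card fun i _ => Finset.card_filter_le _ _).trans ?_
  exact Nat.mul_le_mul (Finset.card_le_card hW) le_rfl

variable [DecidableEq ι]

theorem price_union_le (S T : Finset E) :
    price b u A W (S ∪ T) ≤ price b u A W S + price b u A W T := by
  rcases price_eq b u A W S with hS | ⟨K, hK, hS⟩
  · exact price_le_top.trans (by omega)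
  rcases price_eq b u A W T with hT | ⟨L, hL, hT⟩
  · exact price_le_top.trans (by omega)
  rw [hS, hT]
  refine (price_le (K := K ∪ L) ⟨Finset.union_subset hK.1 hL.1, ?_⟩).trans ?_
  · rw [Finset.union_biUnion]
    exact Finset.union_subset_union hK.2 hL.2
  · rw [← Finset.sum_union_inter]
    exact Nat.le_add_right _ _

theorem price_biUnion_le {κ : Type*} [DecidableEq κ] (C : Finset κ) (f : κ → Finset E) :
    price b u A W (C.biUnion f) ≤ ∑ T ∈ C, price b u A W (f T) := by
  induction C using Finset.induction_on with
  | empty => simp [price_empty]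
  | insert T C hT ih =>
    rw [Finset.biUnion_insert, Finset.sum_insert hT]
    exact (price_union_le _ _).trans (Nat.add_le_add_left ih _)

/-! ### Exchanging a cheap cover for an envious agent -/

/-- The winners after the agent `j` has replaced the agents in `K`. -/
def swap (W K : Finset ι) (j : ι) : Finset ι := insert j (W \ K)

/-- Exchanging `K` for `j` does not lower prices: in a cover that uses `j`, the agent `j` may be
replaced by `K`, which covers the bundle of `j` at no higher cost. -/
theorem price_le_price_swap {K : Finset ι} {j : ι} (hK : IsCover b W (b j) K)
    (hlt : ∑ i ∈ K, u i ≤ u j) (S : Finset E) :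
    price b u A W S ≤ price b u A (swap W K j) S := by
  rcases price_eq b u A (swap W K j) S with h | ⟨L, hL, h⟩
  · rw [h]; exact price_le_top
  rw [h]
  by_cases hj : j ∈ L
  · refine (price_le (K := L.erase j ∪ K) ⟨?_, ?_⟩).trans ?_
    · refine Finset.union_subset (fun x hx => ?_) hK.1
      have := hL.1 (Finset.mem_of_mem_erase hx)
      rw [swap, Finset.mem_insert, Finset.mem_sdiff] at this
      exact (this.resolve_left (Finset.ne_of_mem_erase hx)).1
    · rw [Finset.union_biUnion]
      intro x hx
      obtain ⟨k, hk, hxk⟩ := Finset.mem_biUnion.1 (hL.2 hx)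
      by_cases hkj : k = j
      · subst hkj
        exact Finset.mem_union_right _ (hK.2 hxk)
      · exact Finset.mem_union_left _ (Finset.mem_biUnion.2 ⟨k, Finset.mem_erase.2 ⟨hkj, hk⟩, hxk⟩)
    · rw [← Finset.sum_erase_add _ _ hj]
      have := Finset.sum_union_inter (s₁ := L.erase j) (s₂ := K) (f := u)
      omega
  · refine price_le ⟨fun x hx => ?_, hL.2⟩
    have := hL.1 hx
    rw [swap, Finset.mem_insert, Finset.mem_sdiff] at this
    exact (this.resolve_left fun h => hj (h ▸ hx)).1

/-- The exchange does not lower the revenue. -/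
theorem sum_price_le_swap {K : Finset ι} {j : ι} (hj : j ∉ W) (hK : IsCover b W (b j) K)
    (hmin : price b u A W (b j) = ∑ i ∈ K, u i) (hlt : ∑ i ∈ K, u i ≤ u j) :
    ∑ i ∈ W, price b u A W (b i) ≤ ∑ i ∈ swap W K j, price b u A (swap W K j) (b i) := by
  have hj' : j ∉ W \ K := fun h => hj (Finset.mem_sdiff.1 h).1
  rw [swap, Finset.sum_insert hj', ← swap, ← Finset.sum_sdiff hK.1, add_comm]
  refine Nat.add_le_add ?_ (Finset.sum_le_sum fun i _ => price_le_price_swap hK hlt _)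
  calc ∑ i ∈ K, price b u A W (b i) ≤ ∑ i ∈ K, u i :=
        Finset.sum_le_sum fun i hi => price_bundle_le (hK.1 hi)
    _ = price b u A W (b j) := hmin.symm
    _ ≤ _ := price_le_price_swap hK hlt _

/-- The exchange does not raise the load of any item. -/
theorem load_swap_le {K : Finset ι} {j : ι} (hK : IsCover b W (b j) K) (e : E) :
    ((swap W K j).filter fun i => e ∈ b i).card ≤ (W.filter fun i => e ∈ b i).card := by
  have h1 : ((W \ K).filter fun i => e ∈ b i).card + (K.filter fun i => e ∈ b i).card =
      (W.filter fun i => e ∈ b i).card := by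
    rw [← Finset.card_union_of_disjoint, ← Finset.filter_union, Finset.sdiff_union_of_subset hK.1]
    exact Finset.disjoint_filter_filter Finset.sdiff_disjoint
  rw [swap, Finset.filter_insert]
  split_ifs with h
  · obtain ⟨k, hk, hek⟩ := Finset.mem_biUnion.1 (hK.2 h)
    have h2 : 0 < (K.filter fun i => e ∈ b i).card :=
      Finset.card_pos.2 ⟨k, Finset.mem_filter.2 ⟨hk, hek⟩⟩
    have := Finset.card_insert_le j ((W \ K).filter fun i => e ∈ b i)
    omega
  · omega

/-- The agents of the nonempty set `K` have smaller weight than `j`, so for each of them more agents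
have at least its weight than have at least the weight of `j`. -/
theorem potential_swap_lt (hW : W ⊆ A) {K : Finset ι} {j : ι} (hne : (b j).Nonempty)
    (hj : j ∉ W) (hK : IsCover b W (b j) K) (hlt : ∑ i ∈ K, u i < u j) :
    potential u A (swap W K j) < potential u A W := by
  have hj' : j ∉ W \ K := fun h => hj (Finset.mem_sdiff.1 h).1
  obtain ⟨e, he⟩ := hne
  obtain ⟨k, hk, -⟩ := Finset.mem_biUnion.1 (hK.2 he)
  have hkj : u k < u j := (Finset.single_le_sum (fun _ _ => Nat.zero_le _) hk).trans_lt hlt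
  have h1 : (A.filter fun x => u j ≤ u x).card < (A.filter fun x => u k ≤ u x).card := by
    refine Finset.card_lt_card (Finset.ssubset_iff_of_subset ?_ |>.2 ⟨k, ?_, ?_⟩)
    · intro x hx
      rw [Finset.mem_filter] at hx ⊢
      exact ⟨hx.1, by omega⟩
    · exact Finset.mem_filter.2 ⟨hW (hK.1 hk), le_rfl⟩
    · simp [hkj]
  have h2 := Finset.single_le_sum (f := fun i => (A.filter fun x => u i ≤ u x).card)
    (fun _ _ => Nat.zero_le _) hk
  unfold potential
  rw [swap, Finset.sum_insert hj', ← Finset.sum_sdiff hK.1, add_comm]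
  omega

end Cover

/-! ### Sets of agents as binary numbers -/

namespace Mask

/-- The number with the binary digits of the indicator function of `W`. -/
def mask (W : Finset ℕ) : ℕ := ∑ k ∈ W, 2 ^ k

theorem mask_lt {W : Finset ℕ} {m : ℕ} (h : W ⊆ Finset.range m) : mask W < 2 ^ m := by
  have := Finset.sum_le_sum_of_subset (f := fun k => 2 ^ k) h
  have h2 := Nat.geomSum_eq (le_refl 2) m
  have := Nat.one_le_two_pow (n := m)
  unfold mask
  omega

theorem mask_div_mod (W : Finset ℕ) (k : ℕ) : mask W / 2 ^ k % 2 = if k ∈ W then 1 else 0 := by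
  have hsplit : mask W = mask (W.filter (· < k)) + mask (W.filter fun i => ¬ i < k) := by
    unfold mask; rw [Finset.sum_filter_add_sum_filter_not]
  have h1 : mask (W.filter (· < k)) < 2 ^ k :=
    mask_lt fun x hx => Finset.mem_range.2 (Finset.mem_filter.1 hx).2
  have h2 : ∃ q, mask (W.filter fun i => ¬ i < k) = 2 ^ k * ((if k ∈ W then 1 else 0) + 2 * q) := by
    refine ⟨∑ i ∈ W.filter (fun i => k < i), 2 ^ (i - k - 1), ?_⟩
    have : W.filter (fun i => ¬ i < k) = W.filter (· = k) ∪ W.filter (fun i => k < i) := by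
      ext x; simp only [Finset.mem_filter, Finset.mem_union]
      constructor
      · rintro ⟨h1, h2⟩
        rcases Nat.lt_or_ge k x with h | h
        · exact Or.inr ⟨h1, h⟩
        · exact Or.inl ⟨h1, by omega⟩
      · rintro (⟨h1, h2⟩ | ⟨h1, h2⟩) <;> exact ⟨h1, by omega⟩
    unfold mask
    rw [this, Finset.sum_union, mul_add]
    · congr 1
      · rw [Finset.filter_eq']
        split_ifs <;> simp
      · rw [Finset.mul_sum, Finset.mul_sum]
        refine Finset.sum_congr rfl fun i hi => ?_
        have := (Finset.mem_filter.1 hi).2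
        rw [← mul_assoc, ← pow_succ, ← pow_add]
        congr 1
        omega
    · rw [Finset.disjoint_left]
      intro x hx hx'
      have := (Finset.mem_filter.1 hx).2
      have := (Finset.mem_filter.1 hx').2
      omega
  obtain ⟨q, hq⟩ := h2
  rw [hsplit, hq, Nat.add_mul_div_left _ _ (Nat.two_pow_pos k), Nat.div_eq_of_lt h1]
  split_ifs <;> omega

theorem mask_swap {W K : Finset ℕ} {j : ℕ} (hK : K ⊆ W) (hj : j ∉ W) :
    mask (Cover.swap W K j) = mask W + 2 ^ j - mask K := by
  have hj' : j ∉ W \ K := fun h => hj (Finset.mem_sdiff.1 h).1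
  unfold mask
  rw [Cover.swap, Finset.sum_insert hj', ← Finset.sum_sdiff hK]
  generalize 2 ^ j = x
  omega

end Mask

/-! ### Weights that carry the cover -/

namespace Cover

open Mask

/-- The weights `u k 2^m + 2^k`: their sum over a subset of `{0, …, m - 1}` determines both the sum
of the `u k` and the subset. -/
def weight (m : ℕ) (u : ℕ → ℕ) (k : ℕ) : ℕ := u k * 2 ^ m + 2 ^ k

theorem sum_weight (m : ℕ) (u : ℕ → ℕ) (K : Finset ℕ) :
    ∑ k ∈ K, weight m u k = (∑ k ∈ K, u k) * 2 ^ m + mask K := by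
  simp only [weight, mask, Finset.sum_add_distrib, Finset.sum_mul]

theorem sum_weight_div {m : ℕ} (u : ℕ → ℕ) {K : Finset ℕ} (hK : K ⊆ Finset.range m) :
    (∑ k ∈ K, weight m u k) / 2 ^ m = ∑ k ∈ K, u k := by
  rw [sum_weight, mul_comm, Nat.mul_add_div (Nat.two_pow_pos m), Nat.div_eq_of_lt (mask_lt hK),
    add_zero]

theorem sum_weight_mod {m : ℕ} (u : ℕ → ℕ) {K : Finset ℕ} (hK : K ⊆ Finset.range m) :
    (∑ k ∈ K, weight m u k) % 2 ^ m = mask K := by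
  rw [sum_weight, mul_comm, Nat.mul_add_mod, Nat.mod_eq_of_lt (mask_lt hK)]

variable {E : Type*} [DecidableEq E] {b : ℕ → Finset E} {u : ℕ → ℕ} {m : ℕ} {W : Finset ℕ}
  {S : Finset E}

/-- A cover of least weight for `weight m u` is a cover of least weight for `u`. -/
theorem exists_cover_of_weight (hW : W ⊆ Finset.range m)
    (h : price b (weight m u) (Finset.range m) W S < ∑ i ∈ Finset.range m, weight m u i + 1) :
    ∃ K, IsCover b W S K ∧ price b u (Finset.range m) W S = ∑ i ∈ K, u i ∧
      price b (weight m u) (Finset.range m) W S / 2 ^ m = ∑ i ∈ K, u i ∧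
      price b (weight m u) (Finset.range m) W S % 2 ^ m = mask K := by
  obtain ⟨K, hK, h1⟩ := exists_cover_of_lt h
  have hKm := hK.1.trans hW
  refine ⟨K, hK, le_antisymm (price_le hK) ?_, by rw [h1, sum_weight_div u hKm],
    by rw [h1, sum_weight_mod u hKm]⟩
  obtain ⟨L, hL, h2⟩ := exists_cover_of_lt (price_lt_top (u := u) hW hK)
  have h3 := price_le (u := weight m u) (A := Finset.range m) hL
  have := Nat.div_le_div_right (c := 2 ^ m) h3
  rwa [h1, sum_weight_div u hKm, sum_weight_div u (hL.1.trans hW), ← h2] at this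

end Cover

/-! ### Colouring intervals -/

namespace Sweep

/-- Intervals of which at most `C` contain any given point can be coloured with `C` colours such
that intersecting intervals have different colours. -/
theorem exists_coloring (C : ℕ) (lo hi : ℕ → ℕ) (W : Finset ℕ) (hlo : ∀ i ∈ W, lo i ≤ hi i)
    (hC : ∀ x, (W.filter fun i => lo i ≤ x ∧ x ≤ hi i).card ≤ C) :
    ∃ c : ℕ → ℕ, (∀ i ∈ W, c i < C) ∧ ∀ i ∈ W, ∀ k ∈ W, ∀ x, lo i ≤ x → x ≤ hi i →
      lo k ≤ x → x ≤ hi k → c i = c k → i = k := by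
  -- Intervals enter in the order of their left ends.  The earlier ones that meet the new one contain
  -- its left end, so fewer than `C` colours are forbidden.
  induction W using Finset.induction_on_max_value lo with
  | empty => exact ⟨fun _ => 0, by simp, by simp⟩
  | insert a s ha hmax ih =>
    obtain ⟨c, hc, hinj⟩ := ih (fun i hi => hlo i (Finset.mem_insert_of_mem hi)) fun x =>
      (Finset.card_le_card (Finset.filter_subset_filter _ (Finset.subset_insert a s))).trans (hC x)
    have hla := hlo a (Finset.mem_insert_self a s)
    have hlt : ((s.filter fun i => lo i ≤ lo a ∧ lo a ≤ hi i).image c).card < C := by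
      refine Finset.card_image_le.trans_lt ?_
      have := hC (lo a)
      rw [Finset.filter_insert, if_pos ⟨le_rfl, hla⟩, Finset.card_insert_of_notMem
        fun h => ha (Finset.mem_filter.1 h).1] at this
      omega
    obtain ⟨col, hcol, hcol'⟩ := Finset.exists_mem_notMem_of_card_lt_card
      (hlt.trans_eq (Finset.card_range C).symm)
    rw [Finset.mem_range] at hcol
    have hnew : ∀ k ∈ s, ∀ x, lo a ≤ x → x ≤ hi a → lo k ≤ x → x ≤ hi k → col ≠ c k := by
      rintro k hk x h1 h2 h3 h4 rfl
      exact hcol' (Finset.mem_image.2 ⟨k, Finset.mem_filter.2 ⟨hk, hmax k hk, h1.trans h4⟩, rfl⟩)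
    have hne : ∀ k ∈ s, k ≠ a := fun k hk h => ha (h ▸ hk)
    refine ⟨Function.update c a col, fun i hi => ?_, fun i hi k hk x h1 h2 h3 h4 h => ?_⟩
    · rcases Finset.mem_insert.1 hi with rfl | hi
      · simpa using hcol
      · rw [Function.update_of_ne (hne i hi)]; exact hc i hi
    · rcases Finset.mem_insert.1 hi with rfl | his <;> rcases Finset.mem_insert.1 hk with rfl | hks
      · rfl
      · rw [Function.update_self, Function.update_of_ne (hne k hks)] at h
        exact (hnew k hks x h1 h2 h3 h4 h).elim
      · rw [Function.update_self, Function.update_of_ne (hne i his)] at h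
        exact (hnew i his x h3 h4 h1 h2 h.symm).elim
      · rw [Function.update_of_ne (hne i his),
          Function.update_of_ne (hne k hks)] at h
        exact hinj i his k hks x h1 h2 h3 h4 h

/-! ### Digits -/

/-- The digit `k` of `s` in base `M`. -/
def dig (M s k : ℕ) : ℕ := s / M ^ k % M

/-- The number with the `D` digits `f 0, f 1, …` in base `M`. -/
def enc (M : ℕ) : ℕ → (ℕ → ℕ) → ℕ
  | 0, _ => 0
  | D + 1, f => f 0 + M * enc M D fun k => f (k + 1)

theorem enc_lt {M : ℕ} (D : ℕ) : ∀ f : ℕ → ℕ, (∀ k < D, f k < M) → enc M D f < M ^ D := by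
  induction D with
  | zero => intro f _; simp [enc]
  | succ D ih =>
    intro f hf
    have h1 := ih (fun k => f (k + 1)) fun k hk => hf (k + 1) (by omega)
    have h2 := hf 0 (by omega)
    rw [enc, pow_succ']
    nlinarith

theorem dig_enc {M : ℕ} (D : ℕ) : ∀ (f : ℕ → ℕ) (k : ℕ), (∀ k < D, f k < M) → k < D →
    dig M (enc M D f) k = f k := by
  induction D with
  | zero => intro f k _ hk; omega
  | succ D ih =>
    intro f k hf hk
    have h0 := hf 0 (by omega)
    cases k with
    | zero => rw [dig, enc, pow_zero, Nat.div_one, Nat.add_mul_mod_self_left, Nat.mod_eq_of_lt h0]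
    | succ k =>
      rw [dig, enc, pow_succ', ← Nat.div_div_eq_div_mul, Nat.add_mul_div_left _ _ (by omega),
        Nat.div_eq_of_lt h0, zero_add]
      exact ih (fun k => f (k + 1)) k (fun k hk => hf (k + 1) (by omega)) (by omega)

theorem enc_zero (M D : ℕ) : enc M D (fun _ => 0) = 0 := by
  induction D with
  | zero => rfl
  | succ D ih => simp only [enc, ih]; simp

theorem dig_zero (M k : ℕ) : dig M 0 k = 0 := by simp [dig]

/-! ### The dynamic program -/

/-- The data of the dynamic program: `n` edges with capacities `cap`, of which only those up to `C`
matter; `m` agents with the edges from `lo i` to `hi i` and the budget `bud i`; and the base `M`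
in which states are written. -/
structure Data where
  n : ℕ
  m : ℕ
  C : ℕ
  M : ℕ
  cap : ℕ → ℕ
  lo : ℕ → ℕ
  hi : ℕ → ℕ
  bud : ℕ → ℕ

namespace Data

variable (D : Data)

/-- The content of the slot `a` in the state `s`: the number `i + 1` for the agent `i`, or `0`. -/
def slot (s a : ℕ) : ℕ := dig D.M s a

/-- The amount recorded in the state `s` for the pair of slots `a`, `b`. -/
def part (s a b : ℕ) : ℕ := dig D.M s (D.C + D.C * a + b)

/-- The number of states. -/
def states : ℕ := D.M ^ (D.C + D.C * D.C)

/-- The amount recorded before the transition for the agents now in the slots `a`, `b`. -/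
def old (s s' a b : ℕ) : ℕ :=
  if D.slot s' a = D.slot s a ∧ D.slot s' b = D.slot s b then D.part s a b else 0

/-- The slot `a` keeps its agent when the sweep reaches the edge `e`, or an agent that has ended is
replaced by nothing or by an agent that begins. -/
def SlotStep (e s s' a : ℕ) : Prop :=
  (D.slot s' a = D.slot s a ∧ (D.slot s a = 0 ∨ e ≤ D.hi (D.slot s a - 1))) ∨
    ((D.slot s a = 0 ∨ D.hi (D.slot s a - 1) < e) ∧
      (D.slot s' a = 0 ∨ (D.slot s' a ≤ D.m ∧ D.lo (D.slot s' a - 1) = e)))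

/-- The amounts for the slots `a`, `b` grow by the same number for all `b` and respect the
budgets. -/
def PartStep (s s' a b : ℕ) : Prop :=
  D.part s' a b = D.old s s' a b + (D.part s' a a - D.old s s' a a) ∧
    D.old s s' a a ≤ D.part s' a a ∧ D.part s' a b ≤ D.bud (D.slot s' b - 1)

/-- The transition from the state `s` to the state `s'` at the edge `e` is possible. -/
structure Valid (e s s' : ℕ) : Prop where
  slots : ∀ a < D.C, D.SlotStep e s s' a
  distinct : ∀ a < D.C, ∀ b < D.C, a = b ∨ D.slot s' a ≠ D.slot s' b ∨ D.slot s' a = 0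
  load : ∑ a ∈ Finset.range D.C, (if D.slot s' a = 0 then 0 else 1) ≤ D.cap e
  parts : ∀ a < D.C, ∀ b < D.C, D.slot s' a = 0 ∨ D.slot s' b = 0 ∨ D.PartStep s s' a b

/-- The total amount added in a transition. -/
def gain (s s' : ℕ) : ℕ :=
  ∑ a ∈ Finset.range D.C,
    if D.slot s' a = 0 then 0 else D.part s' a a - D.old s s' a a

/-- The binary number of the set of the agents that begin in a transition. -/
def newMask (s s' : ℕ) : ℕ :=
  ∑ a ∈ Finset.range D.C,
    if D.slot s' a = 0 ∨ D.slot s' a = D.slot s a then 0 else 2 ^ (D.slot s' a - 1)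

open Classical in
/-- The table of the dynamic program.  The entry for the edges before `e` and the state `s` is `0`
if the state cannot be reached; otherwise it is `2^m (1 + G) + B`, where `G` is the largest total
amount and `B` is the binary number of the corresponding set of agents. -/
noncomputable def table : ℕ → ℕ → ℕ
  | 0, s => if s = 0 then 2 ^ D.m else 0
  | e + 1, s' => (Finset.range D.states).sup fun s =>
      if table e s ≠ 0 ∧ D.Valid e s s' then
        table e s + 2 ^ D.m * D.gain s s' + D.newMask s s'
      else 0

/-- The total of the weights `w i` on the common edges before `e` of the agents `i` and `k`. -/
def psum (w : ℕ → ℕ → ℕ) (i k e : ℕ) : ℕ :=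
  ∑ x ∈ Finset.range e,
    if (D.lo i ≤ x ∧ x ≤ D.hi i) ∧ (D.lo k ≤ x ∧ x ≤ D.hi k) then w i x else 0

/-- The state `s` describes the set of agents `W` with edge weights `w`, restricted to the edges
before `e`. -/
structure Rep (e s : ℕ) (W : Finset ℕ) (w : ℕ → ℕ → ℕ) : Prop where
  subset : W ⊆ Finset.range D.m
  lo_lt : ∀ i ∈ W, D.lo i < e
  mem : ∀ a < D.C, D.slot s a ≠ 0 → D.slot s a - 1 ∈ W ∧ e ≤ D.hi (D.slot s a - 1) + 1
  active : ∀ i ∈ W, e ≤ D.hi i + 1 → ∃ a < D.C, D.slot s a = i + 1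
  distinct : ∀ a < D.C, ∀ b < D.C, D.slot s a = D.slot s b → D.slot s a ≠ 0 → a = b
  parts : ∀ a < D.C, ∀ b < D.C, D.slot s a ≠ 0 → D.slot s b ≠ 0 →
    D.part s a b = D.psum w (D.slot s a - 1) (D.slot s b - 1) e

/-- The set of agents `W` with the edge weights `w` respects the capacities and the budgets on the
edges before `e`. -/
structure Feas (e : ℕ) (W : Finset ℕ) (w : ℕ → ℕ → ℕ) : Prop where
  subset : W ⊆ Finset.range D.m
  bound : ∀ i ∈ W, ∀ k ∈ W, D.psum w i k e ≤ D.bud k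
  load : ∀ x < e, (W.filter fun i => D.lo i ≤ x ∧ x ≤ D.hi i).card ≤ D.cap x

variable {D}

theorem psum_succ (w : ℕ → ℕ → ℕ) (i k e : ℕ) : D.psum w i k (e + 1) = D.psum w i k e +
    if (D.lo i ≤ e ∧ e ≤ D.hi i) ∧ (D.lo k ≤ e ∧ e ≤ D.hi k) then w i e else 0 :=
  Finset.sum_range_succ _ _

theorem psum_congr {w w' : ℕ → ℕ → ℕ} {i k e : ℕ} (h : ∀ x < e, w i x = w' i x) :
    D.psum w i k e = D.psum w' i k e :=
  Finset.sum_congr rfl fun x hx => by rw [h x (Finset.mem_range.1 hx)]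

theorem psum_eq_zero_left {w : ℕ → ℕ → ℕ} {i k e : ℕ} (h : e ≤ D.lo i) : D.psum w i k e = 0 :=
  Finset.sum_eq_zero fun x hx => if_neg fun h' => by
    have := Finset.mem_range.1 hx
    omega

theorem psum_eq_zero_right {w : ℕ → ℕ → ℕ} {i k e : ℕ} (h : e ≤ D.lo k) : D.psum w i k e = 0 :=
  Finset.sum_eq_zero fun x hx => if_neg fun h' => by
    have := Finset.mem_range.1 hx
    omega

theorem psum_mono {w : ℕ → ℕ → ℕ} {i k e e' : ℕ} (h : e ≤ e') :
    D.psum w i k e ≤ D.psum w i k e' :=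
  Finset.sum_le_sum_of_subset (Finset.range_subset_range.2 h)

/-- A slot that changes holds an agent that begins. -/
def Stays (D : Data) (e s s' : ℕ) : Prop :=
  ∀ a < D.C, D.slot s' a ≠ 0 → D.slot s' a = D.slot s a ∨ D.lo (D.slot s' a - 1) = e

section Step

variable {e s s' : ℕ} {W : Finset ℕ} {w : ℕ → ℕ → ℕ}

/-- The entries carried over are the weights before `e`; when one of the two agents begins at `e`,
both are zero. -/
theorem Rep.old_eq (h : D.Rep e s (W.filter fun i => D.lo i < e) w) (hst : D.Stays e s s')
    {a b : ℕ} (ha : a < D.C) (hb : b < D.C) (ha0 : D.slot s' a ≠ 0) (hb0 : D.slot s' b ≠ 0) :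
    D.old s s' a b = D.psum w (D.slot s' a - 1) (D.slot s' b - 1) e := by
  unfold old
  split_ifs with hab
  · rw [hab.1, hab.2]
    exact h.parts a ha b hb (hab.1 ▸ ha0) (hab.2 ▸ hb0)
  · rcases hst a ha ha0 with h1 | h1
    · rcases hst b hb hb0 with h2 | h2
      · exact (hab ⟨h1, h2⟩).elim
      · exact (psum_eq_zero_right h2.ge).symm
    · exact (psum_eq_zero_left h1.ge).symm

theorem Rep.psum_step (h' : D.Rep (e + 1) s' W w) {a b : ℕ} (ha : a < D.C) (hb : b < D.C)
    (ha0 : D.slot s' a ≠ 0) (hb0 : D.slot s' b ≠ 0) :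
    D.part s' a b = D.psum w (D.slot s' a - 1) (D.slot s' b - 1) e + w (D.slot s' a - 1) e := by
  obtain ⟨h1, h2⟩ := h'.mem a ha ha0
  obtain ⟨h3, h4⟩ := h'.mem b hb hb0
  have h5 := h'.lo_lt _ h1
  have h6 := h'.lo_lt _ h3
  rw [h'.parts a ha b hb ha0 hb0, psum_succ, if_pos (by omega)]

theorem Rep.image_slots (h' : D.Rep (e + 1) s' W w) (p : ℕ → Prop) [DecidablePred p] :
    ((Finset.range D.C).filter fun a => D.slot s' a ≠ 0 ∧ p (D.slot s' a - 1)).image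
      (fun a => D.slot s' a - 1) = W.filter fun i => e ≤ D.hi i ∧ p i := by
  ext i
  simp only [Finset.mem_image, Finset.mem_filter, Finset.mem_range]
  constructor
  · rintro ⟨a, ⟨ha, ha0, hp⟩, rfl⟩
    obtain ⟨h1, h2⟩ := h'.mem a ha ha0
    exact ⟨h1, by omega, hp⟩
  · rintro ⟨hi, h1, hp⟩
    obtain ⟨a, ha, ha'⟩ := h'.active i hi (by omega)
    exact ⟨a, ⟨ha, by omega, by rwa [ha', Nat.add_sub_cancel]⟩, by omega⟩

theorem Rep.sum_slots (h' : D.Rep (e + 1) s' W w) (p : ℕ → Prop) [DecidablePred p] (f : ℕ → ℕ) :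
    ∑ a ∈ (Finset.range D.C).filter (fun a => D.slot s' a ≠ 0 ∧ p (D.slot s' a - 1)),
      f (D.slot s' a - 1) = ∑ i ∈ W.filter (fun i => e ≤ D.hi i ∧ p i), f i := by
  rw [← h'.image_slots p, Finset.sum_image]
  intro a ha b hb hab
  have ha := Finset.mem_filter.1 ha
  have hb := Finset.mem_filter.1 hb
  have h1 := ha.2.1
  have h2 := hb.2.1
  dsimp only at hab
  exact h'.distinct a (Finset.mem_range.1 ha.1) b (Finset.mem_range.1 hb.1) (by omega) h1

/-- The gain is the total weight that the edge `e` adds. -/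
theorem Rep.gain_eq (h : D.Rep e s (W.filter fun i => D.lo i < e) w)
    (h' : D.Rep (e + 1) s' W w) (hst : D.Stays e s s') :
    D.gain s s' = ∑ i ∈ W.filter (fun i => e ≤ D.hi i ∧ True), w i e := by
  rw [← h'.sum_slots (fun _ => True), gain, Finset.sum_filter]
  refine Finset.sum_congr rfl fun a ha => ?_
  have ha := Finset.mem_range.1 ha
  by_cases h0 : D.slot s' a = 0
  · simp [h0]
  · rw [if_neg h0, if_pos ⟨h0, trivial⟩, h.old_eq hst ha ha h0 h0, h'.psum_step ha ha h0 h0]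
    omega

/-- The new bits of the mask are those of the agents that begin at `e`. -/
theorem Rep.newMask_eq (hlo : ∀ i < D.m, D.lo i ≤ D.hi i)
    (h : D.Rep e s (W.filter fun i => D.lo i < e) w)
    (h' : D.Rep (e + 1) s' W w) (hst : D.Stays e s s') :
    D.newMask s s' = Mask.mask (W.filter fun i => D.lo i = e) := by
  have h1 : W.filter (fun i => D.lo i = e) = W.filter fun i => e ≤ D.hi i ∧ D.lo i = e :=
    Finset.filter_congr fun i hi => by
      have := hlo i (Finset.mem_range.1 (h'.subset hi))
      constructor
      · intro h; exact ⟨by omega, h⟩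
      · exact fun h => h.2
  rw [h1, Mask.mask, ← h'.sum_slots, newMask, Finset.sum_filter]
  refine Finset.sum_congr rfl fun a ha => ?_
  have ha := Finset.mem_range.1 ha
  by_cases h0 : D.slot s' a = 0
  · simp [h0]
  by_cases h2 : D.slot s' a = D.slot s a
  · rw [if_pos (Or.inr h2), if_neg]
    rintro ⟨-, h3⟩
    have := (h.mem a ha (h2 ▸ h0)).1
    rw [← h2, Finset.mem_filter] at this
    omega
  · rw [if_neg (by tauto), if_pos ⟨h0, (hst a ha h0).resolve_left h2⟩]

/-- The value of a pair `(W, w)` in the table. -/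
def value (D : Data) (e : ℕ) (W : Finset ℕ) (w : ℕ → ℕ → ℕ) : ℕ :=
  2 ^ D.m * (1 + ∑ i ∈ W, D.psum w i i e) + Mask.mask W

/-- The value of a pair `(W, w)` is additive along the path. -/
theorem Rep.value_step (hlo : ∀ i < D.m, D.lo i ≤ D.hi i)
    (h : D.Rep e s (W.filter fun i => D.lo i < e) w)
    (h' : D.Rep (e + 1) s' W w) (hst : D.Stays e s s') :
    D.value (e + 1) W w = D.value e (W.filter fun i => D.lo i < e) w +
      2 ^ D.m * D.gain s s' + D.newMask s s' := by
  rw [h.gain_eq h' hst, h.newMask_eq hlo h' hst]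
  have h1 : Mask.mask W = Mask.mask (W.filter fun i => D.lo i < e) +
      Mask.mask (W.filter fun i => D.lo i = e) := by
    unfold Mask.mask
    rw [← Finset.sum_filter_add_sum_filter_not W (fun i => D.lo i < e)]
    congr 1
    refine Finset.sum_congr (Finset.filter_congr fun i hi => ?_) fun _ _ => rfl
    have := h'.lo_lt i hi
    omega
  have h2 : ∑ i ∈ W, D.psum w i i (e + 1) =
      ∑ i ∈ W.filter (fun i => D.lo i < e), D.psum w i i e +
        ∑ i ∈ W.filter (fun i => e ≤ D.hi i ∧ True), w i e := by
    rw [Finset.sum_filter, Finset.sum_filter, ← Finset.sum_add_distrib]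
    refine Finset.sum_congr rfl fun i hi => ?_
    have := h'.lo_lt i hi
    rw [psum_succ]
    congr 1
    · split_ifs with h3
      · rfl
      · exact psum_eq_zero_left (by omega)
    · refine if_congr ?_ rfl rfl
      simp only [and_true]
      omega
  unfold value
  rw [h1, h2]
  ring

/-- Consecutive states of one feasible pair form a transition of the dynamic program. -/
theorem Rep.valid (h : D.Rep e s (W.filter fun i => D.lo i < e) w)
    (h' : D.Rep (e + 1) s' W w) (hst : D.Stays e s s')
    (hslots : ∀ a < D.C, D.SlotStep e s s' a) (hW : D.Feas (e + 1) W w) : D.Valid e s s' where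
  slots := hslots
  distinct a ha b hb := by
    by_contra! hne
    exact hne.1 (h'.distinct a ha b hb hne.2.1 hne.2.2)
  load := by
    have h1 := h'.sum_slots (fun _ => True) fun _ => 1
    rw [Finset.sum_filter] at h1
    calc ∑ a ∈ Finset.range D.C, (if D.slot s' a = 0 then 0 else 1)
        = ∑ i ∈ W.filter (fun i => e ≤ D.hi i ∧ True), 1 := by
          rw [← h1]
          refine Finset.sum_congr rfl fun a _ => ?_
          by_cases h0 : D.slot s' a = 0 <;> simp [h0]
      _ = (W.filter fun i => D.lo i ≤ e ∧ e ≤ D.hi i).card := by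
          rw [← Finset.card_eq_sum_ones]
          congr 1
          refine Finset.filter_congr fun i hi => ?_
          have := h'.lo_lt i hi
          simp only [and_true]
          omega
      _ ≤ _ := hW.load e (by omega)
  parts a ha b hb := by
    by_cases ha0 : D.slot s' a = 0
    · exact Or.inl ha0
    by_cases hb0 : D.slot s' b = 0
    · exact Or.inr (Or.inl hb0)
    refine Or.inr (Or.inr ⟨?_, ?_, ?_⟩)
    · rw [h.old_eq hst ha hb ha0 hb0, h.old_eq hst ha ha ha0 ha0, h'.psum_step ha hb ha0 hb0,
        h'.psum_step ha ha ha0 ha0]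
      omega
    · rw [h.old_eq hst ha ha ha0 ha0, h'.psum_step ha ha ha0 ha0]
      omega
    · rw [h'.parts a ha b hb ha0 hb0]
      exact hW.bound _ (h'.mem a ha ha0).1 _ (h'.mem b hb hb0).1

end Step

end Data

end Sweep

namespace Sweep

namespace Data

variable {D : Data}

theorem Rep.congr {e s : ℕ} {W : Finset ℕ} {w w' : ℕ → ℕ → ℕ} (h : D.Rep e s W w)
    (hw : ∀ i, ∀ x < e, w i x = w' i x) : D.Rep e s W w' :=
  ⟨h.subset, h.lo_lt, h.mem, h.active, h.distinct, fun a ha b hb ha0 hb0 => by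
    rw [h.parts a ha b hb ha0 hb0, psum_congr (hw _)]⟩

theorem Feas.congr {e : ℕ} {W : Finset ℕ} {w w' : ℕ → ℕ → ℕ} (h : D.Feas e W w)
    (hw : ∀ i, ∀ x < e, w i x = w' i x) : D.Feas e W w' :=
  ⟨h.subset, fun i hi k hk => by rw [← psum_congr (hw _)]; exact h.bound i hi k hk, h.load⟩

theorem Valid.stays {e s s' : ℕ} (h : D.Valid e s s') : D.Stays e s s' := fun a ha h0 => by
  rcases h.slots a ha with h1 | h1
  · exact Or.inl h1.1
  · exact Or.inr (h1.2.resolve_left h0).2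

/-- A transition of the dynamic program extends the set of agents and the weights that the state
describes. -/
theorem Rep.extend {e s s' : ℕ} {W : Finset ℕ} {w : ℕ → ℕ → ℕ}
    (hlo : ∀ i < D.m, D.lo i ≤ D.hi i) (h : D.Rep e s W w) (hW : D.Feas e W w)
    (hv : D.Valid e s s') : ∃ W' w', D.Rep (e + 1) s' W' w' ∧ D.Feas (e + 1) W' w' ∧
      D.value (e + 1) W' w' = D.value e W w + 2 ^ D.m * D.gain s s' + D.newMask s s' := by
  classical
  -- `N` consists of the agents that begin at `e`; the weight of an agent at `e` is the growth of the
  -- diagonal entry of its slot.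
  set N : Finset ℕ := ((Finset.range D.C).filter fun a => D.slot s' a ≠ 0 ∧
    D.slot s' a ≠ D.slot s a).image fun a => D.slot s' a - 1 with hN
  set w' : ℕ → ℕ → ℕ := fun i x => if x = e then ∑ a ∈ Finset.range D.C,
    (if D.slot s' a = i + 1 then D.part s' a a - D.old s s' a a else 0) else w i x with hw'
  have hww : ∀ i, ∀ x < e, w i x = w' i x := fun i x hx => by rw [hw']; exact (if_neg hx.ne).symm
  replace h := h.congr hww
  replace hW := hW.congr hww
  have hval : D.value e W w = D.value e W w' := by
    unfold value
    rw [Finset.sum_congr rfl fun i _ => psum_congr (hww i)]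
  rw [hval]
  have hNlo : ∀ i ∈ N, D.lo i = e ∧ i < D.m := by
    intro i hi
    obtain ⟨a, ha, rfl⟩ := Finset.mem_image.1 hi
    obtain ⟨ha, ha0, hne⟩ := Finset.mem_filter.1 ha
    rcases hv.slots a (Finset.mem_range.1 ha) with h1 | h1
    · exact (hne h1.1).elim
    · have := h1.2.resolve_left ha0
      exact ⟨this.2, by omega⟩
  have hfil : (W ∪ N).filter (fun i => D.lo i < e) = W := by
    ext i
    rw [Finset.mem_filter, Finset.mem_union]
    constructor
    · rintro ⟨h1 | h1, h2⟩
      · exact h1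
      · have := hNlo i h1; omega
    · exact fun hi => ⟨Or.inl hi, h.lo_lt i hi⟩
  have hdist : ∀ a < D.C, ∀ b < D.C, D.slot s' a = D.slot s' b → D.slot s' a ≠ 0 → a = b := by
    intro a ha b hb hab ha0
    rcases hv.distinct a ha b hb with h1 | h1 | h1
    · exact h1
    · exact (h1 hab).elim
    · exact (ha0 h1).elim
  have hwe : ∀ a < D.C, D.slot s' a ≠ 0 →
      w' (D.slot s' a - 1) e = D.part s' a a - D.old s s' a a := by
    intro a ha ha0
    simp only [hw', if_true]
    rw [Finset.sum_eq_single a]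
    · rw [if_pos (by omega)]
    · intro b hb hba
      exact if_neg fun hb' => hba (hdist b (Finset.mem_range.1 hb) a ha (by omega) (by omega))
    · exact fun h => (h (Finset.mem_range.2 ha)).elim
  have hmem : ∀ a < D.C, D.slot s' a ≠ 0 → D.slot s' a - 1 ∈ W ∪ N ∧
      e + 1 ≤ D.hi (D.slot s' a - 1) + 1 := by
    intro a ha ha0
    by_cases hsa : D.slot s' a = D.slot s a
    · have h1 := h.mem a ha (hsa ▸ ha0)
      rw [hsa]
      refine ⟨Finset.mem_union_left _ h1.1, ?_⟩
      rcases hv.slots a ha with h2 | h2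
      · have := h2.2.resolve_left (hsa ▸ ha0)
        omega
      · have h3 := h2.2.resolve_left ha0
        have h4 := h2.1.resolve_left (hsa ▸ ha0)
        have := hlo (D.slot s' a - 1) (by omega)
        rw [hsa] at this h3
        omega
    · have h1 : D.slot s' a - 1 ∈ N :=
        Finset.mem_image.2 ⟨a, Finset.mem_filter.2 ⟨Finset.mem_range.2 ha, ha0, hsa⟩, rfl⟩
      obtain ⟨h2, h3⟩ := hNlo _ h1
      have := hlo _ h3
      exact ⟨Finset.mem_union_right _ h1, by omega⟩
  have h' : D.Rep (e + 1) s' (W ∪ N) w' := by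
    refine ⟨Finset.union_subset h.subset fun i hi => Finset.mem_range.2 (hNlo i hi).2, ?_, hmem, ?_,
      hdist, ?_⟩
    · intro i hi
      rcases Finset.mem_union.1 hi with hi | hi
      · exact (h.lo_lt i hi).trans (by omega)
      · have := hNlo i hi; omega
    · intro i hi hie
      rcases Finset.mem_union.1 hi with hi | hi
      · obtain ⟨a, ha, hai⟩ := h.active i hi (by omega)
        refine ⟨a, ha, ?_⟩
        rcases hv.slots a ha with h1 | h1
        · omega
        · have := h1.1.resolve_left (by omega)
          rw [hai, Nat.add_sub_cancel] at this
          omega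
      · obtain ⟨a, ha, rfl⟩ := Finset.mem_image.1 hi
        obtain ⟨ha, ha0, -⟩ := Finset.mem_filter.1 ha
        exact ⟨a, Finset.mem_range.1 ha, by omega⟩
    · intro a ha b hb ha0 hb0
      have h1 := ((hv.parts a ha b hb).resolve_left ha0).resolve_left hb0
      obtain ⟨h2, h3⟩ := hmem a ha ha0
      obtain ⟨h4, h5⟩ := hmem b hb hb0
      have hlo' : ∀ i ∈ W ∪ N, D.lo i ≤ e := by
        intro i hi
        rcases Finset.mem_union.1 hi with hi | hi
        · exact (h.lo_lt i hi).le
        · exact (hNlo i hi).1.le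
      have h6 := hlo' _ h2
      have h7 := hlo' _ h4
      rw [h1.1, psum_succ, if_pos (by omega), hwe a ha ha0,
        Rep.old_eq (W := W ∪ N) (by rwa [hfil]) hv.stays ha hb ha0 hb0]
  have h0 : D.Rep e s ((W ∪ N).filter fun i => D.lo i < e) w' := by rwa [hfil]
  refine ⟨W ∪ N, w', h', ⟨h'.subset, ?_, ?_⟩, ?_⟩
  · intro i hi k hk
    have hi' := h'.lo_lt i hi
    have hk' := h'.lo_lt k hk
    by_cases hact : e ≤ D.hi i ∧ e ≤ D.hi k
    · obtain ⟨a, ha, hai⟩ := h'.active i hi (by omega)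
      obtain ⟨b, hb, hbk⟩ := h'.active k hk (by omega)
      have h1 := ((hv.parts a ha b hb).resolve_left (by omega)).resolve_left (by omega)
      have h2 := h'.parts a ha b hb (by omega) (by omega)
      have h3 := h1.2.2
      rw [h2, hai, hbk] at h3
      exact h3
    · rw [psum_succ, if_neg (by omega), add_zero]
      by_cases hie : D.lo i < e
      · by_cases hke : D.lo k < e
        · refine hW.bound i ?_ k ?_ <;> rw [← hfil, Finset.mem_filter]
          · exact ⟨hi, hie⟩
          · exact ⟨hk, hke⟩
        · rw [psum_eq_zero_right (not_lt.1 hke)]; exact Nat.zero_le _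
      · rw [psum_eq_zero_left (not_lt.1 hie)]; exact Nat.zero_le _
  · intro x hx
    rcases Nat.lt_succ_iff_lt_or_eq.1 hx with hx | rfl
    · refine (Finset.card_le_card ?_).trans (hW.load x hx)
      intro i hi
      rw [Finset.mem_filter] at hi ⊢
      refine ⟨?_, hi.2⟩
      rw [← hfil, Finset.mem_filter]
      exact ⟨hi.1, by omega⟩
    · refine le_trans (le_of_eq ?_) hv.load
      have h1 := h'.sum_slots (fun _ => True) fun _ => 1
      rw [Finset.sum_filter] at h1
      have h2 : (W ∪ N).filter (fun i => D.lo i ≤ x ∧ x ≤ D.hi i) =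
          (W ∪ N).filter fun i => x ≤ D.hi i ∧ True := by
        refine Finset.filter_congr fun i hi => ?_
        have := h'.lo_lt i hi
        simp only [and_true]
        omega
      rw [h2, Finset.card_eq_sum_ones, ← h1]
      refine Finset.sum_congr rfl fun a _ => ?_
      by_cases h0 : D.slot s' a = 0 <;> simp [h0]
  · rw [h0.value_step hlo h' hv.stays, hfil]

/-- Every nonzero entry of the table is the value of some feasible pair in that state. -/
theorem table_sound (hlo : ∀ i < D.m, D.lo i ≤ D.hi i) (e : ℕ) : ∀ s, D.table e s ≠ 0 →
    ∃ W w, D.Rep e s W w ∧ D.Feas e W w ∧ D.table e s = D.value e W w := by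
  induction e with
  | zero =>
    intro s hs
    have hs0 : s = 0 := by
      by_contra h
      exact hs (by simp [table, h])
    subst hs0
    refine ⟨∅, fun _ _ => 0, ⟨by simp, by simp, fun a _ h => (h (dig_zero _ _)).elim, by simp,
      fun a _ b _ _ h => (h (dig_zero _ _)).elim, fun a _ b _ h => (h (dig_zero _ _)).elim⟩,
      ⟨by simp, by simp, by simp⟩, by simp [table, value, Mask.mask]⟩
  | succ e ih =>
    intro s' hs'
    classical
    have hne : (Finset.range D.states).Nonempty := by
      by_contra h
      rw [Finset.not_nonempty_iff_eq_empty] at h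
      exact hs' (by simp [table, h])
    obtain ⟨s, hs, heq⟩ := Finset.exists_mem_eq_sup _ hne fun s =>
      if D.table e s ≠ 0 ∧ D.Valid e s s' then
        D.table e s + 2 ^ D.m * D.gain s s' + D.newMask s s' else 0
    have htab : D.table (e + 1) s' = if D.table e s ≠ 0 ∧ D.Valid e s s' then
        D.table e s + 2 ^ D.m * D.gain s s' + D.newMask s s' else 0 := by
      rw [← heq, table]
    have hc : D.table e s ≠ 0 ∧ D.Valid e s s' := by
      by_contra h
      exact hs' (by rw [htab, if_neg h])
    obtain ⟨W, w, h1, h2, h3⟩ := ih s hc.1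
    obtain ⟨W', w', h4, h5, h6⟩ := h1.extend hlo h2 hc.2
    exact ⟨W', w', h4, h5, by rw [htab, if_pos hc, h3, h6]⟩

/-! ### Every feasible choice of winners and weights occurs in the table -/

open Classical in
/-- The agent in the slot `a` just before the edge `e`, when the agents in `W` use the slots given
by the colouring `c`. -/
noncomputable def slotAt (D : Data) (W : Finset ℕ) (c : ℕ → ℕ) (e a : ℕ) : ℕ :=
  if h : ∃ i ∈ W, c i = a ∧ D.lo i < e ∧ e ≤ D.hi i + 1 then h.choose + 1 else 0

/-- The digits of the state just before the edge `e`. -/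
noncomputable def digitAt (D : Data) (W : Finset ℕ) (w : ℕ → ℕ → ℕ) (c : ℕ → ℕ) (e k : ℕ) : ℕ :=
  if k < D.C then D.slotAt W c e k
  else if D.slotAt W c e ((k - D.C) / D.C) = 0 ∨ D.slotAt W c e ((k - D.C) % D.C) = 0 then 0
  else D.psum w (D.slotAt W c e ((k - D.C) / D.C) - 1) (D.slotAt W c e ((k - D.C) % D.C) - 1) e

/-- The state just before the edge `e`. -/
noncomputable def stateAt (D : Data) (W : Finset ℕ) (w : ℕ → ℕ → ℕ) (c : ℕ → ℕ) (e : ℕ) : ℕ :=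
  enc D.M (D.C + D.C * D.C) (D.digitAt W w c e)

section Complete

variable {W : Finset ℕ} {w : ℕ → ℕ → ℕ} {c : ℕ → ℕ}

theorem slotAt_cases (W : Finset ℕ) (c : ℕ → ℕ) (e a : ℕ) : D.slotAt W c e a = 0 ∨
    ∃ i ∈ W, c i = a ∧ D.lo i < e ∧ e ≤ D.hi i + 1 ∧ D.slotAt W c e a = i + 1 := by
  classical
  unfold slotAt
  split_ifs with h
  · obtain ⟨h1, h2, h3, h4⟩ := h.choose_spec
    exact Or.inr ⟨_, h1, h2, h3, h4, rfl⟩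
  · exact Or.inl rfl

theorem slotAt_eq (hinj : ∀ i ∈ W, ∀ k ∈ W, ∀ x, D.lo i ≤ x → x ≤ D.hi i →
      D.lo k ≤ x → x ≤ D.hi k → c i = c k → i = k) {e i : ℕ} (hi : i ∈ W) (h1 : D.lo i < e)
    (h2 : e ≤ D.hi i + 1) : D.slotAt W c e (c i) = i + 1 := by
  classical
  have h : ∃ k ∈ W, c k = c i ∧ D.lo k < e ∧ e ≤ D.hi k + 1 := ⟨i, hi, rfl, h1, h2⟩
  unfold slotAt
  rw [dif_pos h]
  obtain ⟨h3, h4, h5, h6⟩ := h.choose_spec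
  rw [hinj _ h3 i hi (e - 1) (by omega) (by omega) (by omega) (by omega) h4]

variable (hW : D.Feas D.n W w) (hM : D.m < D.M) (hbud : ∀ k ∈ W, D.bud k < D.M)
  (hc : ∀ i ∈ W, c i < D.C)
  (hinj : ∀ i ∈ W, ∀ k ∈ W, ∀ x, D.lo i ≤ x → x ≤ D.hi i →
      D.lo k ≤ x → x ≤ D.hi k → c i = c k → i = k)
include hW hM hbud

theorem digitAt_lt {e : ℕ} (he : e ≤ D.n) (k : ℕ) : D.digitAt W w c e k < D.M := by
  unfold digitAt
  split_ifs with h1 h2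
  · rcases slotAt_cases (D := D) W c e k with h | ⟨i, hi, -, -, -, h⟩
    · omega
    · have := Finset.mem_range.1 (hW.subset hi)
      omega
  · omega
  · rw [not_or] at h2
    obtain ⟨i, hi, -, -, -, hi'⟩ := (slotAt_cases (D := D) W c e _).resolve_left h2.1
    obtain ⟨k, hk, -, -, -, hk'⟩ := (slotAt_cases (D := D) W c e _).resolve_left h2.2
    rw [hi', hk', Nat.add_sub_cancel, Nat.add_sub_cancel]
    exact ((psum_mono he).trans (hW.bound i hi k hk)).trans_lt (hbud k hk)

theorem stateAt_lt {e : ℕ} (he : e ≤ D.n) : D.stateAt W w c e < D.states :=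
  enc_lt _ _ fun k _ => digitAt_lt hW hM hbud he k

theorem slot_stateAt {e : ℕ} (he : e ≤ D.n) {a : ℕ} (ha : a < D.C) :
    D.slot (D.stateAt W w c e) a = D.slotAt W c e a := by
  unfold slot stateAt
  rw [dig_enc _ _ _ (fun k _ => digitAt_lt hW hM hbud he k) (by omega), digitAt, if_pos ha]

theorem part_stateAt {e : ℕ} (he : e ≤ D.n) {a b : ℕ} (ha : a < D.C) (hb : b < D.C)
    (ha0 : D.slotAt W c e a ≠ 0) (hb0 : D.slotAt W c e b ≠ 0) :
    D.part (D.stateAt W w c e) a b =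
      D.psum w (D.slotAt W c e a - 1) (D.slotAt W c e b - 1) e := by
  unfold part stateAt
  rw [dig_enc _ _ _ (fun k _ => digitAt_lt hW hM hbud he k) (by nlinarith), digitAt,
    if_neg (by omega), show D.C + D.C * a + b - D.C = D.C * a + b by omega,
    Nat.mul_add_div (by omega), Nat.div_eq_of_lt hb, Nat.mul_add_mod, Nat.mod_eq_of_lt hb,
    add_zero, if_neg (by tauto)]

include hc hinj

/-- `stateAt` encodes the part of a feasible pair that lies before `e`. -/
theorem rep_stateAt {e : ℕ} (he : e ≤ D.n) :
    D.Rep e (D.stateAt W w c e) (W.filter fun i => D.lo i < e) w := by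
  refine ⟨(Finset.filter_subset _ _).trans hW.subset, fun i hi => (Finset.mem_filter.1 hi).2,
    ?_, ?_, ?_, ?_⟩
  · intro a ha ha0
    rw [slot_stateAt hW hM hbud he ha] at ha0 ⊢
    obtain ⟨i, hi, -, h1, h2, h3⟩ := (slotAt_cases (D := D) W c e a).resolve_left ha0
    rw [h3, Nat.add_sub_cancel]
    exact ⟨Finset.mem_filter.2 ⟨hi, h1⟩, h2⟩
  · intro i hi hie
    obtain ⟨hi, hlt⟩ := Finset.mem_filter.1 hi
    exact ⟨c i, hc i hi, by rw [slot_stateAt hW hM hbud he (hc i hi), slotAt_eq hinj hi hlt hie]⟩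
  · intro a ha b hb hab ha0
    rw [slot_stateAt hW hM hbud he ha] at ha0 hab
    rw [slot_stateAt hW hM hbud he hb] at hab
    obtain ⟨i, hi, hia, h1, h2, h3⟩ := (slotAt_cases (D := D) W c e a).resolve_left ha0
    obtain ⟨k, hk, hkb, h4, h5, h6⟩ := (slotAt_cases (D := D) W c e b).resolve_left (hab ▸ ha0)
    obtain rfl : i = k := by omega
    omega
  · intro a ha b hb ha0 hb0
    rw [slot_stateAt hW hM hbud he ha] at ha0 ⊢
    rw [slot_stateAt hW hM hbud he hb] at hb0 ⊢
    exact part_stateAt hW hM hbud he ha hb ha0 hb0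

/-- The table is at least the value of any feasible pair, read off at the state of that pair. -/
theorem table_stateAt (hlo : ∀ i < D.m, D.lo i ≤ D.hi i) (e : ℕ) (he : e ≤ D.n) :
    D.value e (W.filter fun i => D.lo i < e) w ≤ D.table e (D.stateAt W w c e) := by
  induction e with
  | zero =>
    have h1 : W.filter (fun i => D.lo i < 0) = ∅ := by simp
    have h2 : D.digitAt W w c 0 = fun _ => 0 := by
      have h0 : ∀ a, D.slotAt W c 0 a = 0 := fun a =>
        (slotAt_cases (D := D) W c 0 a).resolve_right fun ⟨i, _, _, h, _⟩ => by omega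
      funext k
      simp [digitAt, h0]
    rw [h1, stateAt, h2, enc_zero]
    simp [table, value, Mask.mask]
  | succ e ih =>
    have ih := ih (by omega)
    set W' := W.filter fun i => D.lo i < e + 1 with hW'
    have hfil : W'.filter (fun i => D.lo i < e) = W.filter fun i => D.lo i < e := by
      ext i
      simp only [hW', Finset.mem_filter]
      constructor
      · exact fun h => ⟨h.1.1, h.2⟩
      · exact fun h => ⟨⟨h.1, by omega⟩, h.2⟩
    have h1 := rep_stateAt hW hM hbud hc hinj (e := e) (by omega)
    have h2 := rep_stateAt hW hM hbud hc hinj he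
    rw [← hfil] at h1
    have hslots : ∀ a < D.C, D.SlotStep e (D.stateAt W w c e) (D.stateAt W w c (e + 1)) a := by
      intro a ha
      unfold SlotStep
      rw [slot_stateAt hW hM hbud he ha, slot_stateAt hW hM hbud (by omega) ha]
      rcases slotAt_cases (D := D) W c e a with h3 | ⟨i, hi, hia, h3, h4, h5⟩
      · refine Or.inr ⟨Or.inl h3, ?_⟩
        rcases slotAt_cases (D := D) W c (e + 1) a with h6 | ⟨k, hk, hka, h6, h7, h8⟩
        · exact Or.inl h6
        · have := Finset.mem_range.1 (hW.subset hk)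
          rw [h8, Nat.add_sub_cancel]
          refine Or.inr ⟨by omega, ?_⟩
          by_contra hne
          have := slotAt_eq (e := e) hinj hk (by omega) (by omega)
          rw [hka] at this
          omega
      · by_cases hie : e ≤ D.hi i
        · have := slotAt_eq (e := e + 1) hinj hi (by omega) (by omega)
          rw [hia] at this
          left
          rw [this, h5, Nat.add_sub_cancel]
          exact ⟨rfl, Or.inr hie⟩
        · right
          rw [h5, Nat.add_sub_cancel]
          refine ⟨Or.inr (by omega), ?_⟩
          rcases slotAt_cases (D := D) W c (e + 1) a with h6 | ⟨k, hk, hka, h6, h7, h8⟩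
          · exact Or.inl h6
          · have := Finset.mem_range.1 (hW.subset hk)
            rw [h8, Nat.add_sub_cancel]
            refine Or.inr ⟨by omega, ?_⟩
            by_contra hne
            have := slotAt_eq (e := e) hinj hk (by omega) (by omega)
            rw [hka, h5] at this
            obtain rfl : i = k := by omega
            omega
    have hst : D.Stays e (D.stateAt W w c e) (D.stateAt W w c (e + 1)) := by
      intro a ha h0
      rcases hslots a ha with h1 | h1
      · exact Or.inl h1.1
      · exact Or.inr (h1.2.resolve_left h0).2
    have hfeas : D.Feas (e + 1) W' w := by
      refine ⟨h2.subset, fun i hi k hk => (psum_mono he).trans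
        (hW.bound i (Finset.mem_filter.1 hi).1 k (Finset.mem_filter.1 hk).1), fun x hx => ?_⟩
      exact (Finset.card_le_card (Finset.filter_subset_filter _
        (Finset.filter_subset _ _))).trans (hW.load x (by omega))
    have hv := h1.valid h2 hst hslots hfeas
    have hpos : D.table e (D.stateAt W w c e) ≠ 0 := by
      have : 0 < D.value e (W.filter fun i => D.lo i < e) w := by unfold value; positivity
      omega
    rw [h1.value_step hlo h2 hst, hfil, table]
    classical
    have := Finset.le_sup (f := fun s => if D.table e s ≠ 0 ∧
      D.Valid e s (D.stateAt W w c (e + 1)) then D.table e s +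
        2 ^ D.m * D.gain s (D.stateAt W w c (e + 1)) + D.newMask s (D.stateAt W w c (e + 1)) else 0)
      (Finset.mem_range.2 (stateAt_lt (c := c) hW hM hbud (e := e) (by omega)))
    rw [if_pos ⟨hpos, hv⟩] at this
    refine le_trans ?_ (this.trans (le_of_eq ?_))
    · omega
    · congr!

end Complete

/-- The best entry of the last row of the table. -/
noncomputable def best (D : Data) : ℕ := (Finset.range D.states).sup (D.table D.n)

/-- The dynamic program finds a feasible set of agents with weights of largest total. -/
theorem exists_best (hlo : ∀ i < D.m, D.lo i ≤ D.hi i ∧ D.hi i < D.n) (hM : D.m < D.M)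
    (hcap : ∀ x < D.n, D.cap x ≤ D.C)
    (hbud : ∀ k < D.m, (∀ x, D.lo k ≤ x → x ≤ D.hi k → D.cap x ≠ 0) → D.bud k < D.M) :
    ∃ W w, D.Feas D.n W w ∧ D.best = D.value D.n W w ∧ ∀ W' w', D.Feas D.n W' w' →
      ∑ i ∈ W', D.psum w' i i D.n ≤ ∑ i ∈ W, D.psum w i i D.n := by
  have hle : ∀ W' w', D.Feas D.n W' w' → D.value D.n W' w' ≤ D.best := by
    intro W' w' h
    obtain ⟨c, hc, hinj⟩ := exists_coloring D.C D.lo D.hi W'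
      (fun i hi => (hlo i (Finset.mem_range.1 (h.subset hi))).1) (by
        intro x
        by_cases hx : x < D.n
        · exact (h.load x hx).trans (hcap x hx)
        · rw [Finset.filter_false_of_mem fun i hi => ?_]
          · simp
          · have := hlo i (Finset.mem_range.1 (h.subset hi))
            omega)
    have hb : ∀ k ∈ W', D.bud k < D.M := by
      intro k hk
      have hk' := Finset.mem_range.1 (h.subset hk)
      refine hbud k hk' fun x hx1 hx2 h0 => ?_
      have h1 := h.load x (hx2.trans_lt (hlo k hk').2)
      rw [h0, Nat.le_zero, Finset.card_eq_zero] at h1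
      have : k ∈ W'.filter fun i => D.lo i ≤ x ∧ x ≤ D.hi i := Finset.mem_filter.2 ⟨hk, hx1, hx2⟩
      rw [h1] at this
      simp at this
    have h1 := table_stateAt h hM hb hc hinj (fun i hi => (hlo i hi).1) D.n le_rfl
    rw [Finset.filter_true_of_mem fun i hi => by
      have := hlo i (Finset.mem_range.1 (h.subset hi)); omega] at h1
    exact h1.trans (Finset.le_sup (Finset.mem_range.2 (stateAt_lt h hM hb le_rfl)))
  have hpos : D.best ≠ 0 := by
    have h1 := hle ∅ (fun _ _ => 0) ⟨by simp, by simp, by simp⟩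
    have : 0 < D.value D.n ∅ (fun _ _ => 0) := by unfold value; positivity
    omega
  have hne : (Finset.range D.states).Nonempty := by
    by_contra h
    rw [Finset.not_nonempty_iff_eq_empty] at h
    exact hpos (by simp [best, h])
  obtain ⟨s, hs, heq⟩ := Finset.exists_mem_eq_sup _ hne (D.table D.n)
  obtain ⟨W, w, -, h2, h3⟩ := table_sound (fun i hi => (hlo i hi).1) D.n s (by rw [← heq]; exact hpos)
  refine ⟨W, w, h2, by rw [best, heq, h3], fun W' w' h => ?_⟩
  have h4 := hle W' w' h
  rw [best, heq, h3] at h4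
  unfold value at h4
  have h5 := Mask.mask_lt h2.subset
  by_contra! hlt
  have h6 : 2 ^ D.m * (∑ i ∈ W, D.psum w i i D.n + 1) ≤
      2 ^ D.m * ∑ i ∈ W', D.psum w' i i D.n := Nat.mul_le_mul le_rfl hlt
  rw [mul_add] at h4 h6
  rw [mul_add] at h4
  omega

end Data

end Sweep

/-! ### Least covers of intervals by recursion along the path -/

namespace Sweep

open Cover Mask

/-- The edges from `lo k` to `hi k`. -/
def seg (lo hi : ℕ → ℕ) (k : ℕ) : Finset ℕ := Finset.Icc (lo k) (hi k)

/-- The bound on prices for the weights `weight m u`. -/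
def top (m : ℕ) (u : ℕ → ℕ) : ℕ := ∑ k ∈ Finset.range m, weight m u k + 1

/-- The amount by which the least weight of a cover of the edges from `l` to `y - 1` stays below
`top m u`; the weights are `weight m u` and the agents are those with a digit `1` in the binary
number `q`.  It is `0` if there is no cover. -/
def slack (m : ℕ) (lo hi u : ℕ → ℕ) (q l : ℕ) : ℕ → ℕ
  | y => if y ≤ l then top m u else (Finset.range m).sup fun k =>
      if _h : q / 2 ^ k % 2 ≠ 0 ∧ lo k < y ∧ y ≤ hi k + 1 then
        slack m lo hi u q l (lo k) - weight m u k else 0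
termination_by y => y
decreasing_by exact _h.2.1

variable {m : ℕ} {lo hi u : ℕ → ℕ} {W : Finset ℕ}

theorem mask_digit_ne_zero (W : Finset ℕ) (k : ℕ) : mask W / 2 ^ k % 2 ≠ 0 ↔ k ∈ W := by
  rw [mask_div_mod]
  split_ifs <;> simp_all

/-- The recursion defining `slack` splits off the last interval of a least cover. -/
theorem slack_eq (hW : W ⊆ Finset.range m) (l y : ℕ) :
    slack m lo hi u (mask W) l y =
      top m u - price (seg lo hi) (weight m u) (Finset.range m) W (Finset.Ico l y) := by
  induction y using Nat.strong_induction_on with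
  | _ y ih =>
  rw [slack]
  split_ifs with hy
  · rw [Finset.Ico_eq_empty (by omega), price_empty, Nat.sub_zero]
  have hle : price (seg lo hi) (weight m u) (Finset.range m) W (Finset.Ico l y) ≤ top m u :=
    price_le_top
  apply le_antisymm
  · refine Finset.sup_le fun k _ => ?_
    split_ifs with h
    · rw [ih _ h.2.1]
      have hk := (mask_digit_ne_zero W k).1 h.1
      have h1 : price (seg lo hi) (weight m u) (Finset.range m) W (Finset.Ico l y) ≤
          price (seg lo hi) (weight m u) (Finset.range m) W (Finset.Ico l (lo k)) +
            weight m u k := by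
        refine (price_mono (T := Finset.Ico l (lo k) ∪ seg lo hi k) fun x hx => ?_).trans
          ((price_union_le _ _).trans (Nat.add_le_add_left (price_bundle_le hk) _))
        rw [Finset.mem_union, seg, Finset.mem_Icc, Finset.mem_Ico]
        rw [Finset.mem_Ico] at hx
        omega
      omega
    · exact Nat.zero_le _
  · rcases price_eq (seg lo hi) (weight m u) (Finset.range m) W (Finset.Ico l y) with h | ⟨K, hK, h⟩
    · rw [h, top, Nat.sub_self]; exact Nat.zero_le _
    obtain ⟨k, hk, hyk⟩ := Finset.mem_biUnion.1 (hK.2 (Finset.mem_Ico.2 ⟨show l ≤ y - 1 by omega,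
      by omega⟩))
    rw [seg, Finset.mem_Icc] at hyk
    have hkW := hK.1 hk
    refine le_trans ?_ (Finset.le_sup (hW hkW))
    rw [dif_pos ⟨(mask_digit_ne_zero W k).2 hkW, by omega, by omega⟩, ih _ (by omega)]
    have h1 : price (seg lo hi) (weight m u) (Finset.range m) W (Finset.Ico l (lo k)) ≤
        ∑ i ∈ K.erase k, weight m u i := by
      refine price_le ⟨(Finset.erase_subset _ _).trans hK.1, fun x hx => ?_⟩
      rw [Finset.mem_Ico] at hx
      obtain ⟨i, hi, hxi⟩ := Finset.mem_biUnion.1 (hK.2 (Finset.mem_Ico.2 ⟨hx.1, show x < y by omega⟩))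
      refine Finset.mem_biUnion.2 ⟨i, Finset.mem_erase.2 ⟨?_, hi⟩, hxi⟩
      rintro rfl
      rw [seg, Finset.mem_Icc] at hxi
      omega
    have h2 := Finset.sum_erase_add K (weight m u) hk
    omega

/-! ### Repeated exchanges -/

/-- The weight of a least cover of the edges of the agent `j`, with the cover in the last `m`
binary digits. -/
def coverValue (m : ℕ) (lo hi u : ℕ → ℕ) (q j : ℕ) : ℕ :=
  top m u - slack m lo hi u q (lo j) (hi j + 1)

/-- The losing agent `j` values its edges higher than some cover of them by winners. -/
def Envies (m : ℕ) (lo hi u : ℕ → ℕ) (q j : ℕ) : Prop :=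
  q / 2 ^ j % 2 = 0 ∧ slack m lo hi u q (lo j) (hi j + 1) ≠ 0 ∧
    coverValue m lo hi u q j / 2 ^ m < u j

instance (m : ℕ) (lo hi u : ℕ → ℕ) (q j : ℕ) : Decidable (Envies m lo hi u q j) :=
  inferInstanceAs (Decidable (_ ∧ _ ∧ _))

/-- One more than the largest result of an exchange, and `0` if no agent is envious. -/
def candidate (m : ℕ) (lo hi u : ℕ → ℕ) (q : ℕ) : ℕ :=
  (Finset.range m).sup fun j => if Envies m lo hi u q j then
    q + 2 ^ j - coverValue m lo hi u q j % 2 ^ m + 1 else 0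

/-- The result of an exchange, if some agent is envious. -/
def next (m : ℕ) (lo hi u : ℕ → ℕ) (q : ℕ) : ℕ :=
  if candidate m lo hi u q = 0 then q else candidate m lo hi u q - 1

theorem seg_eq (lo hi : ℕ → ℕ) (j : ℕ) : Finset.Ico (lo j) (hi j + 1) = seg lo hi j := by
  ext x
  rw [seg, Finset.mem_Icc, Finset.mem_Ico]
  omega

theorem coverValue_eq (hW : W ⊆ Finset.range m) (j : ℕ) : coverValue m lo hi u (mask W) j =
    price (seg lo hi) (weight m u) (Finset.range m) W (seg lo hi j) := by
  rw [coverValue, slack_eq hW, seg_eq]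
  have : price (seg lo hi) (weight m u) (Finset.range m) W (seg lo hi j) ≤ top m u := price_le_top
  omega

theorem slack_ne_zero_iff (hW : W ⊆ Finset.range m) (j : ℕ) :
    slack m lo hi u (mask W) (lo j) (hi j + 1) ≠ 0 ↔
      price (seg lo hi) (weight m u) (Finset.range m) W (seg lo hi j) <
        ∑ i ∈ Finset.range m, weight m u i + 1 := by
  rw [slack_eq hW, seg_eq, top]
  omega

theorem coverValue_div (hW : W ⊆ Finset.range m) {j : ℕ} (hj : j ∈ W) :
    coverValue m lo hi u (mask W) j / 2 ^ m =
      price (seg lo hi) u (Finset.range m) W (seg lo hi j) := by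
  obtain ⟨K, -, h1, h2, -⟩ := exists_cover_of_weight (S := seg lo hi j) hW
    (price_lt_top (u := weight m u) hW (isCover_singleton (b := seg lo hi) hj))
  rw [coverValue_eq hW, h1, h2]

/-- No losing agent values its edges higher than the price of a cover of them. -/
def Stable (m : ℕ) (lo hi u : ℕ → ℕ) (W : Finset ℕ) : Prop :=
  ∀ j < m, j ∉ W → u j ≤ price (seg lo hi) u (Finset.range m) W (seg lo hi j)

theorem exists_of_envies (hW : W ⊆ Finset.range m) {j : ℕ}
    (h : Envies m lo hi u (mask W) j) : ∃ K, IsCover (seg lo hi) W (seg lo hi j) K ∧ j ∉ W ∧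
      price (seg lo hi) u (Finset.range m) W (seg lo hi j) = ∑ i ∈ K, u i ∧ ∑ i ∈ K, u i < u j ∧
      coverValue m lo hi u (mask W) j % 2 ^ m = mask K := by
  obtain ⟨h1, h2, h3⟩ := h
  rw [slack_ne_zero_iff hW] at h2
  obtain ⟨K, hK, h4, h5, h6⟩ := exists_cover_of_weight hW h2
  rw [coverValue_eq hW, h5] at h3
  refine ⟨K, hK, fun hj => (mask_digit_ne_zero W j).2 hj h1, h4, h3, by rw [coverValue_eq hW, h6]⟩

/-- A round either finds no envious loser or exchanges a least cover for one. -/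
theorem next_spec (hW : W ⊆ Finset.range m) :
    (Stable m lo hi u W ∧ next m lo hi u (mask W) = mask W) ∨
    ∃ j < m, ∃ K, IsCover (seg lo hi) W (seg lo hi j) K ∧ j ∉ W ∧
      price (seg lo hi) u (Finset.range m) W (seg lo hi j) = ∑ i ∈ K, u i ∧ ∑ i ∈ K, u i < u j ∧
      next m lo hi u (mask W) = mask (swap W K j) := by
  by_cases h0 : candidate m lo hi u (mask W) = 0
  · left
    refine ⟨fun j hjm hj => ?_, if_pos h0⟩
    by_contra! hlt
    have htop : u j < ∑ i ∈ Finset.range m, u i + 1 :=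
      Nat.lt_succ_of_le (Finset.single_le_sum (f := u) (fun _ _ => Nat.zero_le _)
        (Finset.mem_range.2 hjm))
    obtain ⟨K, hK, -⟩ := exists_cover_of_lt (hlt.trans htop)
    have h1 := price_lt_top (u := weight m u) hW hK
    obtain ⟨L, hL, h2, h3, -⟩ := exists_cover_of_weight hW h1
    have henv : Envies m lo hi u (mask W) j := by
      refine ⟨?_, (slack_ne_zero_iff hW j).2 h1, by rw [coverValue_eq hW, h3, ← h2]; exact hlt⟩
      by_contra h
      exact hj ((mask_digit_ne_zero W j).1 h)
    have := Finset.le_sup (f := fun j => if Envies m lo hi u (mask W) j then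
      mask W + 2 ^ j - coverValue m lo hi u (mask W) j % 2 ^ m + 1 else 0)
      (Finset.mem_range.2 hjm)
    rw [if_pos henv, ← candidate, h0] at this
    omega
  · right
    have hne : (Finset.range m).Nonempty := by
      by_contra h
      rw [Finset.not_nonempty_iff_eq_empty] at h
      exact h0 (by rw [candidate, h]; rfl)
    obtain ⟨j, hj, heq⟩ := Finset.exists_mem_eq_sup _ hne fun j =>
      if Envies m lo hi u (mask W) j then
        mask W + 2 ^ j - coverValue m lo hi u (mask W) j % 2 ^ m + 1 else 0
    rw [← candidate] at heq
    have henv : Envies m lo hi u (mask W) j := by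
      by_contra h
      exact h0 (by rw [heq, if_neg h])
    obtain ⟨K, hK, hjW, h1, h2, h3⟩ := exists_of_envies hW henv
    refine ⟨j, Finset.mem_range.1 hj, K, hK, hjW, h1, h2, ?_⟩
    rw [next, if_neg h0, heq, if_pos henv, mask_swap hK.1 hjW, h3]
    omega

theorem swap_subset (hW : W ⊆ Finset.range m) {K : Finset ℕ} {j : ℕ} (hj : j < m) :
    swap W K j ⊆ Finset.range m := by
  intro x hx
  rcases Finset.mem_insert.1 hx with rfl | hx
  · exact Finset.mem_range.2 hj
  · exact hW (Finset.mem_sdiff.1 hx).1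

/-- After `m² + 1` exchanges no losing agent is envious, the loads have not risen and the revenue
has not dropped. -/
theorem iterate_next_spec (hlo : ∀ i < m, lo i ≤ hi i) (hW : W ⊆ Finset.range m) :
    ∃ W' ⊆ Finset.range m, (next m lo hi u)^[m * m + 1] (mask W) = mask W' ∧
      Stable m lo hi u W' ∧
      (∀ x, (W'.filter fun i => x ∈ seg lo hi i).card ≤
        (W.filter fun i => x ∈ seg lo hi i).card) ∧
      ∑ i ∈ W, price (seg lo hi) u (Finset.range m) W (seg lo hi i) ≤
        ∑ i ∈ W', price (seg lo hi) u (Finset.range m) W' (seg lo hi i) := by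
  -- Each exchange lowers the potential, which is at most `m * m` at the start.
  have key : ∀ t, ∃ W' ⊆ Finset.range m, (next m lo hi u)^[t] (mask W) = mask W' ∧
      (Stable m lo hi u W' ∨ potential u (Finset.range m) W' + t ≤
        potential u (Finset.range m) W) ∧
      (∀ x, (W'.filter fun i => x ∈ seg lo hi i).card ≤
        (W.filter fun i => x ∈ seg lo hi i).card) ∧
      ∑ i ∈ W, price (seg lo hi) u (Finset.range m) W (seg lo hi i) ≤
        ∑ i ∈ W', price (seg lo hi) u (Finset.range m) W' (seg lo hi i) := by
    intro t
    induction t with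
    | zero => exact ⟨W, hW, rfl, Or.inr le_rfl, fun _ => le_rfl, le_rfl⟩
    | succ t ih =>
      obtain ⟨W', hW', h1, h2, h3, h4⟩ := ih
      rcases next_spec (lo := lo) (hi := hi) (u := u) hW' with ⟨h5, h6⟩ | ⟨j, hj, K, hK, hjW, h5, h6, h7⟩
      · exact ⟨W', hW', by rw [Function.iterate_succ_apply', h1, h6], Or.inl h5, h3, h4⟩
      · have hpot := potential_swap_lt (b := seg lo hi) (u := u) (A := Finset.range m) hW'
          (Finset.nonempty_Icc.2 (hlo j hj)) hjW hK h6
        refine ⟨swap W' K j, swap_subset hW' hj, by rw [Function.iterate_succ_apply', h1, h7], ?_,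
          fun x => (load_swap_le hK x).trans (h3 x),
          h4.trans (sum_price_le_swap hjW hK h5 h6.le)⟩
        rcases h2 with h2 | h2
        · have := h2 j hj hjW
          omega
        · right; omega
  obtain ⟨W', hW', h1, h2, h3, h4⟩ := key (m * m + 1)
  refine ⟨W', hW', h1, h2.resolve_right fun h => ?_, h3, h4⟩
  have := potential_le (u := u) hW
  rw [Finset.card_range] at this
  omega

/-! ### Prices from edge weights -/

namespace Data

/-- Edge weights within the budgets bound the price of a bundle from below. -/
theorem Feas.le_price {D : Data} {w : ℕ → ℕ → ℕ} (h : D.Feas D.n W w)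
    {c A : ℕ} (hbud : ∀ k ∈ W, c * D.bud k ≤ A * u k + c) {i : ℕ} (hi : i ∈ W) :
    c * D.psum w i i D.n ≤
      A * price (seg D.lo D.hi) u (Finset.range D.m) W (seg D.lo D.hi i) + c * D.m := by
  obtain ⟨K, hK, h1⟩ := exists_cover_of_lt (price_lt_top (u := u) h.subset
    (isCover_singleton (b := seg D.lo D.hi) hi))
  rw [h1]
  -- Every edge of `i` lies in the bundle of some `k ∈ K`, so its weight is counted at least once.
  have h2 : D.psum w i i D.n ≤ ∑ k ∈ K, D.psum w i k D.n := by
    unfold psum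
    rw [Finset.sum_comm]
    refine Finset.sum_le_sum fun x _ => ?_
    split_ifs with hx
    · obtain ⟨k, hk, hxk⟩ := Finset.mem_biUnion.1 (hK.2 (Finset.mem_Icc.2 hx.1))
      refine le_trans ?_ (Finset.single_le_sum (fun _ _ => Nat.zero_le _) hk)
      rw [if_pos ⟨hx.1, Finset.mem_Icc.1 hxk⟩]
    · exact Nat.zero_le _
  have h3 : K.card ≤ D.m := by
    have := Finset.card_le_card (hK.1.trans h.subset)
    rwa [Finset.card_range] at this
  calc c * D.psum w i i D.n ≤ c * ∑ k ∈ K, D.bud k :=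
        Nat.mul_le_mul le_rfl (h2.trans (Finset.sum_le_sum fun k hk => h.bound i hi k (hK.1 hk)))
    _ = ∑ k ∈ K, c * D.bud k := Finset.mul_sum _ _ _
    _ ≤ ∑ k ∈ K, (A * u k + c) := Finset.sum_le_sum fun k hk => hbud k (hK.1 hk)
    _ = A * ∑ k ∈ K, u k + c * K.card := by
        rw [Finset.sum_add_distrib, ← Finset.mul_sum, Finset.sum_const, smul_eq_mul, mul_comm c]
    _ ≤ _ := by
        have := Nat.mul_le_mul_left c h3
        omega

end Data

end Sweep

/-! ### The algorithm as a function of the input word -/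

namespace Algo

open Cover Mask Sweep

variable (C : ℕ) (g : ℕ → ℕ)

/-- The number of edges in the input `g`. -/
abbrev n : ℕ := g 2

/-- The number of agents in the input `g`. -/
abbrev m : ℕ := g 3

/-- The capacity of an edge. -/
abbrev cap (e : ℕ) : ℕ := g (4 + e)

/-- The first edge of an agent. -/
abbrev lo (k : ℕ) : ℕ := g (4 + n g + 4 * k)

/-- The last edge of an agent. -/
abbrev hi (k : ℕ) : ℕ := g (4 + n g + 4 * k + 1)

/-- The numerator of a valuation. -/
abbrev num (k : ℕ) : ℕ := g (4 + n g + 4 * k + 2)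

/-- The denominator of a valuation. -/
abbrev den (k : ℕ) : ℕ := g (4 + n g + 4 * k + 3)

/-- The common denominator of the valuations. -/
def denProd : ℕ := ∏ k ∈ Finset.range (m g), den g k

/-- The valuation of an agent as a multiple of `1 / denProd g`. -/
def u (k : ℕ) : ℕ := num g k * (denProd g / den g k)

/-- The number of edges of an agent that have capacity zero. -/
def blocked (k : ℕ) : ℕ :=
  ∑ e ∈ Finset.range (n g), if lo g k ≤ e ∧ e ≤ hi g k ∧ cap g e = 0 then 1 else 0

/-- The largest valuation of an agent all of whose edges have positive capacity. -/
def maxVal : ℕ := (Finset.range (m g)).sup fun k => if blocked g k = 0 then u g k else 0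

/-- The numerator of the scaling factor for valuations. -/
def scale : ℕ := 2 * (m g * m g) * g 1

/-- The budget of an agent: its valuation in multiples of the rounding unit, rounded down, plus
one. -/
def bud (k : ℕ) : ℕ := u g k * scale g / (g 0 * maxVal g) + 1

/-- A number that is larger than all digits in a state of the dynamic program. -/
def base : ℕ := scale g / g 0 + m g + 2

/-- The data of the dynamic program. -/
def data : Data := ⟨n g, m g, C, base g, cap g, lo g, hi g, bud g⟩

/-- The winners found by the dynamic program. -/
noncomputable def start : ℕ := (data C g).best % 2 ^ m g

/-- The winners after `t` exchanges. -/
noncomputable def winners (t : ℕ) : ℕ := (next (m g) (lo g) (hi g) (u g))^[t] (start C g)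

/-- The winners at the end. -/
noncomputable def final : ℕ := winners C g (m g * m g + 1)

/-- The input describes an instance with capacities at most `C` and a positive accuracy. -/
structure Ok : Prop where
  eps_num : 0 < g 0
  eps_den : 0 < g 1
  lo_hi : ∀ k < m g, lo g k ≤ hi g k ∧ hi g k < n g
  cap_le : ∀ e < n g, cap g e ≤ C
  den_pos : ∀ k < m g, 0 < den g k

/-- The set `W` of agents respects the capacities. -/
def LoadOk (W : Finset ℕ) : Prop :=
  ∀ x < n g, (W.filter fun i => lo g i ≤ x ∧ x ≤ hi g i).card ≤ cap g x

/-- The agents in `W` can be charged the amounts `π i (hi i + 1)`, where `π i x` is the price of the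
edges from `lo i` to `x - 1`. -/
structure Candidate (W : Finset ℕ) (π : ℕ → ℕ → ℝ) : Prop where
  subset : W ⊆ Finset.range (m g)
  load : LoadOk g W
  mono : ∀ i ∈ W, Monotone (π i)
  zero : ∀ i ∈ W, π i (lo g i) = 0
  le_add : ∀ i ∈ W, ∀ k ∈ W, ∀ x y, lo g k ≤ x → x ≤ y → y ≤ hi g k + 1 →
    π i y ≤ π i x + u g k

variable {C g}

theorem denProd_pos (h : Ok C g) : 0 < denProd g :=
  Finset.prod_pos fun k hk => h.den_pos k (Finset.mem_range.1 hk)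

theorem u_eq (h : Ok C g) {k : ℕ} (hk : k < m g) :
    (u g k : ℝ) = (num g k : ℝ) / den g k * denProd g := by
  have hd : den g k ∣ denProd g := Finset.dvd_prod_of_mem _ (Finset.mem_range.2 hk)
  have h0 : (den g k : ℝ) ≠ 0 := by exact_mod_cast (h.den_pos k hk).ne'
  rw [u, Nat.cast_mul, Nat.cast_div hd h0]
  field_simp

theorem blocked_eq_zero {W : Finset ℕ} (h : Ok C g) (hW : W ⊆ Finset.range (m g))
    (hl : LoadOk g W) {k : ℕ} (hk : k ∈ W) : blocked g k = 0 := by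
  have hk' := h.lo_hi k (Finset.mem_range.1 (hW hk))
  refine Finset.sum_eq_zero fun e he => if_neg fun hc => ?_
  have h1 := hl e (Finset.mem_range.1 he)
  rw [hc.2.2, Nat.le_zero, Finset.card_eq_zero] at h1
  have : k ∈ W.filter fun i => lo g i ≤ e ∧ e ≤ hi g i := Finset.mem_filter.2 ⟨hk, hc.1, hc.2.1⟩
  rw [h1] at this
  simp at this

theorem u_le_maxVal {k : ℕ} (hk : k < m g) (hb : blocked g k = 0) : u g k ≤ maxVal g := by
  have := Finset.le_sup (f := fun k => if blocked g k = 0 then u g k else 0)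
    (Finset.mem_range.2 hk)
  rwa [if_pos hb] at this

theorem bud_lt_base {k : ℕ} (hk : k < m g) (hb : blocked g k = 0) : bud g k < base g := by
  have h1 := u_le_maxVal hk hb
  have h2 : u g k * scale g / (g 0 * maxVal g) ≤ scale g / g 0 := by
    rcases Nat.eq_zero_or_pos (maxVal g) with h0 | h0
    · simp [h0]
    · rw [← Nat.mul_div_mul_right (scale g) (g 0) h0]
      refine Nat.div_le_div_right ?_
      rw [mul_comm (scale g)]
      exact Nat.mul_le_mul h1 le_rfl
  unfold bud base
  omega

theorem sum_Ico_sub {F : ℕ → ℕ} (hF : Monotone F) {a b : ℕ} (hab : a ≤ b) :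
    ∑ x ∈ Finset.Ico a b, (F (x + 1) - F x) = F b - F a := by
  induction b, hab using Nat.le_induction with
  | base => simp
  | succ b hab ih =>
    rw [Finset.sum_Ico_succ_top hab, ih]
    have := hF hab
    have := hF (Nat.le_succ b)
    rw [Nat.succ_eq_add_one] at this
    omega

theorem psum_eq {F : ℕ → ℕ} {w : ℕ → ℕ → ℕ} {i k : ℕ}
    (hw : ∀ x, w i x = F (x + 1) - F x) (hi' : hi g i < n g) :
    (data C g).psum w i k (n g) = ∑ x ∈ Finset.Ico (max (lo g i) (lo g k))
      (min (hi g i) (hi g k) + 1), (F (x + 1) - F x) := by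
  unfold Data.psum
  rw [← Finset.sum_filter]
  refine Finset.sum_congr ?_ fun x _ => hw x
  ext x
  rw [Finset.mem_filter, Finset.mem_range, Finset.mem_Ico]
  simp only [data]
  omega

theorem exists_start (h : Ok C g) : ∃ W w, (data C g).Feas (n g) W w ∧ start C g = mask W ∧
    ∀ W' w', (data C g).Feas (n g) W' w' →
      ∑ i ∈ W', (data C g).psum w' i i (n g) ≤ ∑ i ∈ W, (data C g).psum w i i (n g) := by
  obtain ⟨W, w, h1, h2, h3⟩ := (data C g).exists_best h.lo_hi
    (by
      show m g < scale g / g 0 + m g + 2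
      generalize scale g / g 0 = q
      omega) h.cap_le (by
      intro k hk hx
      refine bud_lt_base hk (Finset.sum_eq_zero fun e _ => if_neg fun hc => ?_)
      exact hx e hc.1 hc.2.1 hc.2.2)
  refine ⟨W, w, h1, ?_, h3⟩
  rw [start, h2, Data.value]
  exact (Nat.mul_add_mod _ _ _).trans (Nat.mod_eq_of_lt (mask_lt h1.subset))

theorem Candidate.le_u {W : Finset ℕ} {π : ℕ → ℕ → ℝ} (hc : Candidate g W π) (h : Ok C g) {i : ℕ}
    (hi' : i ∈ W) : π i (hi g i + 1) ≤ u g i := by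
  have h1 := (h.lo_hi i (Finset.mem_range.1 (hc.subset hi'))).1
  have := hc.le_add i hi' i hi' (lo g i) (hi g i + 1) le_rfl (by omega) le_rfl
  rwa [hc.zero i hi', zero_add] at this

/-- The winners at the end respect the capacities, are stable, and yield at least as much as any
candidate up to an `ε`-fraction of the largest valuation. -/
theorem exists_final (h : Ok C g) : ∃ W ⊆ Finset.range (m g), final C g = mask W ∧
    Stable (m g) (lo g) (hi g) (u g) W ∧ LoadOk g W ∧
    ∀ W' π, Candidate g W' π → ∑ i ∈ W', π i (hi g i + 1) ≤
      (∑ i ∈ W, price (seg (lo g) (hi g)) (u g) (Finset.range (m g)) W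
        (seg (lo g) (hi g) i) : ℕ) + (g 0 : ℝ) / g 1 * maxVal g := by
  obtain ⟨W₀, w, h1, h2, h3⟩ := exists_start h
  obtain ⟨W, hW, h4, h5, h6, h7⟩ := iterate_next_spec (lo := lo g) (hi := hi g) (u := u g)
    (m := m g) (fun i hi => (h.lo_hi i hi).1) h1.subset
  refine ⟨W, hW, by rw [final, winners, h2, h4], h5, fun x hx => ?_, fun W' π hπ => ?_⟩
  · have h8 := h6 x
    simp only [seg, Finset.mem_Icc] at h8
    exact h8.trans (h1.load x hx)
  rcases Nat.eq_zero_or_pos (maxVal g) with h0 | h0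
  · have : ∑ i ∈ W', π i (hi g i + 1) ≤ 0 := by
      refine Finset.sum_nonpos fun i hi' => (hπ.le_u h hi').trans ?_
      have := u_le_maxVal (Finset.mem_range.1 (hπ.subset hi'))
        (blocked_eq_zero h hπ.subset hπ.load hi')
      rw [h0, Nat.le_zero] at this
      rw [this, Nat.cast_zero]
    refine this.trans ?_
    positivity
  have hm : 0 < m g := by
    by_contra hm
    have : m g = 0 := by omega
    simp [maxVal, this] at h0
  set c := g 0 * maxVal g with hc
  have hc0 : 0 < c := Nat.mul_pos h.eps_num h0
  have hA0 : 0 < scale g := by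
    have := h.eps_den
    unfold scale
    positivity
  have hcR : (0 : ℝ) < c := by exact_mod_cast hc0
  have hAR : (0 : ℝ) < scale g := by exact_mod_cast hA0
  set r : ℝ := scale g / c with hr
  have hr0 : 0 < r := div_pos hAR hcR
  -- The given prices are rounded down to multiples of `1 / r`.
  set F : ℕ → ℕ → ℕ := fun i x => ⌊π i x * r⌋₊ with hF
  set w' : ℕ → ℕ → ℕ := fun i x => F i (x + 1) - F i x with hw'
  have hFmono : ∀ i ∈ W', Monotone (F i) := fun i hi' x y hxy =>
    Nat.floor_mono (mul_le_mul_of_nonneg_right (hπ.mono i hi' hxy) hr0.le)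
  have hn : ∀ i ∈ W', lo g i ≤ hi g i ∧ hi g i < n g := fun i hi' =>
    h.lo_hi i (Finset.mem_range.1 (hπ.subset hi'))
  have hfeas : (data C g).Feas (n g) W' w' := by
    refine ⟨hπ.subset, fun i hi' k hk => ?_, hπ.load⟩
    rw [psum_eq (fun _ => rfl) (hn i hi').2]
    rcases Nat.lt_or_ge (min (hi g i) (hi g k) + 1) (max (lo g i) (lo g k)) with hlt | hge
    · rw [Finset.Ico_eq_empty (by omega), Finset.sum_empty]; exact Nat.zero_le _
    rw [sum_Ico_sub (hFmono i hi') hge]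
    set x := max (lo g i) (lo g k) with hx
    set y := min (hi g i) (hi g k) + 1 with hy
    have hxy := hπ.le_add i hi' k hk x y (le_max_right _ _) hge (by omega)
    have hx0 : 0 ≤ π i x := by
      rw [← hπ.zero i hi']
      exact hπ.mono i hi' (le_max_left _ _)
    -- Rounding may raise an increment by less than one unit, which the `+ 1` in the budget absorbs.
    have hfl : F i y ≤ F i x + (u g k * scale g / c + 1) := by
      have h8 : (u g k * scale g / c : ℕ) = ⌊(u g k : ℝ) * r⌋₊ := by
        rw [hr, ← mul_div_assoc, ← Nat.cast_mul, Nat.floor_div_eq_div]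
      rw [h8, hF]
      dsimp only
      have h9 : π i y * r ≤ π i x * r + u g k * r := by
        rw [← add_mul]; exact mul_le_mul_of_nonneg_right hxy hr0.le
      have h10 := Nat.lt_floor_add_one (π i x * r)
      have h11 := Nat.lt_floor_add_one ((u g k : ℝ) * r)
      have h12 : ⌊π i y * r⌋₊ < ⌊π i x * r⌋₊ + (⌊(u g k : ℝ) * r⌋₊ + 1) + 1 := by
        rw [Nat.floor_lt' (by omega)]
        push_cast
        linarith
      omega
    exact Nat.sub_le_iff_le_add'.2 hfl
  have h8 := h3 W' w' hfeas
  have h9 : ∀ i ∈ W', (data C g).psum w' i i (n g) = F i (hi g i + 1) := by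
    intro i hi'
    rw [psum_eq (fun _ => rfl) (hn i hi').2, max_self, min_self,
      sum_Ico_sub (hFmono i hi') (by have := hn i hi'; omega)]
    simp [hF, hπ.zero i hi']
  rw [Finset.sum_congr rfl h9] at h8
  have h10 : ∀ i ∈ W₀, c * (data C g).psum w i i (n g) ≤ scale g *
      price (seg (lo g) (hi g)) (u g) (Finset.range (m g)) W₀ (seg (lo g) (hi g) i) + c * m g :=
    fun i hi' => h1.le_price (D := data C g) (u := u g) (A := scale g) (fun k _ => by
      show c * (u g k * scale g / c + 1) ≤ scale g * u g k + c
      have := Nat.mul_div_le (u g k * scale g) c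
      rw [mul_add, mul_one, mul_comm (scale g)]
      omega) hi'
  have h11 : c * ∑ i ∈ W₀, (data C g).psum w i i (n g) ≤ scale g * ∑ i ∈ W₀,
      price (seg (lo g) (hi g)) (u g) (Finset.range (m g)) W₀ (seg (lo g) (hi g) i) +
        c * (m g * m g) := by
    rw [Finset.mul_sum]
    refine (Finset.sum_le_sum h10).trans ?_
    rw [Finset.sum_add_distrib, ← Finset.mul_sum, Finset.sum_const, smul_eq_mul]
    have := Finset.card_le_card h1.subset
    have h12 : (data C g).m = m g := rfl
    rw [Finset.card_range, h12] at this
    have := Nat.mul_le_mul_right (c * m g) this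
    nlinarith
  have h13 := Finset.card_le_card hπ.subset
  rw [Finset.card_range] at h13
  -- Each winner loses less than one unit.
  have h14 : (∑ i ∈ W', π i (hi g i + 1)) * r ≤ ∑ i ∈ W', (F i (hi g i + 1) : ℝ) + m g := by
    rw [Finset.sum_mul]
    calc ∑ i ∈ W', π i (hi g i + 1) * r ≤ ∑ i ∈ W', ((F i (hi g i + 1) : ℝ) + 1) :=
          Finset.sum_le_sum fun i _ => (Nat.lt_floor_add_one _).le
      _ = ∑ i ∈ W', (F i (hi g i + 1) : ℝ) + W'.card := by
          rw [Finset.sum_add_distrib, Finset.sum_const, nsmul_eq_mul, mul_one]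
      _ ≤ _ := by
          have : (W'.card : ℝ) ≤ m g := by exact_mod_cast h13
          linarith
  set P₀ := ∑ i ∈ W₀, price (seg (lo g) (hi g)) (u g) (Finset.range (m g)) W₀
    (seg (lo g) (hi g) i) with hP0
  set P := ∑ i ∈ W, price (seg (lo g) (hi g)) (u g) (Finset.range (m g)) W
    (seg (lo g) (hi g) i) with hP
  have h15 : (P₀ : ℝ) ≤ P := by exact_mod_cast h7
  have h16 : (∑ i ∈ W', (F i (hi g i + 1) : ℝ)) ≤
      ((∑ i ∈ W₀, (data C g).psum w i i (n g) : ℕ) : ℝ) := by exact_mod_cast h8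
  have h17 : (c : ℝ) * ((∑ i ∈ W₀, (data C g).psum w i i (n g) : ℕ) : ℝ) ≤
      scale g * P₀ + c * (m g * m g) := by exact_mod_cast h11
  set G : ℝ := ((∑ i ∈ W₀, (data C g).psum w i i (n g) : ℕ) : ℝ) with hG
  set S := ∑ i ∈ W', π i (hi g i + 1) with hS
  have hS1 : S * scale g ≤ c * (G + m g) := by
    have : S * r * c ≤ (G + m g) * c := mul_le_mul_of_nonneg_right (by linarith) hcR.le
    rw [hr] at this
    have e : S * (scale g / c) * c = S * scale g := by field_simp
    rw [e] at this
    linarith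
  have hS2 : S * scale g ≤ scale g * P + c * (m g * m g + m g) := by
    have : (scale g : ℝ) * P₀ ≤ scale g * P := mul_le_mul_of_nonneg_left h15 hAR.le
    nlinarith
  have hgd : (0 : ℝ) < g 1 := by exact_mod_cast h.eps_den
  have hmR : (1 : ℝ) ≤ m g := by exact_mod_cast hm
  have hscale : (scale g : ℝ) = 2 * (m g * m g) * g 1 := by unfold scale; push_cast; ring
  have hcast : (c : ℝ) = g 0 * maxVal g := by rw [hc]; push_cast; ring
  -- The scale is chosen so that the total loss is at most `ε` times the largest valuation.
  have hfin : (c : ℝ) * (m g * m g + m g) ≤ scale g * ((g 0 : ℝ) / g 1 * maxVal g) := by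
    have e : (scale g : ℝ) * ((g 0 : ℝ) / g 1 * maxVal g) = c * (2 * (m g * m g)) := by
      rw [hscale, hcast]
      field_simp
    rw [e]
    refine mul_le_mul_of_nonneg_left ?_ hcR.le
    nlinarith
  have : scale g * S ≤ scale g * (P + (g 0 : ℝ) / g 1 * maxVal g) := by
    rw [mul_add]
    linarith
  exact le_of_mul_le_mul_left this hAR

/-- The winners at the end yield a `(1 - ε)`-fraction of the revenue of any candidate. -/
theorem one_sub_mul_le (h : Ok C g) : ∃ W ⊆ Finset.range (m g), final C g = mask W ∧
    Stable (m g) (lo g) (hi g) (u g) W ∧ LoadOk g W ∧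
    ∀ W' π, Candidate g W' π → (1 - (g 0 : ℝ) / g 1) * ∑ i ∈ W', π i (hi g i + 1) ≤
      (∑ i ∈ W, price (seg (lo g) (hi g)) (u g) (Finset.range (m g)) W
        (seg (lo g) (hi g) i) : ℕ) := by
  obtain ⟨W, hW, h1, h2, h3, h4⟩ := exists_final h
  refine ⟨W, hW, h1, h2, h3, fun W' π hπ => ?_⟩
  set P : ℝ := ((∑ i ∈ W, price (seg (lo g) (hi g)) (u g) (Finset.range (m g)) W
        (seg (lo g) (hi g) i) : ℕ) : ℝ) with hP
  set ε : ℝ := (g 0 : ℝ) / g 1 with hε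
  have hε0 : 0 ≤ ε := by positivity
  have hP0 : 0 ≤ P := Nat.cast_nonneg _
  have h5 := h4 W' π hπ
  have h6 : 0 ≤ ∑ i ∈ W', π i (hi g i + 1) := Finset.sum_nonneg fun i hi' => by
    have := (h.lo_hi i (Finset.mem_range.1 (hπ.subset hi'))).1
    rw [← hπ.zero i hi']
    exact hπ.mono i hi' (by omega)
  -- selling only to an agent of largest valuation is one of the candidates
  have h7 : (maxVal g : ℝ) ≤ P + ε * maxVal g := by
    rcases Nat.eq_zero_or_pos (maxVal g) with h0 | h0
    · rw [h0]; simpa using hP0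
    have hne : (Finset.range (m g)).Nonempty := by
      by_contra hne
      rw [Finset.not_nonempty_iff_eq_empty] at hne
      simp [maxVal, hne] at h0
    obtain ⟨k, hk, heq⟩ := Finset.exists_mem_eq_sup _ hne fun k =>
      if blocked g k = 0 then u g k else 0
    rw [← maxVal] at heq
    have hb : blocked g k = 0 := by
      by_contra hb
      rw [if_neg hb] at heq
      omega
    rw [if_pos hb] at heq
    have hk' := h.lo_hi k (Finset.mem_range.1 hk)
    have hcand : Candidate g {k} (fun i x => if x ≤ lo g i then 0 else (maxVal g : ℝ)) := by
      refine ⟨by simpa using hk, fun x hx => ?_, fun i _ x y hxy => ?_, fun i _ => if_pos le_rfl,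
        fun i hi' j hj x y _ hxy _ => ?_⟩
      · rw [Finset.filter_singleton]
        split_ifs with hx'
        · rw [Finset.card_singleton, Nat.one_le_iff_ne_zero]
          intro hc
          have := (Finset.sum_eq_zero_iff.1 hb) x (Finset.mem_range.2 hx)
          rw [if_pos ⟨hx'.1, hx'.2, hc⟩] at this
          omega
        · simp
      · split_ifs
        · exact le_rfl
        · positivity
        · omega
        · exact le_rfl
      · rw [Finset.mem_singleton] at hj
        subst hj
        rw [← heq]
        have : (0 : ℝ) ≤ maxVal g := Nat.cast_nonneg _
        split_ifs <;> linarith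
    have := h4 _ _ hcand
    rw [Finset.sum_singleton, if_neg (by omega)] at this
    exact this
  rcases le_total (maxVal g : ℝ) (∑ i ∈ W', π i (hi g i + 1)) with h8 | h8
  · nlinarith
  · rcases le_total ε 1 with h9 | h9
    · nlinarith
    · nlinarith

end Algo

/-! ### Terms -/

namespace Tab

instance : Add Term := ⟨.bin .add⟩

instance : Sub Term := ⟨.bin .sub⟩

instance : Mul Term := ⟨.bin .mul⟩

instance : Div Term := ⟨.bin .div⟩

/-- A number that is positive if and only if `a ≤ b`. -/
def Term.le (a b : Term) : Term := .lit 1 - (a - b)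

/-- A number that is positive if and only if `a = b`. -/
def Term.eq (a b : Term) : Term := .lit 1 - ((a - b) + (b - a))

/-- A number that is positive if and only if `a` is zero. -/
def Term.not (a : Term) : Term := .lit 1 - a

/-- The remainder. -/
def Term.mod (a b : Term) : Term := a - b * (a / b)

/-- A case distinction. -/
def Term.ite (c a b : Term) : Term := (.lit 1 - (.lit 1 - c)) * a + (.lit 1 - c) * b

/-- A sum over a parameter. -/
def Term.sum (p : Fin 10) (x : ℕ) (f : Term) : Term := .fold false p x f

/-- A maximum over a parameter. -/
def Term.max (p : Fin 10) (x : ℕ) (f : Term) : Term := .fold true p x f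

/-- A number that is positive if and only if `f` is positive for all values of the variable. -/
def Term.all (p : Fin 10) (x : ℕ) (f : Term) : Term := .not (.sum p x (.not f))

section Eval

variable (σ : Store) (η : ℕ → ℕ) (a b c f : Term)

theorem eval_lit' (k : ℕ) : (Term.lit k).eval σ η = k := rfl

theorem eval_var (x : ℕ) : (Term.var x).eval σ η = η x := rfl

theorem eval_get (j : Fin 30) : (Term.get j a).eval σ η = σ j (a.eval σ η) := rfl

theorem eval_add' : (a + b).eval σ η = a.eval σ η + b.eval σ η := rfl

theorem eval_sub' : (a - b).eval σ η = a.eval σ η - b.eval σ η := rfl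

theorem eval_mul' : (a * b).eval σ η = a.eval σ η * b.eval σ η := rfl

theorem eval_div' : (a / b).eval σ η = a.eval σ η / b.eval σ η := rfl

theorem eval_le : (a.le b).eval σ η ≠ 0 ↔ a.eval σ η ≤ b.eval σ η := by
  simp only [Term.le, eval_sub', eval_lit']
  omega

theorem eval_eq : (a.eq b).eval σ η ≠ 0 ↔ a.eval σ η = b.eval σ η := by
  simp only [Term.eq, eval_sub', eval_add', eval_lit']
  omega

theorem eval_not : a.not.eval σ η ≠ 0 ↔ a.eval σ η = 0 := by
  simp only [Term.not, eval_sub', eval_lit']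
  omega

theorem eval_and : (a * b).eval σ η ≠ 0 ↔ a.eval σ η ≠ 0 ∧ b.eval σ η ≠ 0 := mul_ne_zero_iff

theorem eval_or : (a + b).eval σ η ≠ 0 ↔ a.eval σ η ≠ 0 ∨ b.eval σ η ≠ 0 := by
  rw [eval_add']
  omega

theorem eval_mod : (a.mod b).eval σ η = a.eval σ η % b.eval σ η := by
  simp only [Term.mod, eval_sub', eval_mul', eval_div']
  have := Nat.div_add_mod (a.eval σ η) (b.eval σ η)
  omega

theorem eval_ite : (c.ite a b).eval σ η =
    if c.eval σ η ≠ 0 then a.eval σ η else b.eval σ η := by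
  simp only [Term.ite, eval_sub', eval_mul', eval_add', eval_lit']
  split_ifs with h
  · rw [show 1 - c.eval σ η = 0 by omega]; simp
  · rw [show c.eval σ η = 0 by omega]; simp

theorem eval_sum (p : Fin 10) (x : ℕ) : (Term.sum p x f).eval σ η =
    ∑ i ∈ Finset.range (σ (parArr p) 0), f.eval σ (Function.update η x i) := rfl

theorem eval_max (p : Fin 10) (x : ℕ) : (Term.max p x f).eval σ η =
    (Finset.range (σ (parArr p) 0)).sup fun i => f.eval σ (Function.update η x i) := rfl

theorem eval_all (p : Fin 10) (x : ℕ) : (Term.all p x f).eval σ η ≠ 0 ↔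
    ∀ i < σ (parArr p) 0, f.eval σ (Function.update η x i) ≠ 0 := by
  rw [Term.all, eval_not, eval_sum, Finset.sum_eq_zero_iff]
  simp only [Finset.mem_range]
  refine forall₂_congr fun i _ => ?_
  have := eval_not σ (Function.update η x i) f
  tauto

end Eval

/-- The first `N` values of `F`, followed by zeros. -/
def cut (N : ℕ) (F : ℕ → ℕ) (k : ℕ) : ℕ := if k < N then F k else 0

theorem cut_of_lt {N : ℕ} {F : ℕ → ℕ} {k : ℕ} (h : k < N) : cut N F k = F k := if_pos h

theorem cut_one_zero (F : ℕ → ℕ) : cut 1 F 0 = F 0 := rfl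

/-- The step holds when its body computes `F i` from the earlier arrays and the entries `F k` with
`k < i`. -/
theorem Step.holds_of {st : Step} {G : Store} {N : ℕ} {F : ℕ → ℕ} (hG : G st.tgt = cut N F)
    (hN : st.count G = N)
    (h : ∀ i < N, ∀ σ : Store, (∀ a k, a < st.tgt → σ a k = G a k) →
      (∀ k < i, σ st.tgt k = F k) →
      st.body.eval σ (Function.update (fun _ => 0) 0 i) = F i) : st.Holds G where
  eval_eq i hi := by
    rw [hN] at hi
    rw [hG, cut_of_lt hi]
    refine h i hi _ (fun a k ha => ?_) fun k hk => ?_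
    · exact if_pos (Or.inl ha)
    · rw [Store.trunc, if_pos (Or.inr ⟨rfl, hk⟩), hG, cut_of_lt (by omega)]
  eq_zero k hk := by
    rw [hN] at hk
    rw [hG, cut, if_neg (by omega)]

end Tab

/-! ### The array definitions of the algorithm -/

namespace Algo

open Tab Sweep Cover Mask

/-- The number of entries of the array `22` for one round of exchanges. -/
def row (g : ℕ → ℕ) : ℕ := m g * (n g + 1) + 1

/-- The entries of the array `22` for the round `t`: the winners, followed by the values of `slack`
for all agents and edges. -/
noncomputable def rowVal (C : ℕ) (g : ℕ → ℕ) (t r : ℕ) : ℕ :=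
  if r = 0 then winners C g t
  else slack (m g) (lo g) (hi g) (u g) (winners C g t) (lo g ((r - 1) / (n g + 1)))
    ((r - 1) % (n g + 1))

/-- The output: the numerators and denominators of the payments. -/
noncomputable def outVal (C : ℕ) (g : ℕ → ℕ) (i : ℕ) : ℕ :=
  if final C g / 2 ^ (i / 2) % 2 ≠ 0 then
    if i % 2 = 0 then
      coverValue (m g) (lo g) (hi g) (u g) (final C g) (i / 2) / 2 ^ m g
    else denProd g
  else 0

/-- The final contents of the arrays. -/
noncomputable def arr (C : ℕ) (g : ℕ → ℕ) (a : Fin 30) : ℕ → ℕ :=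
  match a.val with
  | 0 => g
  | 1 => cut 1 fun _ => n g
  | 2 => cut 1 fun _ => m g
  | 3 => cut 1 fun _ => m g + 1
  | 4 => cut 1 fun _ => (data C g).states
  | 5 => cut 1 fun _ => (n g + 1) * (data C g).states
  | 6 => cut 1 fun _ => (m g * m g + 2) * row g
  | 7 => cut 1 fun _ => 2 * m g
  | 8 => cut 1 fun _ => base g
  | 9 => cut 1 fun _ => C
  | 10 => cut 1 fun _ => C + C * C + 1
  | 11 => cut (m g + 1) fun i => ∏ k ∈ Finset.range i, den g k
  | 12 => cut (m g) (u g)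
  | 13 => cut (m g) fun k => if blocked g k = 0 then u g k else 0
  | 14 => cut 1 fun _ => maxVal g
  | 15 => cut (m g) (bud g)
  | 16 => cut (m g + 1) fun k => 2 ^ k
  | 17 => cut (C + C * C + 1) fun k => base g ^ k
  | 18 => cut (m g) (weight (m g) (u g))
  | 19 => cut 1 fun _ => top (m g) (u g)
  | 20 => cut ((n g + 1) * (data C g).states) fun i =>
      (data C g).table (i / (data C g).states) (i % (data C g).states)
  | 21 => cut 1 fun _ => start C g
  | 22 => cut ((m g * m g + 2) * row g) fun i => rowVal C g (i / row g) (i % row g)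
  | 23 => cut (2 * m g) (outVal C g)
  | _ => fun _ => 0

section Arr

variable (C : ℕ) (g : ℕ → ℕ)

theorem arr_0 : arr C g 0 = g := rfl
theorem arr_1 : arr C g 1 = cut 1 fun _ => n g := rfl
theorem arr_2 : arr C g 2 = cut 1 fun _ => m g := rfl
theorem arr_3 : arr C g 3 = cut 1 fun _ => m g + 1 := rfl
theorem arr_4 : arr C g 4 = cut 1 fun _ => (data C g).states := rfl
theorem arr_5 : arr C g 5 = cut 1 fun _ => (n g + 1) * (data C g).states := rfl
theorem arr_6 : arr C g 6 = cut 1 fun _ => (m g * m g + 2) * row g := rfl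
theorem arr_7 : arr C g 7 = cut 1 fun _ => 2 * m g := rfl
theorem arr_8 : arr C g 8 = cut 1 fun _ => base g := rfl
theorem arr_9 : arr C g 9 = cut 1 fun _ => C := rfl
theorem arr_10 : arr C g 10 = cut 1 fun _ => C + C * C + 1 := rfl
theorem arr_11 : arr C g 11 = cut (m g + 1) fun i => ∏ k ∈ Finset.range i, den g k := rfl
theorem arr_12 : arr C g 12 = cut (m g) (u g) := rfl
theorem arr_13 : arr C g 13 = cut (m g) fun k => if blocked g k = 0 then u g k else 0 := rfl
theorem arr_14 : arr C g 14 = cut 1 fun _ => maxVal g := rfl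
theorem arr_15 : arr C g 15 = cut (m g) (bud g) := rfl
theorem arr_16 : arr C g 16 = cut (m g + 1) fun k => 2 ^ k := rfl
theorem arr_17 : arr C g 17 = cut (C + C * C + 1) fun k => base g ^ k := rfl
theorem arr_18 : arr C g 18 = cut (m g) (weight (m g) (u g)) := rfl
theorem arr_19 : arr C g 19 = cut 1 fun _ => top (m g) (u g) := rfl
theorem arr_20 : arr C g 20 = cut ((n g + 1) * (data C g).states) fun i =>
  (data C g).table (i / (data C g).states) (i % (data C g).states) := rfl
theorem arr_21 : arr C g 21 = cut 1 fun _ => start C g := rfl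
theorem arr_22 : arr C g 22 = cut ((m g * m g + 2) * row g) fun i =>
  rowVal C g (i / row g) (i % row g) := rfl
theorem arr_23 : arr C g 23 = cut (2 * m g) (outVal C g) := rfl

end Arr

theorem parArr_0 : parArr 0 = 1 := rfl
theorem parArr_1 : parArr 1 = 2 := rfl
theorem parArr_3 : parArr 3 = 4 := rfl
theorem parArr_8 : parArr 8 = 9 := rfl

/-- Read the entry `0` of an array. -/
def val (a : Fin 30) : Term := .get a (.lit 0)

/-- The entry number. -/
def idx : Term := .var 0

/-- The capacity of an edge. -/
def capT (e : Term) : Term := .get 0 (.lit 4 + e)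

/-- The first edge of an agent. -/
def loT (k : Term) : Term := .get 0 (.lit 4 + val 1 + .lit 4 * k)

/-- The last edge of an agent. -/
def hiT (k : Term) : Term := .get 0 (.lit 4 + val 1 + .lit 4 * k + .lit 1)

/-- The numerator of a valuation. -/
def numT (k : Term) : Term := .get 0 (.lit 4 + val 1 + .lit 4 * k + .lit 2)

/-- The denominator of a valuation. -/
def denT (k : Term) : Term := .get 0 (.lit 4 + val 1 + .lit 4 * k + .lit 3)

/-- The scaling factor. -/
def scaleT : Term := .lit 2 * (val 2 * val 2) * .get 0 (.lit 1)

/-- The base of the digits. -/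
def baseT : Term := scaleT / .get 0 (.lit 0) + val 2 + .lit 2

/-- A power with a fixed exponent. -/
def powT (a : Term) : ℕ → Term
  | 0 => .lit 1
  | k + 1 => powT a k * a

/-- The length of the rows of the array `22`. -/
def rowT : Term := val 2 * (val 1 + .lit 1) + .lit 1

/-- The definitions of the parameters. -/
def paramSteps (C : ℕ) : List Step :=
  [⟨1, none, .get 0 (.lit 2)⟩,
   ⟨2, none, .get 0 (.lit 3)⟩,
   ⟨3, none, val 2 + .lit 1⟩,
   ⟨4, none, powT baseT (C + C * C)⟩,
   ⟨5, none, (val 1 + .lit 1) * val 4⟩,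
   ⟨6, none, (val 2 * val 2 + .lit 2) * rowT⟩,
   ⟨7, none, .lit 2 * val 2⟩,
   ⟨8, none, baseT⟩,
   ⟨9, none, .lit C⟩,
   ⟨10, none, .lit (C + C * C + 1)⟩]

/-- The definitions of the valuations, the budgets and the tables of powers. -/
def dataSteps : List Step :=
  [⟨11, some 2, .ite (.eq idx (.lit 0)) (.lit 1)
      (.get 11 (idx - .lit 1) * denT (idx - .lit 1))⟩,
   ⟨12, some 1, numT idx * (.get 11 (val 2) / denT idx)⟩,
   ⟨13, some 1, .ite (.not (.sum 0 1
      (.ite (.le (loT idx) (.var 1) * (.le (.var 1) (hiT idx) * .not (capT (.var 1))))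
        (.lit 1) (.lit 0)))) (.get 12 idx) (.lit 0)⟩,
   ⟨14, none, .max 1 1 (.get 13 (.var 1))⟩,
   ⟨15, some 1, .get 12 idx * scaleT / (.get 0 (.lit 0) * val 14) + .lit 1⟩,
   ⟨16, some 2, .ite (.eq idx (.lit 0)) (.lit 1) (.get 16 (idx - .lit 1) * .lit 2)⟩,
   ⟨17, some 9, .ite (.eq idx (.lit 0)) (.lit 1) (.get 17 (idx - .lit 1) * val 8)⟩,
   ⟨18, some 1, .get 12 idx * .get 16 (val 2) + .get 16 idx⟩,
   ⟨19, none, .sum 1 1 (.get 18 (.var 1)) + .lit 1⟩]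

/-- The store `σ` contains the final contents of the arrays before `j`. -/
def Sees (C : ℕ) (g : ℕ → ℕ) (j : Fin 30) (σ : Store) : Prop :=
  ∀ a k, a < j → σ a k = arr C g a k

section EvalLemmas

variable {C : ℕ} {g : ℕ → ℕ} {j : Fin 30} {σ : Store} (h : Sees C g j σ) (η : ℕ → ℕ)
include h

theorem Sees.eval_val {a : Fin 30} (ha : a < j) : (val a).eval σ η = arr C g a 0 := h a 0 ha

theorem Sees.eval_inp (hj : 0 < j) (e : Term) : (Term.get 0 e).eval σ η = g (e.eval σ η) := by
  rw [eval_get, h _ _ hj, arr_0]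

theorem Sees.eval_capT (hj : 0 < j) (e : Term) :
    (capT e).eval σ η = cap g (e.eval σ η) := by
  rw [capT, h.eval_inp η hj, eval_add', eval_lit']

theorem Sees.eval_loT (hj : 1 < j) (e : Term) : (loT e).eval σ η = lo g (e.eval σ η) := by
  rw [loT, h.eval_inp η (lt_trans (by decide) hj), eval_add', eval_add', eval_mul',
    h.eval_val η hj, arr_1, cut_one_zero, eval_lit']

theorem Sees.eval_hiT (hj : 1 < j) (e : Term) : (hiT e).eval σ η = hi g (e.eval σ η) := by
  rw [hiT, h.eval_inp η (lt_trans (by decide) hj), eval_add', eval_add', eval_add', eval_mul',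
    h.eval_val η hj, arr_1, cut_one_zero, eval_lit', eval_lit']

theorem Sees.eval_numT (hj : 1 < j) (e : Term) : (numT e).eval σ η = num g (e.eval σ η) := by
  rw [numT, h.eval_inp η (lt_trans (by decide) hj), eval_add', eval_add', eval_add', eval_mul',
    h.eval_val η hj, arr_1, cut_one_zero, eval_lit', eval_lit']

theorem Sees.eval_denT (hj : 1 < j) (e : Term) : (denT e).eval σ η = den g (e.eval σ η) := by
  rw [denT, h.eval_inp η (lt_trans (by decide) hj), eval_add', eval_add', eval_add', eval_mul',
    h.eval_val η hj, arr_1, cut_one_zero, eval_lit', eval_lit']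

theorem Sees.eval_scaleT (hj : 2 < j) : scaleT.eval σ η = scale g := by
  rw [scaleT, eval_mul', eval_mul', eval_mul', h.eval_val η hj,
    h.eval_inp η (lt_trans (by decide) hj), arr_2, cut_one_zero, eval_lit', eval_lit', scale]

theorem Sees.eval_baseT (hj : 2 < j) : baseT.eval σ η = base g := by
  rw [baseT, eval_add', eval_add', eval_div', h.eval_scaleT η hj, h.eval_val η hj,
    h.eval_inp η (lt_trans (by decide) hj), arr_2, cut_one_zero, eval_lit', eval_lit', base]

theorem Sees.eval_rowT (hj : 2 < j) : rowT.eval σ η = row g := by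
  rw [rowT, eval_add', eval_mul', eval_add', h.eval_val η hj,
    h.eval_val η (lt_trans (by decide) hj), arr_1, arr_2, cut_one_zero, cut_one_zero, eval_lit',
    row]

end EvalLemmas

theorem eval_powT (σ : Store) (η : ℕ → ℕ) (a : Term) (k : ℕ) :
    (powT a k).eval σ η = a.eval σ η ^ k := by
  induction k with
  | zero => rfl
  | succ k ih => rw [powT, eval_mul', ih, pow_succ]

theorem paramSteps_holds (C : ℕ) (g : ℕ → ℕ) : ∀ st ∈ paramSteps C, st.Holds (arr C g) := by
  simp only [paramSteps, List.forall_mem_cons, List.not_mem_nil, false_imp_iff, implies_true,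
    and_true]
  refine ⟨?_, ?_, ?_, ?_, ?_, ?_, ?_, ?_, ?_, ?_⟩
  · refine Step.holds_of (arr_1 C g) rfl fun i hi σ (h : Sees C g _ σ) _ => ?_
    exact h.eval_inp _ (by decide) _
  · refine Step.holds_of (arr_2 C g) rfl fun i hi σ (h : Sees C g _ σ) _ => ?_
    exact h.eval_inp _ (by decide) _
  · refine Step.holds_of (arr_3 C g) rfl fun i hi σ (h : Sees C g _ σ) _ => ?_
    rw [eval_add', h.eval_val _ (by decide), arr_2, cut_one_zero, eval_lit']
  · refine Step.holds_of (arr_4 C g) rfl fun i hi σ (h : Sees C g _ σ) _ => ?_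
    rw [eval_powT, h.eval_baseT _ (show (2 : Fin 30) < 4 by decide)]
    rfl
  · refine Step.holds_of (arr_5 C g) rfl fun i hi σ (h : Sees C g _ σ) _ => ?_
    rw [eval_mul', eval_add', h.eval_val _ (by decide), h.eval_val _ (by decide), arr_1, arr_4,
      cut_one_zero, cut_one_zero, eval_lit']
  · refine Step.holds_of (arr_6 C g) rfl fun i hi σ (h : Sees C g _ σ) _ => ?_
    rw [eval_mul', eval_add', eval_mul', h.eval_rowT _ (by decide), h.eval_val _ (by decide), arr_2,
      cut_one_zero, eval_lit']
  · refine Step.holds_of (arr_7 C g) rfl fun i hi σ (h : Sees C g _ σ) _ => ?_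
    rw [eval_mul', h.eval_val _ (by decide), arr_2, cut_one_zero, eval_lit']
  · refine Step.holds_of (arr_8 C g) rfl fun i hi σ (h : Sees C g _ σ) _ => ?_
    exact h.eval_baseT _ (by decide)
  · exact Step.holds_of (arr_9 C g) rfl fun i hi σ (h : Sees C g _ σ) _ => rfl
  · exact Step.holds_of (arr_10 C g) rfl fun i hi σ (h : Sees C g _ σ) _ => rfl

theorem dataSteps_holds (C : ℕ) (g : ℕ → ℕ) : ∀ st ∈ dataSteps, st.Holds (arr C g) := by
  simp only [dataSteps, List.forall_mem_cons, List.not_mem_nil, false_imp_iff, implies_true,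
    and_true]
  refine ⟨?_, ?_, ?_, ?_, ?_, ?_, ?_, ?_, ?_⟩
  · refine Step.holds_of (arr_11 C g) rfl fun i hi σ (h : Sees C g _ σ) hs => ?_
    rw [eval_ite, eval_mul', eval_get, h.eval_denT _ (by decide)]
    simp only [eval_eq, eval_sub', eval_lit', idx, eval_var, Function.update_self]
    split_ifs with h0
    · subst h0; simp
    · rw [hs _ (by omega), ← Finset.prod_range_succ, Nat.sub_add_cancel (by omega)]
  · refine Step.holds_of (arr_12 C g) rfl fun i hi σ (h : Sees C g _ σ) hs => ?_
    rw [eval_mul', h.eval_numT _ (by decide), eval_div', h.eval_denT _ (by decide), eval_get,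
      h _ _ (by decide), h.eval_val _ (by decide), arr_2, cut_one_zero, arr_11,
      cut_of_lt (Nat.lt_succ_self _), idx, eval_var, Function.update_self, u, denProd]
  · refine Step.holds_of (arr_13 C g) rfl fun i hi σ (h : Sees C g _ σ) hs => ?_
    rw [eval_ite, eval_get, h _ _ (by decide), arr_12, idx, eval_var, Function.update_self,
      cut_of_lt hi, eval_lit']
    refine if_congr ?_ rfl rfl
    rw [eval_not, eval_sum, h _ _ (by decide), parArr_0, arr_1, cut_one_zero, blocked]
    refine iff_of_eq (congrArg (· = 0) (Finset.sum_congr rfl fun e _ => ?_))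
    rw [eval_ite]
    simp only [eval_and, eval_le, eval_not, h.eval_loT _ (show (1 : Fin 30) < 13 by decide),
      h.eval_hiT _ (show (1 : Fin 30) < 13 by decide),
      h.eval_capT _ (show (0 : Fin 30) < 13 by decide), eval_var, eval_lit',
      Function.update_self, ne_eq, not_false_eq_true, Function.update_of_ne,
      zero_ne_one]
  · refine Step.holds_of (arr_14 C g) rfl fun i hi σ (h : Sees C g _ σ) hs => ?_
    rw [eval_max, h _ _ (by decide), parArr_1, arr_2, cut_one_zero, maxVal]
    refine Finset.sup_congr rfl fun k hk => ?_
    rw [eval_get, h _ _ (by decide), eval_var, Function.update_self, arr_13,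
      cut_of_lt (Finset.mem_range.1 hk)]
  · refine Step.holds_of (arr_15 C g) rfl fun i hi σ (h : Sees C g _ σ) hs => ?_
    rw [eval_add', eval_div', eval_mul', eval_mul', h.eval_scaleT _ (by decide),
      h.eval_inp _ (by decide), h.eval_val _ (by decide), arr_14, cut_one_zero, eval_lit',
      eval_get, h _ _ (by decide), arr_12, idx, eval_var, Function.update_self, cut_of_lt hi, bud,
      eval_lit']
  · refine Step.holds_of (arr_16 C g) rfl fun i hi σ (h : Sees C g _ σ) hs => ?_
    rw [eval_ite, eval_mul', eval_get]
    simp only [eval_eq, eval_sub', eval_lit', idx, eval_var, Function.update_self]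
    split_ifs with h0
    · subst h0; simp
    · rw [hs _ (by omega), ← pow_succ, Nat.sub_add_cancel (by omega)]
  · refine Step.holds_of (arr_17 C g) rfl fun i hi σ (h : Sees C g _ σ) hs => ?_
    rw [eval_ite, eval_mul', eval_get, h.eval_val _ (by decide), arr_8, cut_one_zero]
    simp only [eval_eq, eval_sub', eval_lit', idx, eval_var, Function.update_self]
    split_ifs with h0
    · subst h0; simp
    · rw [hs _ (by omega), ← pow_succ, Nat.sub_add_cancel (by omega)]
  · refine Step.holds_of (arr_18 C g) rfl fun i hi σ (h : Sees C g _ σ) hs => ?_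
    rw [eval_add', eval_mul', eval_get, eval_get, eval_get, h _ _ (by decide), h _ _ (by decide),
      h _ _ (by decide), h.eval_val _ (by decide), arr_2, cut_one_zero, arr_12, arr_16, idx,
      eval_var, Function.update_self, cut_of_lt hi, cut_of_lt (Nat.lt_succ_self _),
      cut_of_lt (Nat.lt_succ_of_lt hi), weight]
  · refine Step.holds_of (arr_19 C g) rfl fun i hi σ (h : Sees C g _ σ) hs => ?_
    rw [eval_add', eval_sum, h _ _ (by decide), parArr_1, arr_2, cut_one_zero, top, eval_lit']
    refine congrArg (· + 1) (Finset.sum_congr rfl fun k hk => ?_)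
    rw [eval_get, h _ _ (by decide), eval_var, Function.update_self, arr_18,
      cut_of_lt (Finset.mem_range.1 hk)]

end Algo

/-! ### The array definitions of the dynamic program -/

namespace Algo

open Tab Sweep Cover Mask

/-- A number that is positive if and only if `a < b`. -/
def ltT (a b : Term) : Term := .le (a + .lit 1) b

theorem eval_ltT (σ : Store) (η : ℕ → ℕ) (a b : Term) :
    (ltT a b).eval σ η ≠ 0 ↔ a.eval σ η < b.eval σ η := by
  rw [ltT, eval_le, eval_add', eval_lit', Nat.succ_le_iff]

/-- A digit in base `base g`. -/
def digT (s k : Term) : Term := .mod (s / .get 17 k) (val 8)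

/-- The content of a slot. -/
def slotT (s a : Term) : Term := digT s a

/-- The amount recorded for two slots. -/
def partT (s a b : Term) : Term := digT s (val 9 + val 9 * a + b)

/-- The amount recorded before a transition for two slots. -/
def oldT (s s' a b : Term) : Term :=
  .ite (.eq (slotT s' a) (slotT s a) * .eq (slotT s' b) (slotT s b)) (partT s a b) (.lit 0)

/-- The condition `Sweep.Data.SlotStep`. -/
def slotStepT (e s s' a : Term) : Term :=
  .eq (slotT s' a) (slotT s a) * (.not (slotT s a) + .le e (hiT (slotT s a - .lit 1))) +
    (.not (slotT s a) + ltT (hiT (slotT s a - .lit 1)) e) *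
      (.not (slotT s' a) + .le (slotT s' a) (val 2) * .eq (loT (slotT s' a - .lit 1)) e)

/-- The amount by which the slot `a` grows. -/
def growT (s s' a : Term) : Term := partT s' a a - oldT s s' a a

/-- The condition `Sweep.Data.PartStep`. -/
def partStepT (s s' a b : Term) : Term :=
  .eq (partT s' a b) (oldT s s' a b + growT s s' a) *
    (.le (oldT s s' a a) (partT s' a a) * .le (partT s' a b) (.get 15 (slotT s' b - .lit 1)))

/-- The condition `Sweep.Data.Valid`. -/
def validT (e s s' : Term) : Term :=
  .all 8 4 (slotStepT e s s' (.var 4)) *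
    (.all 8 4 (.all 8 5 (.eq (.var 4) (.var 5) +
      (.not (.eq (slotT s' (.var 4)) (slotT s' (.var 5))) + .not (slotT s' (.var 4))))) *
    (.le (.sum 8 4 (.ite (slotT s' (.var 4)) (.lit 1) (.lit 0))) (capT e) *
    .all 8 4 (.all 8 5 (.not (slotT s' (.var 4)) + (.not (slotT s' (.var 5)) +
      partStepT s s' (.var 4) (.var 5))))))

/-- The total amount added in a transition. -/
def gainT (s s' : Term) : Term :=
  .sum 8 4 (.ite (slotT s' (.var 4)) (growT s s' (.var 4)) (.lit 0))

/-- The binary number of the agents that begin in a transition. -/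
def newMaskT (s s' : Term) : Term :=
  .sum 8 4 (.ite (.not (slotT s' (.var 4)) + .eq (slotT s' (.var 4)) (slotT s (.var 4))) (.lit 0)
    (.get 16 (slotT s' (.var 4) - .lit 1)))

/-- The entry of the table for a row and a state. -/
def entryT (e s : Term) : Term := .get 20 (e * val 4 + s)

/-- An entry of the table of the dynamic program, from its row and its state. -/
def tableT (e s' : Term) : Term :=
  .ite e
    (.max 3 3 (.ite
      (entryT (e - .lit 1) (.var 3) * validT (e - .lit 1) (.var 3) s')
      (entryT (e - .lit 1) (.var 3) + .get 16 (val 2) * gainT (.var 3) s' + newMaskT (.var 3) s')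
      (.lit 0)))
    (.ite s' (.lit 0) (.get 16 (val 2)))

/-- The definition of the table of the dynamic program. -/
def tableStep : Step := ⟨20, some 4, tableT (idx / val 4) (.mod idx (val 4))⟩

/-- The definition of the set of winners found by the dynamic program. -/
def startStep : Step := ⟨21, none, .mod (.max 3 3 (entryT (val 1) (.var 3))) (.get 16 (val 2))⟩

/-- The slots of a state that can be reached contain only agents of the instance. -/
theorem slot_le {C : ℕ} {g : ℕ → ℕ} {ev sv sv' av : ℕ} (hg : Ok C g) (h0 : (data C g).table ev sv ≠ 0)
    (hv : ∀ a < C, (data C g).SlotStep ev sv sv' a) (hav : av < C) :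
    (data C g).slot sv' av ≤ m g := by
  obtain ⟨W, w, hr, -⟩ := Data.table_sound (D := data C g) (fun i hi => (hg.lo_hi i hi).1) ev sv h0
  rcases hv av hav with h1 | h1
  · rw [h1.1]
    by_contra hc
    have := Finset.mem_range.1 (hr.subset (hr.mem av hav (by omega)).1)
    change _ < m g at this
    omega
  · rcases h1.2 with h2 | h2
    · omega
    · exact h2.1

section EvalLemmas

variable {C : ℕ} {g : ℕ → ℕ} {σ : Store} (h : Sees C g 20 σ) {η : ℕ → ℕ}
  {e s s' a b : Term} {ev sv sv' av bv : ℕ}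
include h

theorem eval_digT (hs : s.eval σ η = sv) (ha : a.eval σ η = av) (hav : av < C + C * C + 1) :
    (digT s a).eval σ η = dig (base g) sv av := by
  rw [digT, eval_mod, eval_div', eval_get, h _ _ (by decide), h.eval_val _ (by decide), hs, ha,
    arr_17, arr_8, cut_one_zero, cut_of_lt hav, dig]

theorem eval_slotT (hs : s.eval σ η = sv) (ha : a.eval σ η = av) (hav : av < C) :
    (slotT s a).eval σ η = (data C g).slot sv av :=
  eval_digT h hs ha (by omega)

theorem eval_partT (hs : s.eval σ η = sv) (ha : a.eval σ η = av) (hav : av < C)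
    (hb : b.eval σ η = bv) (hbv : bv < C) :
    (partT s a b).eval σ η = (data C g).part sv av bv := by
  refine eval_digT h hs ?_ ?_
  · rw [eval_add', eval_add', eval_mul', h.eval_val _ (by decide), ha, hb, arr_9, cut_one_zero]
    rfl
  · change C + C * av + bv < _
    nlinarith

theorem eval_oldT (hs : s.eval σ η = sv) (hs' : s'.eval σ η = sv') (ha : a.eval σ η = av)
    (hav : av < C) (hb : b.eval σ η = bv) (hbv : bv < C) :
    (oldT s s' a b).eval σ η = (data C g).old sv sv' av bv := by
  rw [oldT, eval_ite, eval_partT h hs ha hav hb hbv]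
  refine if_congr ?_ rfl rfl
  rw [eval_and, eval_eq, eval_eq, eval_slotT h hs' ha hav, eval_slotT h hs ha hav,
    eval_slotT h hs' hb hbv, eval_slotT h hs hb hbv]

theorem eval_growT (hs : s.eval σ η = sv) (hs' : s'.eval σ η = sv') (ha : a.eval σ η = av)
    (hav : av < C) : (growT s s' a).eval σ η =
      (data C g).part sv' av av - (data C g).old sv sv' av av := by
  rw [growT, eval_sub', eval_partT h hs' ha hav ha hav, eval_oldT h hs hs' ha hav ha hav]

theorem eval_slotStepT (he : e.eval σ η = ev) (hs : s.eval σ η = sv) (hs' : s'.eval σ η = sv')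
    (ha : a.eval σ η = av) (hav : av < C) :
    (slotStepT e s s' a).eval σ η ≠ 0 ↔ (data C g).SlotStep ev sv sv' av := by
  rw [slotStepT, eval_or, eval_and, eval_or, eval_eq, eval_not, eval_le, eval_and, eval_or,
    eval_or, eval_and, eval_ltT, eval_not, eval_not, eval_le, eval_eq, h.eval_hiT _ (by decide),
    h.eval_loT _ (by decide), h.eval_val _ (by decide), arr_2, cut_one_zero, eval_sub', eval_sub',
    eval_slotT h hs ha hav, eval_slotT h hs' ha hav, he, eval_lit']
  rfl

theorem eval_partStepT (hs : s.eval σ η = sv) (hs' : s'.eval σ η = sv')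
    (ha : a.eval σ η = av) (hav : av < C) (hb : b.eval σ η = bv) (hbv : bv < C)
    (hm : (data C g).slot sv' bv - 1 < m g) :
    (partStepT s s' a b).eval σ η ≠ 0 ↔ (data C g).PartStep sv sv' av bv := by
  rw [partStepT, eval_and, eval_and, eval_eq, eval_le, eval_le, eval_add',
    eval_growT h hs hs' ha hav, eval_oldT h hs hs' ha hav ha hav, eval_oldT h hs hs' ha hav hb hbv,
    eval_partT h hs' ha hav ha hav, eval_partT h hs' ha hav hb hbv, eval_get, h _ _ (by decide),
    eval_sub', eval_slotT h hs' hb hbv, arr_15, eval_lit', cut_of_lt hm]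
  rfl

variable (hs : ∀ x y, s.eval σ (Function.update (Function.update η 4 x) 5 y) = sv)
  (hs' : ∀ x y, s'.eval σ (Function.update (Function.update η 4 x) 5 y) = sv')
  (he1 : ∀ x, e.eval σ (Function.update η 4 x) = ev)
  (hs1 : ∀ x, s.eval σ (Function.update η 4 x) = sv)
  (hs1' : ∀ x, s'.eval σ (Function.update η 4 x) = sv')

include hs1 hs1' in
theorem eval_gainT : (gainT s s').eval σ η = (data C g).gain sv sv' := by
  rw [gainT, eval_sum, h _ _ (by decide), parArr_8, arr_9, cut_one_zero]
  refine Finset.sum_congr rfl fun a ha => ?_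
  have ha' := Finset.mem_range.1 ha
  rw [eval_ite, eval_growT h (av := a) (hs1 a) (hs1' a) rfl ha', eval_slotT h (av := a) (hs1' a) rfl ha', ite_not]
  rfl

include hs1 hs1' in
theorem eval_newMaskT (hm : ∀ a < C, (data C g).slot sv' a ≤ m g) :
    (newMaskT s s').eval σ η = (data C g).newMask sv sv' := by
  rw [newMaskT, eval_sum, h _ _ (by decide), parArr_8, arr_9, cut_one_zero]
  refine Finset.sum_congr rfl fun a ha => ?_
  have ha' := Finset.mem_range.1 ha
  have hav : (Term.var 4).eval σ (Function.update η 4 a) = a := rfl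
  rw [eval_ite, eval_get, eval_sub', h _ _ (by decide), eval_slotT h (hs1' a) hav ha', arr_16,
    eval_lit', eval_lit', cut_of_lt (by have := hm a ha'; omega)]
  refine if_congr ?_ rfl rfl
  rw [eval_or, eval_not, eval_eq, eval_slotT h (hs1' a) hav ha', eval_slotT h (hs1 a) hav ha']

include hs hs' he1 hs1 hs1' in
theorem eval_validT (hg : Ok C g) (he0 : e.eval σ η = ev) (h0 : (data C g).table ev sv ≠ 0) :
    (validT e s s').eval σ η ≠ 0 ↔ (data C g).Valid ev sv sv' := by
  have hC : σ (parArr 8) 0 = C := by rw [h _ _ (by decide), parArr_8, arr_9, cut_one_zero]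
  have key : (validT e s s').eval σ η ≠ 0 ↔ (∀ a < C, (data C g).SlotStep ev sv sv' a) ∧
      (∀ a < C, ∀ b < C, a = b ∨ (data C g).slot sv' a ≠ (data C g).slot sv' b ∨
        (data C g).slot sv' a = 0) ∧
      (∑ a ∈ Finset.range C, (if (data C g).slot sv' a = 0 then 0 else 1) ≤ cap g ev) ∧
      ∀ a < C, ∀ b < C, (data C g).slot sv' a = 0 ∨ (data C g).slot sv' b = 0 ∨
        (partStepT s s' (.var 4) (.var 5)).eval σ
          (Function.update (Function.update η 4 a) 5 b) ≠ 0 := by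
    rw [validT, eval_and, eval_and, eval_and, eval_all, eval_all, eval_all, eval_le, hC,
      h.eval_capT _ (by decide), he0, eval_sum, hC]
    refine and_congr (forall₂_congr fun a ha => ?_) (and_congr (forall₂_congr fun a ha => ?_)
      (and_congr (iff_of_eq (congrArg (· ≤ _) (Finset.sum_congr rfl fun a ha => ?_)))
        (forall₂_congr fun a ha => ?_)))
    · exact eval_slotStepT h (he1 a) (hs1 a) (hs1' a) rfl ha
    · rw [eval_all, hC]
      refine forall₂_congr fun b hb => ?_
      rw [eval_or, eval_or, eval_eq, eval_not, eval_not, eval_slotT h (av := a) (hs' a b) rfl ha]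
      have h1 := eval_eq σ (Function.update (Function.update η 4 a) 5 b) (slotT s' (.var 4))
        (slotT s' (.var 5))
      rw [eval_slotT h (av := a) (hs' a b) rfl ha,
        eval_slotT h (av := b) (hs' a b) rfl hb] at h1
      refine or_congr Iff.rfl (or_congr ?_ Iff.rfl)
      rw [← not_ne_iff, h1]
    · have ha' := Finset.mem_range.1 ha
      rw [eval_ite, eval_slotT h (av := a) (hs1' a) rfl ha', ite_not]
      rfl
    · rw [eval_all, hC]
      refine forall₂_congr fun b hb => ?_
      rw [eval_or, eval_or, eval_not, eval_not, eval_slotT h (av := a) (hs' a b) rfl ha,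
        eval_slotT h (av := b) (hs' a b) rfl hb]
  have part (hsl : ∀ a < C, (data C g).SlotStep ev sv sv' a) {a b : ℕ} (ha : a < C) (hb : b < C)
      (hb0 : (data C g).slot sv' b ≠ 0) : (partStepT s s' (.var 4) (.var 5)).eval σ
          (Function.update (Function.update η 4 a) 5 b) ≠ 0 ↔ (data C g).PartStep sv sv' a b :=
    eval_partStepT h (hs a b) (hs' a b) rfl ha rfl hb (by
      have := slot_le hg h0 hsl hb
      omega)
  rw [key]
  constructor
  · rintro ⟨h1, h2, h3, h4⟩
    refine ⟨h1, h2, h3, fun a ha b hb => ?_⟩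
    by_cases hb0 : (data C g).slot sv' b = 0
    · exact Or.inr (Or.inl hb0)
    · rw [← part h1 ha hb hb0]
      exact h4 a ha b hb
  · rintro ⟨h1, h2, h3, h4⟩
    refine ⟨h1, h2, h3, fun a ha b hb => ?_⟩
    by_cases hb0 : (data C g).slot sv' b = 0
    · exact Or.inr (Or.inl hb0)
    · rw [part h1 ha hb hb0]
      exact h4 a ha b hb

end EvalLemmas

theorem states_pos (C : ℕ) (g : ℕ → ℕ) : 0 < (data C g).states :=
  pow_pos (Nat.lt_of_lt_of_le (Nat.succ_pos _) (Nat.le_add_left 2 (scale g / g 0 + m g))) _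

theorem tableStep_holds {C : ℕ} {g : ℕ → ℕ} (hg : Ok C g) : tableStep.Holds (arr C g) := by
  refine Step.holds_of (arr_20 C g) rfl fun i hi σ (h : Sees C g 20 σ) hs => ?_
  set η : ℕ → ℕ := Function.update (fun _ => 0) 0 i with hη
  set S := (data C g).states with hS
  have hSp : 0 < S := states_pos C g
  have hv4 : ∀ η', (val 4).eval σ η' = S := fun η' => by
    rw [h.eval_val _ (by decide), arr_4, cut_one_zero]
  have hpm : ∀ η', (Term.get 16 (val 2)).eval σ η' = 2 ^ m g := fun η' => by
    rw [eval_get, h.eval_val _ (by decide), arr_2, cut_one_zero, h _ _ (by decide), arr_16,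
      cut_of_lt (Nat.lt_succ_self _)]
  have hidx : ∀ η' : ℕ → ℕ, η' 0 = i → (idx / val 4).eval σ η' = i / S ∧
      (Term.mod idx (val 4)).eval σ η' = i % S := fun η' h0 => by
    rw [eval_div', eval_mod, hv4, idx, eval_var, h0]
    exact ⟨rfl, rfl⟩
  change (tableT (idx / val 4) (.mod idx (val 4))).eval σ η = _
  rw [tableT, eval_ite, (hidx η rfl).1]
  rcases Nat.eq_zero_or_pos (i / S) with h0 | h0
  · rw [if_neg (by omega), eval_ite, (hidx η rfl).2, hpm, h0, Data.table, ite_not]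
    rfl
  obtain ⟨e, hes⟩ : ∃ e, i / S = e + 1 := ⟨i / S - 1, by omega⟩
  rw [if_pos (by omega), eval_max, h _ _ (by decide), parArr_3, arr_4, cut_one_zero, ← hS, hes,
    Data.table]
  refine Finset.sup_congr rfl fun s hsr => ?_
  have hss := Finset.mem_range.1 hsr
  set η' := Function.update η 3 s with hη'
  have hE : ∀ ζ : ℕ → ℕ, ζ 0 = i → (idx / val 4 - .lit 1).eval σ ζ = e := fun ζ hζ => by
    rw [eval_sub', (hidx ζ hζ).1, hes, eval_lit', Nat.add_sub_cancel]
  have hent : (entryT (idx / val 4 - .lit 1) (.var 3)).eval σ η' = (data C g).table e s := by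
    have hlt : e * S + s < i := by
      have h1 : (e + 1) * S ≤ i := by rw [← hes]; exact Nat.div_mul_le_self i S
      nlinarith
    rw [entryT, eval_get, eval_add', eval_mul', hv4, hE η' rfl]
    have := hs (e * S + s) hlt
    rw [mul_comm e S, Nat.mul_add_div hSp, Nat.mul_add_mod, Nat.div_eq_of_lt hss,
      Nat.mod_eq_of_lt hss, add_zero, mul_comm S e] at this
    exact this
  have hvalid (h0 : (data C g).table e s ≠ 0) := eval_validT (η := η') h
    (e := idx / val 4 - .lit 1) (s := .var 3) (s' := .mod idx (val 4)) (ev := e) (sv := s)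
    (sv' := i % S)
    (fun x y => rfl) (fun x y => (hidx _ rfl).2) (fun x => hE _ rfl)
    (fun x => rfl) (fun x => (hidx _ rfl).2) hg (hE _ rfl) h0
  rw [eval_ite]
  classical
  refine (if_congr ((eval_and _ _ _ _).trans (by rw [hent])) rfl rfl).trans ?_
  by_cases h1 : (data C g).table e s ≠ 0
  swap
  · rw [if_neg (fun hc => h1 hc.1), if_neg (fun hc => h1 hc.1), eval_lit']
  refine (if_congr (and_congr_right fun _ => hvalid h1) rfl rfl).trans ?_
  by_cases h2 : (data C g).Valid e s (i % S)
  swap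
  · rw [if_neg (fun hc => h2 hc.2), if_neg (fun hc => h2 hc.2), eval_lit']
  rw [if_pos ⟨h1, h2⟩, if_pos ⟨h1, h2⟩, eval_add', eval_add', eval_mul', hpm, hent,
    eval_gainT h (fun x => rfl) (fun x => (hidx _ rfl).2),
    eval_newMaskT h (fun x => rfl) (fun x => (hidx _ rfl).2)
      fun a ha => slot_le hg h1 h2.slots ha]
  rfl

theorem startStep_holds (C : ℕ) (g : ℕ → ℕ) : startStep.Holds (arr C g) := by
  refine Step.holds_of (arr_21 C g) rfl fun i hi σ (h : Sees C g 21 σ) _ => ?_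
  change (Term.mod (.max 3 3 (entryT (val 1) (.var 3))) (.get 16 (val 2))).eval σ _ = _
  rw [eval_mod, eval_get, h.eval_val _ (by decide), arr_2, cut_one_zero, h _ _ (by decide), arr_16,
    cut_of_lt (Nat.lt_succ_self _), eval_max, h _ _ (by decide), parArr_3, arr_4, cut_one_zero,
    start, Data.best]
  refine congrArg (· % 2 ^ m g) (Finset.sup_congr rfl fun s hs => ?_)
  have hss := Finset.mem_range.1 hs
  have hSp := states_pos C g
  rw [entryT, eval_get, eval_add', eval_mul', h.eval_val _ (by decide), h.eval_val _ (by decide),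
    arr_4, arr_1, cut_one_zero, cut_one_zero, h _ _ (by decide), arr_20, eval_var,
    Function.update_self, cut_of_lt (by nlinarith), mul_comm, Nat.mul_add_div hSp, Nat.mul_add_mod,
    Nat.div_eq_of_lt hss, Nat.mod_eq_of_lt hss, add_zero]
  rfl

end Algo

/-! ### The array definitions of the exchanges and of the output -/

namespace Algo

open Tab Sweep Cover Mask

/-- A binary digit. -/
def bitT (q k : Term) : Term := .mod (q / .get 16 k) (.lit 2)

/-- The value of `slack` for the agent `j` and the edge `y`, from the row that starts at `B`. -/
def slackT (B j y : Term) : Term := .get 22 (B + (.lit 1 + (j * (val 1 + .lit 1) + y)))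

/-- The value of `coverValue`. -/
def coverT (B j : Term) : Term := val 19 - slackT B j (hiT j + .lit 1)

/-- The value of `candidate`. -/
def candidateT (B : Term) : Term :=
  .max 1 1 (.ite (.not (bitT (.get 22 B) (.var 1)) * (slackT B (.var 1) (hiT (.var 1) + .lit 1) *
      ltT (coverT B (.var 1) / .get 16 (val 2)) (.get 12 (.var 1))))
    (.get 22 B + .get 16 (.var 1) - .mod (coverT B (.var 1)) (.get 16 (val 2)) + .lit 1) (.lit 0))

/-- The value of `next`. -/
def nextT (B : Term) : Term :=
  .ite (.not (candidateT B)) (.get 22 B) (candidateT B - .lit 1)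

/-- One step of the recursion for `slack`. -/
def slackStepT (B j y : Term) : Term :=
  .ite (.le y (loT j)) (val 19)
    (.max 1 1 (.ite (bitT (.get 22 B) (.var 1) * (ltT (loT (.var 1)) y *
        .le y (hiT (.var 1) + .lit 1)))
      (slackT B j (loT (.var 1)) - .get 18 (.var 1)) (.lit 0)))

/-- The entry `r` of the row `t` of the array `22`. -/
def rowEntryT (t r : Term) : Term :=
  .ite r
    (slackStepT (t * rowT) ((r - .lit 1) / (val 1 + .lit 1)) (.mod (r - .lit 1) (val 1 + .lit 1)))
    (.ite t (nextT ((t - .lit 1) * rowT)) (val 21))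

/-- The definition of the array `22`. -/
def roundStep : Step := ⟨22, some 5, rowEntryT (idx / rowT) (.mod idx rowT)⟩

/-- The first entry of the last row of the array `22`. -/
def lastT : Term := (val 2 * val 2 + .lit 1) * rowT

/-- The definition of the output. -/
def outStep : Step := ⟨23, some 6, .ite (bitT (.get 22 lastT) (idx / .lit 2))
  (.ite (.mod idx (.lit 2)) (.get 11 (val 2)) (coverT lastT (idx / .lit 2) / .get 16 (val 2)))
  (.lit 0)⟩

theorem row_pos (g : ℕ → ℕ) : 0 < row g := Nat.succ_pos _

theorem entry_lt_row {g : ℕ → ℕ} {j y : ℕ} (hj : j < m g) (hy : y ≤ n g) :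
    1 + (j * (n g + 1) + y) < row g := by
  unfold row
  nlinarith

theorem rowVal_zero (C : ℕ) (g : ℕ → ℕ) (t : ℕ) : rowVal C g t 0 = winners C g t := if_pos rfl

theorem rowVal_entry (C : ℕ) {g : ℕ → ℕ} (t j : ℕ) {y : ℕ} (hy : y ≤ n g) :
    rowVal C g t (1 + (j * (n g + 1) + y)) =
      slack (m g) (lo g) (hi g) (u g) (winners C g t) (lo g j) y := by
  rw [rowVal, if_neg (by omega), Nat.add_sub_cancel_left, mul_comm,
    Nat.mul_add_div (Nat.succ_pos _), Nat.mul_add_mod, Nat.div_eq_of_lt (by omega),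
    Nat.mod_eq_of_lt (by omega), add_zero]

theorem eval_winners {C : ℕ} {g : ℕ → ℕ} {σ : Store} {η : ℕ → ℕ} {B : Term} {t : ℕ}
    (hrow : ∀ r < row g, σ 22 (t * row g + r) = rowVal C g t r) (hB : B.eval σ η = t * row g) :
    (Term.get 22 B).eval σ η = winners C g t := by
  have := hrow 0 (row_pos g)
  rwa [add_zero, rowVal_zero, ← hB] at this

section EvalLemmas

variable {C : ℕ} {g : ℕ → ℕ} {σ : Store} (h : Sees C g 22 σ)
  {η : ℕ → ℕ} {q k B J Y : Term} {qv kv bv jv yv : ℕ}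
include h

theorem eval_bitT (hq : q.eval σ η = qv) (hk : k.eval σ η = kv) (hkv : kv < m g) :
    (bitT q k).eval σ η = qv / 2 ^ kv % 2 := by
  rw [bitT, eval_mod, eval_div', eval_get, hq, hk, h _ _ (by decide), arr_16,
    cut_of_lt (by omega), eval_lit']

theorem eval_slackT (hB : B.eval σ η = bv) (hJ : J.eval σ η = jv) (hY : Y.eval σ η = yv) :
    (slackT B J Y).eval σ η = σ 22 (bv + (1 + (jv * (n g + 1) + yv))) := by
  rw [slackT, eval_get, eval_add', eval_add', eval_add', eval_mul', eval_add', hB, hJ, hY,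
    eval_lit', h.eval_val _ (by decide), arr_1, cut_one_zero]

theorem eval_pow_m : (Term.get 16 (val 2)).eval σ η = 2 ^ m g := by
  rw [eval_get, h.eval_val _ (by decide), arr_2, cut_one_zero, h _ _ (by decide), arr_16,
      cut_of_lt (Nat.lt_succ_self _)]

variable (hg : Ok C g) {t : ℕ} (hrow : ∀ r < row g, σ 22 (t * row g + r) = rowVal C g t r)
include hg hrow

theorem eval_slackT_hi (hB : B.eval σ η = t * row g) (hJ : J.eval σ η = jv) (hjv : jv < m g) :
    (slackT B J (hiT J + .lit 1)).eval σ η =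
      slack (m g) (lo g) (hi g) (u g) (winners C g t) (lo g jv) (hi g jv + 1) := by
  have hh := (hg.lo_hi jv hjv).2
  have hY : (hiT J + .lit 1).eval σ η = hi g jv + 1 := by
    rw [eval_add', h.eval_hiT _ (by decide), hJ, eval_lit']
  rw [eval_slackT h hB hJ hY, hrow _ (entry_lt_row hjv (by omega)), rowVal_entry C t jv (by omega)]

theorem eval_coverT (hB : B.eval σ η = t * row g) (hJ : J.eval σ η = jv) (hjv : jv < m g) :
    (coverT B J).eval σ η = coverValue (m g) (lo g) (hi g) (u g) (winners C g t) jv := by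
  rw [coverT, eval_sub', eval_slackT_hi h hg hrow hB hJ hjv, h.eval_val _ (by decide), arr_19,
    cut_one_zero, coverValue]

theorem eval_candidateT (hB : ∀ x, B.eval σ (Function.update η 1 x) = t * row g) :
    (candidateT B).eval σ η = candidate (m g) (lo g) (hi g) (u g) (winners C g t) := by
  rw [candidateT, eval_max, h _ _ (by decide), parArr_1, arr_2, cut_one_zero, candidate]
  refine Finset.sup_congr rfl fun k hk => ?_
  have hk' := Finset.mem_range.1 hk
  have hv : (Term.var 1).eval σ (Function.update η 1 k) = k := rfl
  have hw := eval_winners hrow (hB k)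
  have hc := eval_coverT h hg hrow (hB k) hv hk'
  rw [eval_ite, eval_add', eval_sub', eval_add', eval_mod, hw, hc, eval_pow_m h, eval_get,
    h _ _ (by decide), arr_16, hv, cut_of_lt (by omega), eval_lit', eval_lit']
  refine if_congr ?_ rfl rfl
  rw [eval_and, eval_and, eval_not, eval_ltT, eval_bitT h hw hv hk', eval_div', hc, eval_pow_m h,
    eval_slackT_hi h hg hrow (hB k) hv hk', eval_get, h _ _ (by decide), arr_12, hv, cut_of_lt hk',
    Envies]

theorem eval_nextT (hB0 : B.eval σ η = t * row g)
    (hB : ∀ x, B.eval σ (Function.update η 1 x) = t * row g) :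
    (nextT B).eval σ η = winners C g (t + 1) := by
  rw [nextT, eval_ite, eval_sub', eval_winners hrow hB0, eval_candidateT h hg hrow hB,
    eval_lit', show winners C g (t + 1) = next (m g) (lo g) (hi g) (u g) (winners C g t) from
      Function.iterate_succ_apply' _ _ _, next]
  refine if_congr ?_ rfl rfl
  rw [eval_not, eval_candidateT h hg hrow hB]

end EvalLemmas

theorem roundStep_holds {C : ℕ} {g : ℕ → ℕ} (hg : Ok C g) : roundStep.Holds (arr C g) := by
  refine Step.holds_of (arr_22 C g) rfl fun i hi σ (h : Sees C g 22 σ) hs => ?_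
  set η : ℕ → ℕ := Function.update (fun _ => 0) 0 i with hη
  change ∀ k < i, σ 22 k = _ at hs
  have hR := row_pos g
  have hs' : ∀ t r, r < row g → t * row g + r < i → σ 22 (t * row g + r) = rowVal C g t r := by
    intro t r hr hlt
    rw [hs _ hlt, mul_comm, Nat.mul_add_div hR, Nat.mul_add_mod, Nat.div_eq_of_lt hr,
      Nat.mod_eq_of_lt hr, add_zero]
  have hidx : ∀ η' : ℕ → ℕ, η' 0 = i → (idx / rowT).eval σ η' = i / row g ∧
      (Term.mod idx rowT).eval σ η' = i % row g := fun η' h0 => by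
    rw [eval_div', eval_mod, h.eval_rowT _ (by decide), idx, eval_var, h0]
    exact ⟨rfl, rfl⟩
  have hn : ∀ η' : ℕ → ℕ, (val 1 + .lit 1).eval σ η' = n g + 1 := fun η' => by
    rw [eval_add', h.eval_val _ (by decide), arr_1, cut_one_zero, eval_lit']
  change (rowEntryT (idx / rowT) (.mod idx rowT)).eval σ η = _
  have hdm := Nat.div_add_mod i (row g)
  have hml := Nat.mod_lt i hR
  rw [mul_comm] at hdm
  set t := i / row g with ht
  set r := i % row g with hr
  rw [rowEntryT, eval_ite, (hidx η rfl).2]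
  rcases Nat.eq_zero_or_pos r with hr0 | hr0
  · rw [if_neg (by omega), hr0, rowVal_zero, eval_ite, (hidx η rfl).1]
    rcases Nat.eq_zero_or_pos t with ht0 | ht0
    · rw [if_neg (by omega), ht0, h.eval_val _ (by decide), arr_21, cut_one_zero, winners,
        Function.iterate_zero_apply]
    · obtain ⟨t', ht'⟩ : ∃ t', t = t' + 1 := ⟨t - 1, by omega⟩
      have hB : ∀ η' : ℕ → ℕ, η' 0 = i →
          ((idx / rowT - .lit 1) * rowT).eval σ η' = t' * row g := fun η' h0 => by
        rw [eval_mul', eval_sub', (hidx η' h0).1, h.eval_rowT _ (by decide), eval_lit', ht',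
          Nat.add_sub_cancel]
      rw [if_pos (by omega), eval_nextT h hg (t := t') ?_ (hB _ rfl) (fun x => hB _ rfl), ht']
      intro r' hr'
      refine hs' t' r' hr' ?_
      rw [ht', add_mul] at hdm
      omega
  · rw [if_pos (by omega)]
    have hB : ∀ η' : ℕ → ℕ, η' 0 = i → ((idx / rowT) * rowT).eval σ η' = t * row g :=
      fun η' h0 => by rw [eval_mul', (hidx η' h0).1, h.eval_rowT _ (by decide)]
    have hJ : ∀ η' : ℕ → ℕ, η' 0 = i → ((Term.mod idx rowT - .lit 1) / (val 1 + .lit 1)).eval σ η' =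
        (r - 1) / (n g + 1) := fun η' h0 => by
      rw [eval_div', eval_sub', (hidx η' h0).2, hn, eval_lit']
    have hY : ∀ η' : ℕ → ℕ, η' 0 = i →
        (Term.mod (Term.mod idx rowT - .lit 1) (val 1 + .lit 1)).eval σ η' =
        (r - 1) % (n g + 1) := fun η' h0 => by
      rw [eval_mod, eval_sub', (hidx η' h0).2, hn, eval_lit']
    have hJY := Nat.div_add_mod (r - 1) (n g + 1)
    rw [mul_comm] at hJY
    have hYn := Nat.mod_lt (r - 1) (Nat.succ_pos (n g))
    rw [rowVal, if_neg (by omega)]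
    set J := (r - 1) / (n g + 1) with hJd
    set Y := (r - 1) % (n g + 1) with hYd
    have hw : ∀ η' : ℕ → ℕ, η' 0 = i →
        (Term.get 22 ((idx / rowT) * rowT)).eval σ η' = winners C g t := fun η' h0 => by
      rw [eval_get, hB η' h0]
      have := hs' t 0 hR (by omega)
      rwa [add_zero, rowVal_zero] at this
    rw [slackStepT, eval_ite, h.eval_val _ (by decide), arr_19, cut_one_zero, slack]
    refine if_congr ?_ rfl ?_
    · rw [eval_le, hY η rfl, h.eval_loT _ (by decide), hJ η rfl]
    rw [eval_max, h _ _ (by decide), parArr_1, arr_2, cut_one_zero]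
    refine Finset.sup_congr rfl fun k hk => ?_
    have hk' := Finset.mem_range.1 hk
    set η' := Function.update η 1 k with hη'
    have hv : (Term.var 1).eval σ η' = k := rfl
    rw [eval_ite]
    have hc : (bitT (.get 22 ((idx / rowT) * rowT)) (.var 1) *
        (ltT (loT (.var 1)) (.mod (.mod idx rowT - .lit 1) (val 1 + .lit 1)) *
        .le (.mod (.mod idx rowT - .lit 1) (val 1 + .lit 1)) (hiT (.var 1) + .lit 1))).eval σ η' ≠ 0
        ↔ winners C g t / 2 ^ k % 2 ≠ 0 ∧ lo g k < Y ∧ Y ≤ Algo.hi g k + 1 := by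
      rw [eval_and, eval_and, eval_bitT h (hw η' rfl) hv hk', eval_ltT, eval_le, hY η' rfl,
        eval_add', h.eval_loT _ (by decide), h.eval_hiT _ (by decide), hv, eval_lit']
    by_cases hcond : winners C g t / 2 ^ k % 2 ≠ 0 ∧ lo g k < Y ∧ Y ≤ Algo.hi g k + 1
    swap
    · rw [if_neg (fun hh => hcond (hc.1 hh)), dif_neg hcond, eval_lit']
    have hlo' : (loT (.var 1)).eval σ η' = lo g k := by rw [h.eval_loT _ (by decide), hv]
    rw [if_pos (hc.2 hcond), dif_pos hcond, eval_sub',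
      eval_slackT h (hB η' rfl) (hJ η' rfl) hlo', hs' t _ (by omega) (by omega),
      rowVal_entry C t J (by omega), eval_get, h _ _ (by decide), arr_18, hv, cut_of_lt hk']

theorem outStep_holds {C : ℕ} {g : ℕ → ℕ} (hg : Ok C g) : outStep.Holds (arr C g) := by
  refine Step.holds_of (arr_23 C g) rfl fun i hi σ (h' : Sees C g 23 σ) _ => ?_
  have h : Sees C g 22 σ := fun a k ha => h' a k (lt_trans ha (by decide))
  set η : ℕ → ℕ := Function.update (fun _ => 0) 0 i with hη
  have hrow : ∀ r < row g, σ 22 ((m g * m g + 1) * row g + r) = rowVal C g (m g * m g + 1) r := by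
    intro r hr
    rw [h' _ _ (by decide), arr_22, cut_of_lt (by nlinarith), mul_comm,
      Nat.mul_add_div (row_pos g), Nat.mul_add_mod, Nat.div_eq_of_lt hr, Nat.mod_eq_of_lt hr,
      add_zero]
  have hB : lastT.eval σ η = (m g * m g + 1) * row g := by
    rw [lastT, eval_mul', eval_add', eval_mul', h.eval_val _ (by decide), h.eval_rowT _ (by decide),
      arr_2, cut_one_zero, eval_lit']
  have hk : (idx / .lit 2).eval σ η = i / 2 := rfl
  have hk' : i / 2 < m g := by omega
  change (Term.ite (bitT (.get 22 lastT) (idx / .lit 2)) (.ite (.mod idx (.lit 2))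
    (.get 11 (val 2)) (coverT lastT (idx / .lit 2) / .get 16 (val 2))) (.lit 0)).eval σ η = _
  rw [eval_ite, eval_bitT h (eval_winners hrow hB) hk hk', eval_ite, eval_mod, eval_div',
    eval_coverT h hg hrow hB hk hk', eval_pow_m h, eval_get, h.eval_val _ (by decide), arr_2,
    cut_one_zero, h _ _ (by decide), arr_11, cut_of_lt (Nat.lt_succ_self _), outVal]
  simp only [ne_eq, ite_not]
  rfl

/-- The algorithm as a sequence of array definitions. -/
def steps (C : ℕ) : List Step :=
  paramSteps C ++ dataSteps ++ [tableStep, startStep, roundStep, outStep]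

/-- The arrays computed by the algorithm satisfy the steps of the program. -/
theorem steps_holds {C : ℕ} {g : ℕ → ℕ} (hg : Ok C g) : ∀ st ∈ steps C, st.Holds (arr C g) := by
  intro st hst
  rw [steps, List.mem_append, List.mem_append] at hst
  rcases hst with (h | h) | h
  · exact paramSteps_holds C g st h
  · exact dataSteps_holds C g st h
  · simp only [List.mem_cons, List.not_mem_nil, or_false] at h
    rcases h with rfl | rfl | rfl | rfl
    · exact tableStep_holds hg
    · exact startStep_holds C g
    · exact roundStep_holds hg
    · exact outStep_holds hg

theorem steps_tgt (C : ℕ) (k : ℕ) (h : k < (steps C).length) : ((steps C)[k].tgt : ℕ) = 1 + k := by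
  have hl : (steps C).length = 23 := rfl
  rw [hl] at h
  interval_cases k <;> rfl

end Algo

/-! ### Bounds on the numbers that occur -/

namespace Algo

open Tab Sweep Cover Mask

/-- The numbers in the input have at most `s` binary digits, and `s` bounds the number of edges, the
number of agents and the inverse of the accuracy. -/
structure Small (g : ℕ → ℕ) (s : ℕ) : Prop where
  entry_le : ∀ k, g k ≤ 2 ^ s
  n_le : n g ≤ s
  m_le : m g ≤ s
  inv_le : g 1 ≤ s * g 0

/-- A bound on the number of binary digits of all array entries. -/
def bitBound (C s : ℕ) : ℕ := (s + 2) ^ 4 * (4 * (C + C * C) + 9)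

/-- A bound on all parameters. -/
def parBound (C s : ℕ) : ℕ := (s + 2) ^ (4 * (C + C * C) + 4)

theorem size_le_of_le_two_pow {x a b : ℕ} (h : x ≤ 2 ^ a) (hab : a < b) : x.size ≤ b :=
  Nat.size_le.2 (h.trans_lt (Nat.pow_lt_pow_right one_lt_two hab))

theorem size_cut_le {N b : ℕ} {F : ℕ → ℕ} (k : ℕ) (h : ∀ i < N, (F i).size ≤ b) :
    (cut N F k).size ≤ b := by
  rw [cut]
  split_ifs with hk
  · exact h k hk
  · simp

theorem add_le_two_pow {x y a b : ℕ} (hx : x ≤ 2 ^ a) (hy : y ≤ 2 ^ b) : x + y ≤ 2 ^ (a + b + 1) := by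
  have h1 : 2 ^ a ≤ 2 ^ (a + b) := Nat.pow_le_pow_right two_pos (by omega)
  have h2 : 2 ^ b ≤ 2 ^ (a + b) := Nat.pow_le_pow_right two_pos (by omega)
  rw [pow_succ]
  omega

theorem mul_le_two_pow {x y a b : ℕ} (hx : x ≤ 2 ^ a) (hy : y ≤ 2 ^ b) : x * y ≤ 2 ^ (a + b) := by
  rw [pow_add]
  exact Nat.mul_le_mul hx hy

theorem sum_le_two_pow {N a b : ℕ} {f : ℕ → ℕ} (hN : N ≤ b) (h : ∀ i < N, f i ≤ 2 ^ a) :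
    ∑ i ∈ Finset.range N, f i ≤ 2 ^ (a + b) := by
  refine (Finset.sum_le_card_nsmul _ _ _ fun i hi => h i (Finset.mem_range.1 hi)).trans ?_
  rw [Finset.card_range, smul_eq_mul, mul_comm]
  exact mul_le_two_pow le_rfl (hN.trans Nat.lt_two_pow_self.le)

theorem slack_le_top (m : ℕ) (lo hi u : ℕ → ℕ) (q l y : ℕ) : slack m lo hi u q l y ≤ top m u := by
  induction y using Nat.strong_induction_on with
  | _ y ih =>
  rw [slack]
  split_ifs with hy
  · exact le_rfl
  · refine Finset.sup_le fun k _ => ?_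
    split_ifs with h
    · exact (Nat.sub_le _ _).trans (ih _ h.2.1)
    · exact Nat.zero_le _

theorem next_le (m : ℕ) (lo hi u : ℕ → ℕ) (q : ℕ) : next m lo hi u q ≤ q + 2 ^ m := by
  have : candidate m lo hi u q ≤ q + 2 ^ m + 1 := by
    refine Finset.sup_le fun j hj => ?_
    have : 2 ^ j ≤ 2 ^ m := Nat.pow_le_pow_right two_pos (Finset.mem_range.1 hj).le
    split_ifs
    · omega
    · exact Nat.zero_le _
  rw [next]
  split_ifs
  · exact Nat.le_add_right _ _
  · omega

theorem winners_le (C : ℕ) (g : ℕ → ℕ) (t : ℕ) : winners C g t ≤ (t + 1) * 2 ^ m g := by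
  induction t with
  | zero =>
    rw [zero_add, one_mul]
    exact (Nat.mod_lt _ (by positivity)).le
  | succ t ih =>
    have h := next_le (m g) (lo g) (hi g) (u g) (winners C g t)
    rw [winners, Function.iterate_succ_apply', ← winners]
    linarith

theorem table_le (D : Data) (hM : 0 < D.M) (e s : ℕ) :
    D.table e s ≤ 2 ^ D.m + e * (2 ^ D.m * (D.C * D.M) + D.C * 2 ^ D.M) := by
  induction e generalizing s with
  | zero =>
    rw [Data.table]
    split_ifs <;> simp
  | succ e ih =>
    have hd : ∀ s k, dig D.M s k ≤ D.M := fun s k => (Nat.mod_lt _ hM).le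
    rw [Data.table]
    refine Finset.sup_le fun s' _ => ?_
    split_ifs
    swap
    · exact Nat.zero_le _
    have h1 : D.gain s' s ≤ D.C * D.M := by
      refine (Finset.sum_le_card_nsmul _ _ D.M fun a _ => ?_).trans_eq (by
        rw [Finset.card_range, smul_eq_mul])
      split_ifs
      · exact Nat.zero_le _
      · exact (Nat.sub_le _ _).trans (hd _ _)
    have h2 : D.newMask s' s ≤ D.C * 2 ^ D.M := by
      refine (Finset.sum_le_card_nsmul _ _ (2 ^ D.M) fun a _ => ?_).trans_eq (by
        rw [Finset.card_range, smul_eq_mul])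
      split_ifs
      · exact Nat.zero_le _
      · exact Nat.pow_le_pow_right two_pos ((Nat.sub_le _ _).trans (hd _ _))
    have h3 := ih s'
    have h4 := Nat.mul_le_mul (le_refl (2 ^ D.m)) h1
    linarith

theorem parBound_size_le (C s : ℕ) : (parBound C s).size ≤ bitBound C s := by
  have h1 : s + 2 ≤ 2 ^ (s + 2) := Nat.lt_two_pow_self.le
  refine size_le_of_le_two_pow (a := (s + 2) * (4 * (C + C * C) + 4)) ?_ ?_
  · rw [pow_mul]
    exact Nat.pow_le_pow_left h1 _
  · unfold bitBound
    have h2 : s + 2 ≤ (s + 2) ^ 4 := Nat.le_self_pow (by omega) _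
    calc (s + 2) * (4 * (C + C * C) + 4) < (s + 2) * (4 * (C + C * C) + 9) :=
          Nat.mul_lt_mul_of_pos_left (by omega) (by omega)
      _ ≤ _ := Nat.mul_le_mul h2 le_rfl

section Bounds

variable {C : ℕ} {g : ℕ → ℕ} {s : ℕ} (h : Small g s)
include h

theorem base_le : base g ≤ (s + 2) ^ 4 := by
  have h1 : scale g / g 0 ≤ 2 * (m g * m g) * s := by
    refine Nat.div_le_of_le_mul ?_
    rw [scale]
    calc 2 * (m g * m g) * g 1 ≤ 2 * (m g * m g) * (s * g 0) := Nat.mul_le_mul le_rfl h.inv_le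
      _ = g 0 * (2 * (m g * m g) * s) := by ring
  have h2 : 2 * (m g * m g) * s ≤ 2 * (s * s) * s :=
    Nat.mul_le_mul (Nat.mul_le_mul le_rfl (Nat.mul_le_mul h.m_le h.m_le)) le_rfl
  have h3 := h.m_le
  have h4 : (s + 2) ^ 4 = s ^ 4 + 8 * s ^ 3 + 24 * s ^ 2 + 32 * s + 16 := by ring
  have h5 : 2 * (s * s) * s = 2 * s ^ 3 := by ring
  unfold base
  omega

theorem prod_den_le {i : ℕ} (hi : i ≤ m g) : ∏ k ∈ Finset.range i, den g k ≤ 2 ^ (s * s) := by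
  refine (Finset.prod_le_pow_card _ _ (2 ^ s) fun k _ => h.entry_le _).trans ?_
  rw [Finset.card_range, ← pow_mul]
  exact Nat.pow_le_pow_right two_pos (Nat.mul_le_mul le_rfl (hi.trans h.m_le))

theorem u_le (k : ℕ) : u g k ≤ 2 ^ (s + s * s) :=
  mul_le_two_pow (h.entry_le _) ((Nat.div_le_self _ _).trans (prod_den_le h le_rfl))

theorem weight_le {k : ℕ} (hk : k < m g) : weight (m g) (u g) k ≤ 2 ^ (s * s + 3 * s + 1) := by
  have h1 : 2 ^ m g ≤ 2 ^ s := Nat.pow_le_pow_right two_pos h.m_le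
  have h2 : 2 ^ k ≤ 2 ^ s := Nat.pow_le_pow_right two_pos (hk.le.trans h.m_le)
  refine (add_le_two_pow (mul_le_two_pow (u_le h k) h1) h2).trans (le_of_eq ?_)
  ring_nf

theorem top_le : top (m g) (u g) ≤ 2 ^ (s * s + 4 * s + 2) := by
  have h1 := sum_le_two_pow h.m_le fun k hk => weight_le h hk
  refine (add_le_two_pow h1 (show 1 ≤ 2 ^ 0 from le_rfl)).trans (le_of_eq ?_)
  ring_nf

theorem scale_le : scale g ≤ 2 ^ (3 * s + 1) := by
  have h1 : m g ≤ 2 ^ s := h.m_le.trans Nat.lt_two_pow_self.le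
  refine (mul_le_two_pow (mul_le_two_pow (show 2 ≤ 2 ^ 1 from le_rfl) (mul_le_two_pow h1 h1))
    (h.entry_le 1)).trans (le_of_eq ?_)
  ring_nf

theorem maxVal_le : maxVal g ≤ 2 ^ (s + s * s) := by
  refine Finset.sup_le fun k _ => ?_
  split_ifs
  · exact u_le h k
  · exact Nat.zero_le _

theorem bud_le (k : ℕ) : bud g k ≤ 2 ^ (s * s + 4 * s + 2) := by
  refine (add_le_two_pow ((Nat.div_le_self _ _).trans (mul_le_two_pow (u_le h k) (scale_le h)))
    (show 1 ≤ 2 ^ 0 from le_rfl)).trans (le_of_eq ?_)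
  ring_nf

theorem winners_le_two_pow {t : ℕ} (ht : t < m g * m g + 2) : winners C g t ≤ 2 ^ (3 * s + 2) := by
  have h1 : m g ≤ 2 ^ s := h.m_le.trans Nat.lt_two_pow_self.le
  refine (winners_le C g t).trans ((mul_le_two_pow ((show t + 1 ≤ m g * m g + 2 by omega).trans
    (add_le_two_pow (mul_le_two_pow h1 h1) (show 2 ≤ 2 ^ 1 from le_rfl)))
    (Nat.pow_le_pow_right two_pos h.m_le)).trans (le_of_eq ?_))
  ring_nf

theorem table_le_two_pow {e : ℕ} (he : e ≤ n g) (x : ℕ) :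
    (data C g).table e x ≤ 2 ^ (3 * (s + 2) ^ 4 + 2 * C + 4 * s + 2) := by
  have hM : 0 < (data C g).M := Nat.succ_pos _
  refine (table_le (data C g) hM e x).trans ?_
  have h1 : 2 ^ m g ≤ 2 ^ s := Nat.pow_le_pow_right two_pos h.m_le
  have h2 : e ≤ 2 ^ s := (he.trans h.n_le).trans Nat.lt_two_pow_self.le
  have h3 : C ≤ 2 ^ C := Nat.lt_two_pow_self.le
  have h4 : base g ≤ 2 ^ ((s + 2) ^ 4) := (base_le h).trans Nat.lt_two_pow_self.le
  have h5 : 2 ^ base g ≤ 2 ^ ((s + 2) ^ 4) := Nat.pow_le_pow_right two_pos (base_le h)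
  refine (add_le_two_pow h1 (mul_le_two_pow h2 (add_le_two_pow (mul_le_two_pow h1
    (mul_le_two_pow h3 h4)) (mul_le_two_pow h3 h5)))).trans
      (Nat.pow_le_pow_right two_pos ?_)
  omega

theorem states_le : (data C g).states ≤ (s + 2) ^ (4 * (C + C * C)) := by
  rw [pow_mul]
  exact Nat.pow_le_pow_left (base_le h) _

theorem row_le : (m g * m g + 2) * row g ≤ (s + 2) ^ 4 := by
  have h1 := h.n_le
  have h2 := h.m_le
  have h3 : m g * m g ≤ s * s := Nat.mul_le_mul h2 h2
  have h4 : m g * (n g + 1) ≤ s * (s + 1) := Nat.mul_le_mul h2 (by omega)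
  calc (m g * m g + 2) * row g ≤ (s * s + 2) * (s * (s + 1) + 1) :=
        Nat.mul_le_mul (by omega) (by unfold row; omega)
    _ ≤ (s + 2) ^ 2 * (s + 2) ^ 2 := Nat.mul_le_mul (by nlinarith) (by nlinarith)
    _ = _ := by ring

theorem par_le (p : Fin 10) : arr C g (parArr p) 0 ≤ parBound C s := by
  have hn := h.n_le
  have hm := h.m_le
  have hst := states_le (C := C) h
  have hr := row_le h
  have hb := base_le h
  have h1 : ∀ k ≤ 4 * (C + C * C) + 4, (s + 2) ^ k ≤ parBound C s := fun k hk =>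
    Nat.pow_le_pow_right (by omega) hk
  have h2 := h1 1 (by omega)
  have h4 := h1 4 (by omega)
  have h5 := h1 (4 * (C + C * C) + 1) (by omega)
  have h7 : (s + 2) ^ 4 = s ^ 4 + 8 * s ^ 3 + 24 * s ^ 2 + 32 * s + 16 := by ring
  have h8 : C + C * C + 1 ≤ parBound C s := by
    have h9 : C + C * C + 1 < 2 ^ (C + C * C + 1) := Nat.lt_two_pow_self
    have h10 : 2 ^ (C + C * C + 1) ≤ (s + 2) ^ (C + C * C + 1) :=
      Nat.pow_le_pow_left (by omega) _
    have := h1 (C + C * C + 1) (by omega)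
    omega
  obtain ⟨p, hp⟩ := p
  interval_cases p
  · exact show n g ≤ _ by omega
  · exact show m g ≤ _ by omega
  · exact show m g + 1 ≤ _ by omega
  · exact hst.trans (h1 _ (by omega))
  · refine le_trans ?_ h5
    change (n g + 1) * (data C g).states ≤ _
    rw [pow_succ, mul_comm]
    exact Nat.mul_le_mul hst (by omega)
  · exact hr.trans h4
  · exact show 2 * m g ≤ _ by omega
  · exact hb.trans h4
  · exact show C ≤ _ by omega
  · exact h8

/-- All entries have at most `bitBound C s` bits, and all parameters are at most `parBound C s`. -/
theorem arr_bounded (C : ℕ) : Store.Bounded (bitBound C s) (parBound C s) (arr C g) := by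
  have hpar (p : Fin 10) (k : ℕ) (F : ℕ → ℕ) (hF : arr C g (parArr p) = cut 1 F) :
      (cut 1 F k).size ≤ bitBound C s := by
    refine size_cut_le k fun i hi => ?_
    have h1 := par_le (C := C) h p
    rw [hF, cut_one_zero] at h1
    rw [Nat.lt_one_iff.1 hi]
    exact (Nat.size_le_size h1).trans (parBound_size_le C s)
  have hX : (s + 2) ^ 4 = s ^ 4 + 8 * s ^ 3 + 24 * s ^ 2 + 32 * s + 16 := by ring
  have hs2 : s ^ 2 = s * s := by ring
  have hb : 9 * (s + 2) ^ 4 + 4 * C + 4 * (C * C) ≤ bitBound C s := by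
    unfold bitBound
    have : 1 ≤ (s + 2) ^ 4 := Nat.one_le_pow _ _ (by omega)
    nlinarith
  have hbig : ∀ {x a : ℕ}, x ≤ 2 ^ a → a ≤ s * s + 4 * s + 2 → x.size ≤ bitBound C s :=
    fun hx ha => size_le_of_le_two_pow hx (by omega)
  refine ⟨fun a k => ?_, fun p => par_le h p⟩
  obtain ⟨a, ha⟩ := a
  interval_cases a
  · exact hbig (h.entry_le k) (by omega)
  · exact hpar 0 k _ rfl
  · exact hpar 1 k _ rfl
  · exact hpar 2 k _ rfl
  · exact hpar 3 k _ rfl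
  · exact hpar 4 k _ rfl
  · exact hpar 5 k _ rfl
  · exact hpar 6 k _ rfl
  · exact hpar 7 k _ rfl
  · exact hpar 8 k _ rfl
  · exact hpar 9 k _ rfl
  · change (arr C g 11 k).size ≤ _
    rw [arr_11]
    exact size_cut_le k fun i hi => hbig (prod_den_le h (by omega)) (by omega)
  · change (arr C g 12 k).size ≤ _
    rw [arr_12]
    exact size_cut_le k fun i _ => hbig (u_le h i) (by omega)
  · change (arr C g 13 k).size ≤ _
    rw [arr_13]
    refine size_cut_le k fun i _ => ?_
    split_ifs
    · exact hbig (u_le h i) (by omega)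
    · simp
  · change (arr C g 14 k).size ≤ _
    rw [arr_14]
    exact size_cut_le k fun i _ => hbig (maxVal_le h) (by omega)
  · change (arr C g 15 k).size ≤ _
    rw [arr_15]
    exact size_cut_le k fun i _ => hbig (bud_le h i) (by omega)
  · change (arr C g 16 k).size ≤ _
    rw [arr_16]
    refine size_cut_le k fun i hi => hbig (le_refl (2 ^ i)) ?_
    have := h.m_le
    omega
  · change (arr C g 17 k).size ≤ _
    rw [arr_17]
    refine size_cut_le k fun i hi => ?_
    refine (Nat.size_le_size ?_).trans (parBound_size_le C s)
    calc base g ^ i ≤ ((s + 2) ^ 4) ^ i := Nat.pow_le_pow_left (base_le h) i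
      _ = (s + 2) ^ (4 * i) := (pow_mul _ _ _).symm
      _ ≤ _ := Nat.pow_le_pow_right (by omega) (by omega)
  · change (arr C g 18 k).size ≤ _
    rw [arr_18]
    exact size_cut_le k fun i hi => hbig (weight_le h hi) (by omega)
  · change (arr C g 19 k).size ≤ _
    rw [arr_19]
    exact size_cut_le k fun i _ => hbig (top_le h) (by omega)
  · change (arr C g 20 k).size ≤ _
    rw [arr_20]
    refine size_cut_le k fun i hi => size_le_of_le_two_pow (table_le_two_pow h ?_ _) (by omega)
    exact Nat.lt_succ_iff.1 (Nat.div_lt_of_lt_mul (hi.trans_eq (mul_comm _ _)))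
  · change (arr C g 21 k).size ≤ _
    rw [arr_21]
    exact size_cut_le k fun i _ =>
      size_le_of_le_two_pow (winners_le_two_pow (t := 0) h (by omega)) (by omega)
  · change (arr C g 22 k).size ≤ _
    rw [arr_22]
    refine size_cut_le k fun i hi => ?_
    rw [rowVal]
    split_ifs
    · refine size_le_of_le_two_pow (winners_le_two_pow h ?_) (by omega)
      exact Nat.div_lt_of_lt_mul (hi.trans_eq (mul_comm _ _))
    · exact hbig ((slack_le_top _ _ _ _ _ _ _).trans (top_le h)) (by omega)
  · change (arr C g 23 k).size ≤ _
    rw [arr_23]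
    refine size_cut_le k fun i _ => ?_
    rw [outVal]
    split_ifs
    · exact hbig (((Nat.div_le_self _ _).trans (Nat.sub_le _ _)).trans (top_le h)) (by omega)
    · exact hbig (prod_den_le h le_rfl) (by omega)
    · simp
  all_goals exact Nat.zero_le _

end Bounds

end Algo

/-! ### The input word -/

namespace Highway

open Algo

theorem length_flatten_ofFn {m d : ℕ} (f : Fin m → List ℕ) (hf : ∀ i, (f i).length = d) :
    (List.ofFn f).flatten.length = d * m := by
  induction m with
  | zero => simp
  | succ m ih =>
    rw [List.ofFn_succ, List.flatten_cons, List.length_append, hf, ih _ fun i => hf _]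
    ring

theorem getD_flatten_ofFn {m d : ℕ} (f : Fin m → List ℕ) (hf : ∀ i, (f i).length = d) (i : Fin m)
    {r : ℕ} (hr : r < d) : (List.ofFn f).flatten.getD (d * i + r) 0 = (f i).getD r 0 := by
  induction m with
  | zero => exact i.elim0
  | succ m ih =>
    rw [List.ofFn_succ, List.flatten_cons]
    rcases Fin.eq_zero_or_eq_succ i with rfl | ⟨j, rfl⟩
    · rw [Fin.val_zero, mul_zero, zero_add, List.getD_append _ _ _ _ (by rwa [hf])]
    · rw [List.getD_append_right _ _ _ _ (by rw [hf, Fin.val_succ, mul_add]; omega), hf,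
        ← ih (fun i => f i.succ) (fun i => hf _) j]
      congr 1
      rw [Fin.val_succ, mul_add]
      omega

variable (I : Highway) (ε : ℚ≥0)

/-- The input word, continued by zeros. -/
def word (k : ℕ) : ℕ := (I.encode ε).getD k 0

theorem length_encode : (I.encode ε).length = 4 + I.n + 4 * I.m := by
  rw [encode, List.length_append, List.length_append, List.length_ofFn,
    length_flatten_ofFn (d := 4) _ fun _ => rfl]
  rfl

theorem word_zero : I.word ε 0 = ε.num := rfl

theorem word_one : I.word ε 1 = ε.den := rfl

theorem n_word : Algo.n (I.word ε) = I.n := rfl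

theorem m_word : Algo.m (I.word ε) = I.m := rfl

theorem cap_word (e : Fin I.n) : Algo.cap (I.word ε) e = I.cap e := by
  have he := e.2
  rw [Algo.cap, word, encode, List.getD_append _ _ _ _ (by simp; omega),
    List.getD_append_right _ _ _ _ (by simp), List.getD_eq_getElem _ _ (by simp)]
  simp

theorem word_agent (i : Fin I.m) {r : ℕ} (hr : r < 4) : I.word ε (4 + I.n + 4 * i + r) =
    [(I.lo i : ℕ), (I.hi i : ℕ), (I.val i).num, (I.val i).den].getD r 0 := by
  rw [word, encode, List.getD_append_right _ _ _ _ (by simp; omega)]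
  rw [← getD_flatten_ofFn (fun i : Fin I.m =>
      [(I.lo i : ℕ), (I.hi i : ℕ), (I.val i).num, (I.val i).den]) (fun _ => rfl) i hr]
  congr 1
  simp
  omega

theorem lo_word (i : Fin I.m) : Algo.lo (I.word ε) i = I.lo i := I.word_agent ε i (r := 0) (by omega)

theorem hi_word (i : Fin I.m) : Algo.hi (I.word ε) i = I.hi i := I.word_agent ε i (r := 1) (by omega)

theorem num_word (i : Fin I.m) : num (I.word ε) i = (I.val i).num :=
  I.word_agent ε i (r := 2) (by omega)

theorem den_word (i : Fin I.m) : den (I.word ε) i = (I.val i).den :=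
  I.word_agent ε i (r := 3) (by omega)

variable {I ε}

theorem ok_word {C : ℕ} (hε : 0 < ε) (hC : ∀ e, I.cap e ≤ C) : Ok C (I.word ε) where
  eps_num := NNRat.num_pos.2 hε
  eps_den := ε.den_pos
  lo_hi k hk := by
    have h1 : Algo.lo (I.word ε) k = _ := I.lo_word ε ⟨k, hk⟩
    have h2 : Algo.hi (I.word ε) k = _ := I.hi_word ε ⟨k, hk⟩
    rw [h1, h2]
    exact ⟨I.lo_le_hi ⟨k, hk⟩, (I.hi ⟨k, hk⟩).2⟩
  cap_le e he := (I.cap_word ε ⟨e, he⟩).trans_le (hC _)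
  den_pos k hk := (I.den_word ε ⟨k, hk⟩).symm ▸ (I.val ⟨k, hk⟩).den_pos

theorem length_le_inputSize : (I.encode ε).length ≤ I.inputSize ε := by
  rw [inputSize, ← List.length_map (fun x : ℕ => x.size + 1)]
  exact List.length_le_sum_of_one_le _ fun x hx => by
    obtain ⟨y, -, rfl⟩ := List.mem_map.1 hx
    omega

theorem word_le (k : ℕ) : I.word ε k ≤ 2 ^ I.inputSize ε := by
  rw [word]
  by_cases hk : k < (I.encode ε).length
  · rw [List.getD_eq_getElem _ _ hk]
    refine (Nat.lt_size_self _).le.trans (Nat.pow_le_pow_right two_pos ?_)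
    have : ((I.encode ε)[k]).size + 1 ≤ I.inputSize ε :=
      List.single_le_sum (fun _ _ => Nat.zero_le _) _
        (List.mem_map.2 ⟨_, List.getElem_mem hk, rfl⟩)
    omega
  · rw [List.getD_eq_default _ _ (by omega)]
    exact Nat.zero_le _

theorem small_word (hε : 0 < ε) :
    Small (I.word ε) (I.inputSize ε + ⌈(1 / ε : ℚ≥0)⌉₊) where
  entry_le k := (word_le k).trans (Nat.pow_le_pow_right two_pos (Nat.le_add_right _ _))
  n_le := by
    have h1 := length_le_inputSize (I := I) (ε := ε)
    rw [length_encode] at h1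
    rw [n_word]
    omega
  m_le := by
    have h1 := length_le_inputSize (I := I) (ε := ε)
    rw [length_encode] at h1
    rw [m_word]
    omega
  inv_le := by
    rw [word_zero, word_one]
    have h1 : (1 / ε : ℚ≥0) ≤ ⌈(1 / ε : ℚ≥0)⌉₊ := Nat.le_ceil _
    rw [div_le_iff₀ hε] at h1
    have h2 : (0 : ℚ≥0) < ε.den := by exact_mod_cast ε.den_pos
    have h3 : (ε.den : ℚ≥0) ≤ ⌈(1 / ε : ℚ≥0)⌉₊ * ε.num := by
      have h4 := mul_le_mul_of_nonneg_right h1 h2.le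
      rwa [one_mul, mul_assoc, NNRat.mul_den_eq_num] at h4
    have h5 : ε.den ≤ ⌈(1 / ε : ℚ≥0)⌉₊ * ε.num := by exact_mod_cast h3
    exact h5.trans (Nat.mul_le_mul (Nat.le_add_left _ _) le_rfl)

end Highway

/-! ### Monotone pricings and envy-freeness -/

namespace Auction

theorem IsMonotonePricing.mono {E : Type*} [DecidableEq E] {p : Finset E → ℝ}
    (hp : IsMonotonePricing p) {S T : Finset E} (h : S ⊆ T) :
    p S ≤ p T := by
  simpa using hp S {T} (by simpa using h)

theorem le_maxUtility {E : Type*} [Fintype E] (v p : Finset E → ℝ) (S : Finset E) :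
    v S - p S ≤ maxUtility v p :=
  Finset.le_sup' (fun S => v S - p S) (Finset.mem_univ S)

variable {E : Type*} [Fintype E] [DecidableEq E] {p : Finset E → ℝ}

theorem IsMonotonePricing.nonneg [Nonempty E] (hp : IsMonotonePricing p) (T : Finset E) :
    0 ≤ p T := by
  obtain ⟨S, hS⟩ : ∃ S : Finset E, S ≠ T := by
    by_cases hT : T = ∅
    · exact ⟨Finset.univ, by rw [hT]; exact Finset.univ_nonempty.ne_empty⟩
    · exact ⟨∅, Ne.symm hT⟩
  -- `S` is covered by the two different sets `S` and `T`
  have := hp S {S, T} (by simp)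
  rw [Finset.sum_pair hS] at this
  linarith

theorem IsMonotonePricing.empty [Nonempty E] (hp : IsMonotonePricing p) : p ∅ = 0 :=
  le_antisymm (by simpa using hp ∅ ∅ (by simp)) (hp.nonneg ∅)

theorem IsMonotonePricing.union [Nonempty E] (hp : IsMonotonePricing p) (S T : Finset E) :
    p (S ∪ T) ≤ p S + p T := by
  have h := hp (S ∪ T) {S, T} (by simp)
  by_cases hST : S = T
  · subst hST
    rw [Finset.union_self]
    linarith [hp.nonneg S]
  · rwa [Finset.sum_pair hST] at h

/-- A winner is charged at most the difference of the values of its set and of any other set plus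
the price of the other set. -/
theorem IsEnvyFree.sub_le {ι E : Type*} [Fintype E] {v : ι → Finset E → ℝ} {a : ι → Finset E}
    {p : Finset E → ℝ} (h : IsEnvyFree v a p) {i : ι} (hi : a i ≠ ∅) (S : Finset E) :
    v i S - p S ≤ v i (a i) - p (a i) ∧ 0 ≤ v i (a i) - p (a i) := by
  have h1 := le_maxUtility (v i) p S
  rcases lt_trichotomy (maxUtility (v i) p) 0 with h0 | h0 | h0
  · exact (hi (h.of_neg i h0)).elim
  · have h2 : v i (a i) - p (a i) = _ := (h.of_zero i h0).resolve_right hi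
    rw [h2]
    exact ⟨h1, h0.ge⟩
  · have h2 : v i (a i) - p (a i) = _ := h.of_pos i h0
    rw [h2]
    exact ⟨h1, h0.le⟩

end Auction

namespace Highway

open Auction Cover Sweep Mask Algo

variable {I : Highway} {ε : ℚ≥0}

theorem bundle_ne_empty (i : Fin I.m) : I.bundle i ≠ ∅ :=
  (Finset.nonempty_Icc.2 (I.lo_le_hi i)).ne_empty

theorem map_bundle (i : Fin I.m) : (I.bundle i).map Fin.valEmbedding =
    seg (Algo.lo (I.word ε)) (Algo.hi (I.word ε)) i := by
  rw [bundle, Fin.map_valEmbedding_Icc, seg, lo_word, hi_word]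

theorem u_word {C : ℕ} (h : Ok C (I.word ε)) (i : Fin I.m) :
    (u (I.word ε) i : ℝ) = ((I.val i : ℚ) : ℝ) * denProd (I.word ε) := by
  rw [u_eq h (show (i : ℕ) < Algo.m (I.word ε) from i.2), num_word, den_word]
  congr 1
  have : (I.val i : ℚ) = (I.val i).num / (I.val i).den := by
    conv_lhs => rw [← NNRat.num_div_den (I.val i)]
    push_cast
    rfl
  rw [this]
  push_cast
  rfl

theorem eps_word : (I.word ε 0 : ℝ) / I.word ε 1 = ((ε : ℚ) : ℝ) := by
  have : (ε : ℚ) = ε.num / ε.den := by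
    conv_lhs => rw [← NNRat.num_div_den ε]
    push_cast
    rfl
  rw [this, word_zero, word_one]
  push_cast
  rfl

/-! ### The prices of the output -/

/-- The payment function that goes with the set `W` of winners: the least total valuation of a set
of winners whose intervals cover the given edges. -/
noncomputable def coverPricing (I : Highway) (ε : ℚ≥0) (W : Finset ℕ) (S : Finset (Fin I.n)) : ℝ :=
  (price (seg (Algo.lo (I.word ε)) (Algo.hi (I.word ε))) (u (I.word ε))
    (Finset.range (Algo.m (I.word ε))) W (S.map Fin.valEmbedding) : ℝ) / denProd (I.word ε)

/-- The winners in `W` receive their intervals. -/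
def allocation (I : Highway) (W : Finset ℕ) (i : Fin I.m) : Finset (Fin I.n) :=
  if (i : ℕ) ∈ W then I.bundle i else ∅

theorem allocation_ne_empty {W : Finset ℕ} {i : Fin I.m} : I.allocation W i ≠ ∅ ↔ (i : ℕ) ∈ W := by
  rw [allocation]
  split_ifs with h <;> simp [h, bundle_ne_empty]

theorem coverPricing_nonneg (W : Finset ℕ) (S : Finset (Fin I.n)) :
    0 ≤ coverPricing I ε W S := by
  unfold coverPricing
  positivity

theorem coverPricing_empty (W : Finset ℕ) : coverPricing I ε W ∅ = 0 := by
  rw [coverPricing, Finset.map_empty, price_empty, Nat.cast_zero, zero_div]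

theorem isMonotonePricing_coverPricing (W : Finset ℕ) :
    IsMonotonePricing (coverPricing I ε W) := by
  intro S K hSK
  unfold coverPricing
  rw [← Finset.sum_div]
  refine div_le_div_of_nonneg_right ?_ (Nat.cast_nonneg _)
  have h1 : S.map Fin.valEmbedding ⊆ K.biUnion fun T => T.map Fin.valEmbedding := by
    intro x hx
    obtain ⟨e, he, rfl⟩ := Finset.mem_map.1 hx
    obtain ⟨T, hT, heT⟩ := Finset.mem_biUnion.1 (hSK he)
    exact Finset.mem_biUnion.2 ⟨T, hT, Finset.mem_map_of_mem _ heT⟩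
  exact_mod_cast (price_mono h1).trans (price_biUnion_le _ _)

theorem isMultiEnvyFree_coverPricing {C : ℕ} (h : Ok C (I.word ε)) {W : Finset ℕ}
    (hW : Stable (Algo.m (I.word ε)) (Algo.lo (I.word ε)) (Algo.hi (I.word ε)) (u (I.word ε)) W) :
    IsMultiEnvyFree I.valuation (I.allocation W) (coverPricing I ε W) := by
  have hD : (0 : ℝ) < denProd (I.word ε) := by exact_mod_cast denProd_pos h
  have hmono := isMonotonePricing_coverPricing (I := I) (ε := ε) W
  have hv : ∀ i, I.valuation i ∅ = 0 := fun i =>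
    if_neg fun hs => bundle_ne_empty i (Finset.subset_empty.1 hs)
  have hz0 : ∀ i, 0 ≤ maxUtility (I.valuation i) (coverPricing I ε W) := fun i => by
    have := le_maxUtility (I.valuation i) (coverPricing I ε W) ∅
    rwa [hv, coverPricing_empty, sub_zero] at this
  -- the best choice of an agent is its own interval or nothing
  have hz : ∀ i, maxUtility (I.valuation i) (coverPricing I ε W) ≤
      max (((I.val i : ℚ) : ℝ) - coverPricing I ε W (I.bundle i)) 0 := fun i => by
    refine Finset.sup'_le _ _ fun S _ => ?_
    rw [valuation]
    split_ifs with hS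
    · exact le_max_of_le_left (sub_le_sub_left (hmono.mono hS) _)
    · exact le_max_of_le_right (by linarith [coverPricing_nonneg (ε := ε) W S])
  have hvb : ∀ i, I.valuation i (I.bundle i) = ((I.val i : ℚ) : ℝ) := fun i =>
    if_pos (Finset.Subset.refl _)
  have hwin : ∀ i : Fin I.m, (i : ℕ) ∈ W →
      I.allocation W i ∈ demand (I.valuation i) (coverPricing I ε W) := by
    intro i hi
    rw [allocation, if_pos hi, demand, Set.mem_ofPred_eq]
    refine le_antisymm (le_maxUtility _ _ _) ((hz i).trans ?_)
    rw [hvb, max_eq_left]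
    have h1 : price (seg (Algo.lo (I.word ε)) (Algo.hi (I.word ε))) (u (I.word ε))
        (Finset.range (Algo.m (I.word ε))) W (seg (Algo.lo (I.word ε)) (Algo.hi (I.word ε)) i) ≤
        u (I.word ε) i := price_bundle_le hi
    rw [sub_nonneg, coverPricing, map_bundle, div_le_iff₀ hD, ← u_word h]
    exact_mod_cast h1
  have hlose : ∀ i : Fin I.m, (i : ℕ) ∉ W →
      I.allocation W i = ∅ ∧ maxUtility (I.valuation i) (coverPricing I ε W) = 0 := by
    intro i hi
    refine ⟨if_neg hi, le_antisymm ((hz i).trans ?_) (hz0 i)⟩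
    have h1 := hW i i.2 hi
    rw [max_eq_right]
    rw [sub_nonpos, coverPricing, map_bundle, le_div_iff₀ hD, ← u_word h]
    exact_mod_cast h1
  refine ⟨⟨fun i hi => ?_, fun i _ => ?_, fun i hi => absurd hi (hz0 i).not_gt⟩, hmono⟩
  · by_cases hiW : (i : ℕ) ∈ W
    · exact hwin i hiW
    · exact absurd (hlose i hiW).2 hi.ne'
  · by_cases hiW : (i : ℕ) ∈ W
    · exact Or.inl (hwin i hiW)
    · exact Or.inr (hlose i hiW).1

theorem sum_filter_val {M : Type*} [AddCommMonoid M] {m : ℕ} {W : Finset ℕ}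
    (hW : W ⊆ Finset.range m) (f : ℕ → M) :
    ∑ i ∈ Finset.univ.filter (fun i : Fin m => (i : ℕ) ∈ W), f i = ∑ i ∈ W, f i := by
  have : W = (Finset.univ.filter fun i : Fin m => (i : ℕ) ∈ W).map Fin.valEmbedding := by
    ext k
    rw [Finset.mem_map]
    constructor
    · exact fun hk => ⟨⟨k, Finset.mem_range.1 (hW hk)⟩, by simpa using hk, rfl⟩
    · rintro ⟨i, hi, rfl⟩
      exact (Finset.mem_filter.1 hi).2
  conv_rhs => rw [this, Finset.sum_map]
  rfl

theorem revenue_coverPricing {W : Finset ℕ} (hW : W ⊆ Finset.range (Algo.m (I.word ε))) :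
    revenue (I.allocation W) (coverPricing I ε W) =
      ((∑ i ∈ W, price (seg (Algo.lo (I.word ε)) (Algo.hi (I.word ε))) (u (I.word ε))
        (Finset.range (Algo.m (I.word ε))) W
        (seg (Algo.lo (I.word ε)) (Algo.hi (I.word ε)) i) : ℕ) : ℝ) / denProd (I.word ε) := by
  rw [revenue, Nat.cast_sum, Finset.sum_div, ← sum_filter_val hW]
  refine Finset.sum_congr (Finset.filter_congr fun i _ => allocation_ne_empty) fun i hi => ?_
  rw [allocation, if_pos (Finset.mem_filter.1 hi).2, coverPricing, map_bundle]

theorem feasible_allocation {W : Finset ℕ} (hW : LoadOk (I.word ε) W) :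
    I.Feasible (I.allocation W) := by
  intro e
  refine le_trans ?_ ((hW e e.2).trans_eq (I.cap_word ε e))
  rw [← Finset.card_map Fin.valEmbedding]
  refine Finset.card_le_card fun k hk => ?_
  obtain ⟨i, hi, rfl⟩ := Finset.mem_map.1 hk
  have hi := (Finset.mem_filter.1 hi).2
  have hiW : (i : ℕ) ∈ W := allocation_ne_empty.1 (Finset.ne_empty_of_mem hi)
  rw [allocation, if_pos hiW, bundle, Finset.mem_Icc] at hi
  refine Finset.mem_filter.2 ⟨hiW, ?_⟩
  rw [Fin.valEmbedding_apply, lo_word, hi_word]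
  exact hi

/-! ### Comparison with an arbitrary envy-free pricing -/

/-- The edges from `l` to `y - 1`. -/
def stretch (I : Highway) (l y : ℕ) : Finset (Fin I.n) :=
  Finset.univ.filter fun e => l ≤ (e : ℕ) ∧ (e : ℕ) < y

theorem stretch_bundle (i : Fin I.m) : I.stretch (I.lo i) (I.hi i + 1) = I.bundle i := by
  ext e
  rw [stretch, bundle, Finset.mem_filter, Finset.mem_Icc, Fin.le_def, Fin.le_def]
  simp only [Finset.mem_univ, true_and]
  omega

/-- The agents that receive their interval. -/
def served (I : Highway) (a : Fin I.m → Finset (Fin I.n)) : Finset ℕ :=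
  (Finset.univ.filter fun i => I.bundle i ⊆ a i).map Fin.valEmbedding

theorem mem_served {a : Fin I.m → Finset (Fin I.n)} {k : ℕ} :
    k ∈ I.served a ↔ ∃ i : Fin I.m, I.bundle i ⊆ a i ∧ (i : ℕ) = k := by
  simp [served]

/-- A multi envy free pricing gives a candidate: `i` is priced on the initial segments of its bundle.
Monotonicity of `p` makes an increment inside the bundle of `k` cost at most the payment of `k`,
hence at most the valuation of `k`. -/
theorem candidate_served [Nonempty (Fin I.n)] {C : ℕ} (h : Ok C (I.word ε))
    {a : Fin I.m → Finset (Fin I.n)} {p : Finset (Fin I.n) → ℝ} (ha : I.Feasible a)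
    (hp : IsMultiEnvyFree I.valuation a p) :
    Candidate (I.word ε) (I.served a) fun i x =>
      p (I.stretch (Algo.lo (I.word ε) i) x) * denProd (I.word ε) where
  subset k hk := by
    obtain ⟨i, -, rfl⟩ := mem_served.1 hk
    exact Finset.mem_range.2 i.2
  load x hx := by
    refine le_trans ?_ ((ha ⟨x, hx⟩).trans_eq (I.cap_word ε ⟨x, hx⟩).symm)
    rw [← Finset.card_map Fin.valEmbedding]
    refine Finset.card_le_card fun k hk => ?_
    obtain ⟨hk, h1, h2⟩ := Finset.mem_filter.1 hk
    obtain ⟨i, hi, rfl⟩ := mem_served.1 hk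
    rw [lo_word] at h1
    rw [hi_word] at h2
    exact Finset.mem_map_of_mem _ (Finset.mem_filter.2 ⟨Finset.mem_univ _,
      hi (Finset.mem_Icc.2 ⟨h1, h2⟩)⟩)
  mono i _ x y hxy := by
    refine mul_le_mul_of_nonneg_right (hp.2.mono fun e he => ?_) (Nat.cast_nonneg _)
    rw [stretch, Finset.mem_filter] at he ⊢
    exact ⟨he.1, he.2.1, he.2.2.trans_le hxy⟩
  zero i _ := by
    have : I.stretch (Algo.lo (I.word ε) i) (Algo.lo (I.word ε) i) = ∅ := by
      refine Finset.filter_false_of_mem fun e _ => ?_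
      omega
    change p (I.stretch _ _) * _ = 0
    rw [this, hp.2.empty, zero_mul]
  le_add i _ k hk x y h1 h2 h3 := by
    obtain ⟨k, hkb, rfl⟩ := mem_served.1 hk
    rw [lo_word] at h1
    rw [hi_word] at h3
    have h4 : I.stretch (Algo.lo (I.word ε) i) y ⊆
        I.stretch (Algo.lo (I.word ε) i) x ∪ I.bundle k := by
      intro e he
      rw [stretch, Finset.mem_filter] at he
      rw [Finset.mem_union, stretch, Finset.mem_filter, bundle, Finset.mem_Icc, Fin.le_def,
        Fin.le_def]
      simp only [Finset.mem_univ, true_and] at he ⊢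
      omega
    have hne : a k ≠ ∅ := fun h0 =>
      bundle_ne_empty k (Finset.subset_empty.1 (h0 ▸ hkb))
    have h5 := (hp.1.sub_le hne ∅).2
    rw [valuation, if_pos hkb] at h5
    have h6 : p (I.stretch (Algo.lo (I.word ε) i) y) ≤
        p (I.stretch (Algo.lo (I.word ε) i) x) + ((I.val k : ℚ) : ℝ) := by
      have h7 := (hp.2.mono h4).trans (hp.2.union _ _)
      have h8 := hp.2.mono hkb
      linarith
    rw [u_word h, ← add_mul]
    exact mul_le_mul_of_nonneg_right h6 (Nat.cast_nonneg _)

/-- Winners that are not served their bundle value what they receive at zero, so they pay at most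
zero. -/
theorem revenue_le [Nonempty (Fin I.n)] {a : Fin I.m → Finset (Fin I.n)}
    {p : Finset (Fin I.n) → ℝ} (hp : IsMultiEnvyFree I.valuation a p) :
    revenue a p * denProd (I.word ε) ≤ ∑ i ∈ I.served a,
      p (I.stretch (Algo.lo (I.word ε) i) (Algo.hi (I.word ε) i + 1)) * denProd (I.word ε) := by
  rw [← Finset.sum_mul]
  refine mul_le_mul_of_nonneg_right ?_ (Nat.cast_nonneg _)
  rw [served, Finset.sum_map, revenue, ← Finset.sum_filter_add_sum_filter_not _
    (fun i => I.bundle i ⊆ a i) (fun i => p (a i))]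
  have h1 : ∑ i ∈ (Finset.univ.filter fun i => a i ≠ ∅).filter (fun i => ¬ I.bundle i ⊆ a i),
      p (a i) ≤ 0 := by
    refine Finset.sum_nonpos fun i hi => ?_
    obtain ⟨hi, hb⟩ := Finset.mem_filter.1 hi
    have h2 := (hp.1.sub_le (Finset.mem_filter.1 hi).2 ∅).2
    rw [valuation, if_neg hb] at h2
    linarith
  refine (add_le_of_nonpos_right h1).trans ?_
  rw [Finset.filter_filter]
  refine le_trans (Finset.sum_le_sum_of_subset_of_nonneg (fun i hi => Finset.mem_filter.2
    ⟨Finset.mem_univ _, (Finset.mem_filter.1 hi).2.2⟩) fun i _ _ => hp.2.nonneg _)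
    (Finset.sum_le_sum fun i hi => ?_)
  have hb := (Finset.mem_filter.1 hi).2
  have hne : a i ≠ ∅ := fun h0 => bundle_ne_empty i (Finset.subset_empty.1 (h0 ▸ hb))
  have h2 := (hp.1.sub_le hne (I.bundle i)).1
  rw [valuation, if_pos (Finset.Subset.refl _), valuation, if_pos hb] at h2
  rw [Fin.valEmbedding_apply, lo_word, hi_word, stretch_bundle]
  linarith

/-- The revenue of the set of winners found by the algorithm is nearly optimal. -/
theorem one_sub_mul_revenue_le {C : ℕ} (h : Ok C (I.word ε)) {W : Finset ℕ}
    (hW : W ⊆ Finset.range (Algo.m (I.word ε)))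
    (hopt : ∀ W' π, Candidate (I.word ε) W' π →
      (1 - (I.word ε 0 : ℝ) / I.word ε 1) * ∑ i ∈ W', π i (Algo.hi (I.word ε) i + 1) ≤
        (∑ i ∈ W, price (seg (Algo.lo (I.word ε)) (Algo.hi (I.word ε))) (u (I.word ε))
          (Finset.range (Algo.m (I.word ε))) W
          (seg (Algo.lo (I.word ε)) (Algo.hi (I.word ε)) i) : ℕ))
    {a : Fin I.m → Finset (Fin I.n)} {p : Finset (Fin I.n) → ℝ} (ha : I.Feasible a)
    (hp : IsMultiEnvyFree I.valuation a p) :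
    (1 - ((ε : ℚ) : ℝ)) * revenue a p ≤ revenue (I.allocation W) (coverPricing I ε W) := by
  have hD : (0 : ℝ) < denProd (I.word ε) := by exact_mod_cast denProd_pos h
  have h0 : 0 ≤ revenue (I.allocation W) (coverPricing I ε W) :=
    Finset.sum_nonneg fun i _ => coverPricing_nonneg W _
  rcases isEmpty_or_nonempty (Fin I.n) with hn | hn
  · have : revenue a p = 0 := Finset.sum_eq_zero fun i _ => hn.elim (I.lo i)
    rw [this, mul_zero]
    exact h0
  have hr : 0 ≤ revenue a p := Finset.sum_nonneg fun i _ => hp.2.nonneg _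
  rcases le_total (1 - ((ε : ℚ) : ℝ)) 0 with h1 | h1
  · exact (mul_nonpos_of_nonpos_of_nonneg h1 hr).trans h0
  rw [revenue_coverPricing hW, le_div_iff₀ hD, mul_assoc]
  refine le_trans (mul_le_mul_of_nonneg_left (revenue_le hp) h1) ?_
  rw [← eps_word]
  exact hopt _ _ (candidate_served h ha hp)

/-! ### The output of the program -/

theorem outputAllocation_eq {C : ℕ} (h : Ok C (I.word ε)) {W : Finset ℕ}
    (hW : final C (I.word ε) = mask W) {μ : RAM.Memory}
    (hμ : ∀ k < 2 * I.m, μ k = outVal C (I.word ε) k) : I.outputAllocation μ = I.allocation W := by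
  funext i
  have hD := denProd_pos h
  have h1 : μ (2 * i + 1) = if (i : ℕ) ∈ W then denProd (I.word ε) else 0 := by
    have hi := i.2
    rw [hμ _ (by omega), outVal, hW, show (2 * (i : ℕ) + 1) / 2 = i by omega,
      show (2 * (i : ℕ) + 1) % 2 = 1 by omega, if_neg one_ne_zero]
    exact if_congr (mask_digit_ne_zero W i) rfl rfl
  rw [outputAllocation, allocation, h1]
  by_cases hi : (i : ℕ) ∈ W
  · rw [if_pos hi, if_pos hi, if_neg hD.ne']
  · rw [if_neg hi, if_neg hi, if_pos rfl]

theorem agreesWithOutput_coverPricing {C : ℕ} (h : Ok C (I.word ε)) {W : Finset ℕ}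
    (hWm : W ⊆ Finset.range (Algo.m (I.word ε)))
    (hW : final C (I.word ε) = mask W) {μ : RAM.Memory}
    (hμ : ∀ k < 2 * I.m, μ k = outVal C (I.word ε) k) :
    I.AgreesWithOutput μ (coverPricing I ε W) := by
  intro i hi
  rw [outputAllocation_eq h hW hμ] at hi ⊢
  have hiW := allocation_ne_empty.1 hi
  have hd := (mask_digit_ne_zero W i).2 hiW
  have hi' := i.2
  rw [outputPayment, hμ _ (by omega), hμ _ (by omega), outVal, outVal, hW,
    show (2 * (i : ℕ) + 1) / 2 = i by omega, show (2 * (i : ℕ) + 1) % 2 = 1 by omega,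
    show 2 * (i : ℕ) / 2 = i by omega, show 2 * (i : ℕ) % 2 = 0 by omega, if_neg one_ne_zero,
    if_pos rfl, if_pos hd, if_pos hd, coverValue_div hWm hiW, allocation, if_pos hiW, coverPricing,
    map_bundle]
  push_cast
  rfl

end Highway

theorem mainTheorem2 (C : ℕ) :
    ∃ (prog : RAM.Program) (P : Polynomial ℕ),
      ∀ (I : Highway) (ε : ℚ≥0), 0 < ε → (∀ e, I.cap e ≤ C) →
        ∃ (μ : RAM.Memory) (t : ℕ),
          RAM.Exec prog (RAM.initial (I.encode ε)) μ t ∧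
          t ≤ P.eval (I.inputSize ε + ⌈(1 / ε : ℚ≥0)⌉₊) ∧
          I.Feasible (I.outputAllocation μ) ∧
          ∃ p : Finset (Fin I.n) → ℝ,
            I.AgreesWithOutput μ p ∧
            Auction.IsMultiEnvyFree I.valuation (I.outputAllocation μ) p ∧
            ∀ (a' : Fin I.m → Finset (Fin I.n)) (p' : Finset (Fin I.n) → ℝ),
              I.Feasible a' → Auction.IsMultiEnvyFree I.valuation a' p' →
                (1 - ((ε : ℚ) : ℝ)) * Auction.revenue a' p' ≤
                  Auction.revenue (I.outputAllocation μ) p := by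
  obtain ⟨prog, c, hprog⟩ := Tab.exists_program (Algo.steps C) 6 23 (Algo.steps_tgt C)
    (show 7 < 1 + 23 by decide) (show 23 < 1 + 23 by decide)
  refine ⟨prog, Polynomial.C c * ((Polynomial.X + 2) ^ (4 * (C + C * C) + 4) + 1) ^ c *
    ((Polynomial.X + 2) ^ 4 * Polynomial.C (4 * (C + C * C) + 9) + 1), fun I ε hε hC => ?_⟩
  have hok := Highway.ok_word hε hC
  have hsmall := Highway.small_word (I := I) hε
  set s := I.inputSize ε + ⌈(1 / ε : ℚ≥0)⌉₊ with hs
  have hlen := I.length_encode ε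
  have hlen_le : (I.encode ε).length ≤ Algo.parBound C s := by
    refine (Highway.length_le_inputSize.trans ?_).trans (Nat.le_self_pow (by omega) (s + 2))
    omega
  obtain ⟨μ, t, hexec, ht, hμ⟩ := hprog (I.encode ε) I.n I.m (Algo.bitBound C s)
    (Algo.parBound C s) (Algo.arr C (I.word ε)) hlen rfl rfl (fun k => rfl)
    (Algo.arr_bounded hsmall C) hlen_le (Algo.parBound_size_le C s) (Algo.steps_holds hok)
    (show 2 * I.m ≤ _ by omega)
  replace hμ : ∀ k < 2 * I.m, μ k = Algo.outVal C (I.word ε) k := fun k hk =>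
    (hμ k hk).trans ((congrFun (Algo.arr_23 C _) k).trans (Tab.cut_of_lt hk))
  obtain ⟨W, hWm, hfin, hstable, hload, hopt⟩ := Algo.one_sub_mul_le hok
  have hout := Highway.outputAllocation_eq hok hfin hμ
  refine ⟨μ, t, hexec, ht.trans_eq ?_, ?_, Highway.coverPricing I ε W,
    Highway.agreesWithOutput_coverPricing hok hWm hfin hμ, ?_, fun a' p' ha' hp' => ?_⟩
  · simp [Tab.timeBound, Algo.parBound, Algo.bitBound]
  · rw [hout]
    exact Highway.feasible_allocation hload
  · rw [hout]
    exact Highway.isMultiEnvyFree_coverPricing hok hstable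
  · rw [hout]
    exact Highway.one_sub_mul_revenue_le hok hWm hopt ha' hp'
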